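/- Let $(M,J)$ be a smooth almost complex manifold, $(\Sigma,j)$ a closed surface with a smooth almost complex structure, and $u:\Sigma\to M$ a regular pseudoholomorphic curve, i.e. a smooth immersion with $J\circ du=du\circ j$ (in particular, $u$ may be an embedding onto a pseudoholomorphic curve $L=u(\Sigma)$). Let $N=u^*TM/du(T\Sigma)$ be its normal bundle (so $N=N_LM$ if $u$ is an embedding), with projection $v\mapsto[v]$ from $u^*TM$. For a complex vector bundle $E$ over $\Sigma$ let $\Omega^{0,1}(E)$ be the space of smooth $E$-valued one-forms $\alpha$ with $\alpha\circ j=-J\circ\alpha$. *Gromov's operator.* $D_u:C^\infty(u^*TM)\to\Omega^{0,1}(u^*TM)$ is the linearization at $u$ of $\bar\partial_J f=\frac12(df+J\circ df\circ j)$: $D_u(v)$ is the derivative at $t=0$ of $\bar\partial_J(u_t)$ for any smooth (local) family $u_t$ with $u_0=u$ and $\partial_t u_t|_{t=0}=v$. *The NB-II structure.* Let $R^t$ denote multiplication by $t$ in the fibres of $N$. For a smooth map $\varphi$ to $M$ from a neighbourhood in $N$ of a point of the zero section such that $\varphi=u$ on the zero section and $\frac{d}{dt}\big|_{t=0}\varphi(tn)$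 represents $n$ for every $n$ in the fibres of $N$ near that point, put $J^\varphi=\varphi_*^{-1}J\varphi_*$. The NB-II structure $\check J$ is the field of endomorphisms of the tangent spaces of the total space of $N$ given at each point by $$\check J=\lim_{t\to0}R^{1/t}_*\,J^\varphi\,R^t_* .$$ *The Cauchy–Riemann operator of $\check J$.* For a smooth section $s$ of $N$, $\bar\partial_{\check J}s=\frac12(ds+\check J\circ ds\circ j)$, where $s$ is regarded as a map from $\Sigma$ to the total space of $N$ and vertical tangent vectors are identified with vectors of the fibres of $N$. **Proposition.** 1. $D_u$ is a well-defined linear operator $C^\infty(u^*TM)\to\Omega^{0,1}(u^*TM)$. The limit $\check J$ exists, does not depend on $\varphi$, and satisfies $\check J^2=-1$. 2. $D_u$ descends to the normal bundle: for every smooth vector field $X$ on $\Sigma$ one has $D_u(du(X))=du(\bar\partial X)$, where $\bar\partial$ is the Cauchy–Riemann operator of $T\Sigma$, $(\bar\partial X)(Z)=\frac12([Z,X]+j[jZ,X])$; and there is exactly one linear operator $\check D_u:C^\infty(N)\to\Omega^{0,1}(N)$ with $\check D_u([v])=[D_u(v)]$ for all $v\in C^\infty(u^*TM)$. 3. $\check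 D_u=\bar\partial_{\check J}$: for every smooth section $s$ of $N$ the vectors $\frac12(ds+\check J\circ ds\circ j)(\zeta)$ are vertical and equal to $\check D_u(s)(\zeta)$. -/

import Mathlib

open Bundle Set Filter Topology Manifold ContDiff

/-- The real plane, the model space of surfaces. -/
abbrev Plane : Type := EuclideanSpace ℝ (Fin 2)

/-- A smooth immersion of a surface `S` into a manifold `M`. -/
structure SmoothImmersion (S : Type*) [TopologicalSpace S] [ChartedSpace Plane S]
    (E : Type*) [NormedAddCommGroup E] [NormedSpace ℝ E]
    (M : Type*) [TopologicalSpace M] [ChartedSpace E M] where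
  toMap : C^∞⟮𝓘(ℝ, Plane), S; 𝓘(ℝ, E), M⟯
  injective_mfderiv : ∀ z : S, Function.Injective (mfderiv 𝓘(ℝ, Plane) 𝓘(ℝ, E) toMap z)

/-- Smooth vector fields on a surface. -/
abbrev VectorFields (S : Type*) [TopologicalSpace S] [ChartedSpace Plane S]
    [IsManifold 𝓘(ℝ, Plane) ∞ S] : Type _ :=
  Cₛ^∞⟮𝓘(ℝ, Plane); Plane, (TangentSpace 𝓘(ℝ, Plane) : S → Type _)⟯

namespace SmoothImmersion

noncomputable section

variable {S : Type*} [TopologicalSpace S] [ChartedSpace Plane S]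
  {E : Type*} [NormedAddCommGroup E] [NormedSpace ℝ E]
  {M : Type*} [TopologicalSpace M] [ChartedSpace E M]

/-- The pullback bundle `u^*TM`. -/
abbrev Pull (u : SmoothImmersion S E M) : S → Type _ :=
  u.toMap *ᵖ (TangentSpace 𝓘(ℝ, E) : M → Type _)

instance (u : SmoothImmersion S E M) (z : S) : AddCommGroup (u.Pull z) :=
  inferInstanceAs (AddCommGroup (TangentSpace 𝓘(ℝ, E) (u.toMap z)))

instance (u : SmoothImmersion S E M) (z : S) : IsTopologicalAddGroup (u.Pull z) :=
  inferInstanceAs (IsTopologicalAddGroup (TangentSpace 𝓘(ℝ, E) (u.toMap z)))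

instance (u : SmoothImmersion S E M) (z : S) : ContinuousSMul ℝ (u.Pull z) :=
  inferInstanceAs (ContinuousSMul ℝ (TangentSpace 𝓘(ℝ, E) (u.toMap z)))

/-- The differential `du_z : T_z S → T_{u(z)} M`. -/
def d (u : SmoothImmersion S E M) (z : S) : TangentSpace 𝓘(ℝ, Plane) z →L[ℝ] u.Pull z :=
  mfderiv 𝓘(ℝ, Plane) 𝓘(ℝ, E) u.toMap z

/-- The fibre `T_{u(z)} M / du(T_z S)` of the normal bundle of `u`. -/
abbrev Normal (u : SmoothImmersion S E M) (z : S) : Type _ :=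
  u.Pull z ⧸ (u.d z).range

/-- The projection `T_{u(z)} M → T_{u(z)} M / du(T_z S)`. -/
abbrev proj (u : SmoothImmersion S E M) (z : S) :
    u.Pull z →L[ℝ] u.Normal z :=
  (u.d z).range.mkQL

variable [IsManifold 𝓘(ℝ, E) ∞ M] [IsManifold 𝓘(ℝ, Plane) ∞ S]

theorem contMDiff_d (u : SmoothImmersion S E M) :
    ContMDiff 𝓘(ℝ, Plane) (𝓘(ℝ, Plane).prod 𝓘(ℝ, Plane →L[ℝ] E)) ∞
      (fun z : S => TotalSpace.mk' (Plane →L[ℝ] E)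
        (E := fun z : S => TangentSpace 𝓘(ℝ, Plane) z →L[ℝ] u.Pull z) z (u.d z)) := by
  intro z₀
  rw [contMDiffAt_hom_bundle]
  refine ⟨contMDiffAt_id, ?_⟩
  exact (u.toMap.contMDiff z₀).mfderiv_const (m := ∞) le_rfl

theorem contMDiff_push (u : SmoothImmersion S E M) (X : VectorFields S) :
    ContMDiff 𝓘(ℝ, Plane) (𝓘(ℝ, Plane).prod 𝓘(ℝ, E)) ∞
      (fun z => TotalSpace.mk' E (E := u.Pull) z (u.d z (X z))) :=
  u.contMDiff_d.clm_bundle_apply X.contMDiff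

/-! ### The normal bundle as a smooth vector bundle -/

/-- The matrix of `du_z` in the local trivializations around `z₀`. -/
def localD (u : SmoothImmersion S E M) (z₀ z : S) : Plane →L[ℝ] E :=
  ((trivializationAt E u.Pull z₀).continuousLinearMapAt ℝ z).comp
    ((u.d z).comp
      ((trivializationAt Plane (TangentSpace 𝓘(ℝ, Plane)) z₀).symmL ℝ z))

/-- The common domain of the local trivializations of `TS` and `u^*TM` around `z₀`. -/
def trivDomain (u : SmoothImmersion S E M) (z₀ : S) : Set S :=
  (trivializationAt Plane (TangentSpace 𝓘(ℝ, Plane)) z₀ :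
    Trivialization Plane (π Plane (TangentSpace 𝓘(ℝ, Plane) : S → Type _))).baseSet ∩
  (trivializationAt E u.Pull z₀).baseSet

theorem isOpen_trivDomain (u : SmoothImmersion S E M) (z₀ : S) : IsOpen (u.trivDomain z₀) :=
  (Trivialization.open_baseSet _).inter (Trivialization.open_baseSet _)

theorem mem_trivDomain (u : SmoothImmersion S E M) (z₀ : S) : z₀ ∈ u.trivDomain z₀ :=
  ⟨mem_baseSet_trivializationAt _ _ _, mem_baseSet_trivializationAt _ _ _⟩

theorem contMDiffOn_localD (u : SmoothImmersion S E M) (z₀ : S) :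
    ContMDiffOn 𝓘(ℝ, Plane) 𝓘(ℝ, Plane →L[ℝ] E) ∞ (u.localD z₀) (u.trivDomain z₀) := by
  have h := u.contMDiff_d
  exact ((((trivializationAt Plane (TangentSpace 𝓘(ℝ, Plane)) z₀).continuousLinearMap
    (RingHom.id ℝ) (trivializationAt E u.Pull z₀)).contMDiffOn_section_baseSet_iff).1
      h.contMDiffOn)

theorem injective_localD (u : SmoothImmersion S E M) {z₀ z : S} (hz : z ∈ u.trivDomain z₀) :
    Function.Injective (u.localD z₀ z) := by
  intro x y hxy
  have h1 := (Trivialization.continuousLinearEquivAt ℝ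
    (trivializationAt E u.Pull z₀) z hz.2).injective
  have h2 := (Trivialization.continuousLinearEquivAt ℝ
    (trivializationAt Plane (TangentSpace 𝓘(ℝ, Plane)) z₀) z hz.1).symm.injective
  have hd : Function.Injective (u.d z) := u.injective_mfderiv z
  apply h2
  apply hd
  apply h1
  simpa only [localD, ContinuousLinearMap.comp_apply, Trivialization.continuousLinearEquivAt_apply,
    Trivialization.continuousLinearMapAt_apply, Trivialization.coe_linearMapAt_of_mem _ hz.2,
    Trivialization.symm_continuousLinearEquivAt_eq _ hz.1] using hxy

variable [FiniteDimensional ℝ E]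

/-- The model fibre of the normal bundle. -/
abbrev Fib (E : Type*) [NormedAddCommGroup E] [NormedSpace ℝ E] : Type :=
  EuclideanSpace ℝ (Fin (Module.finrank ℝ E - 2))

theorem exists_frame (A : Plane →L[ℝ] E) (hA : Function.Injective A) :
    ∃ f : (Plane × Fib E) ≃L[ℝ] E, ∀ x, f (x, 0) = A x := by
  obtain ⟨C, hC⟩ := Submodule.exists_isCompl (LinearMap.range (A : Plane →ₗ[ℝ] E))
  have h1 : Module.finrank ℝ (LinearMap.range (A : Plane →ₗ[ℝ] E)) = 2 := by
    rw [LinearMap.finrank_range_of_inj hA]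
    simp
  have h2 : Module.finrank ℝ (Fib E) = Module.finrank ℝ C := by
    have := Submodule.finrank_add_eq_of_isCompl hC
    simp only [finrank_euclideanSpace, Fintype.card_fin]
    omega
  let e₁ : Plane ≃ₗ[ℝ] LinearMap.range (A : Plane →ₗ[ℝ] E) := LinearEquiv.ofInjective _ hA
  let e₂ : Fib E ≃ₗ[ℝ] C := LinearEquiv.ofFinrankEq _ _ h2
  refine ⟨((LinearEquiv.prodCongr e₁ e₂).trans
    (Submodule.prodEquivOfIsCompl _ _ hC)).toContinuousLinearEquiv, fun x => ?_⟩
  simp [e₁]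

/-- A linear frame of the model space extending `du` at `z₀`. -/
def frame (u : SmoothImmersion S E M) (z₀ : S) : (Plane × Fib E) ≃L[ℝ] E :=
  (exists_frame (u.localD z₀ z₀) (u.injective_localD (u.mem_trivDomain z₀))).choose

theorem frame_apply (u : SmoothImmersion S E M) (z₀ : S) (x : Plane) :
    u.frame z₀ (x, 0) = u.localD z₀ z₀ x :=
  (exists_frame (u.localD z₀ z₀) (u.injective_localD (u.mem_trivDomain z₀))).choose_spec x

/-- The inclusion of the model fibre as a complement of `du` near `z₀`. -/
def incl (u : SmoothImmersion S E M) (z₀ : S) : Fib E →L[ℝ] E :=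
  (u.frame z₀ : (Plane × Fib E) →L[ℝ] E).comp (ContinuousLinearMap.inr ℝ Plane (Fib E))

/-- The moving frame `(x, y) ↦ du_z x + incl y`. -/
def localFrame (u : SmoothImmersion S E M) (z₀ z : S) : (Plane × Fib E) →L[ℝ] E :=
  (u.localD z₀ z).comp (ContinuousLinearMap.fst ℝ Plane (Fib E)) +
    (u.incl z₀).comp (ContinuousLinearMap.snd ℝ Plane (Fib E))

theorem contMDiffOn_localFrame (u : SmoothImmersion S E M) (z₀ : S) :
    ContMDiffOn 𝓘(ℝ, Plane) 𝓘(ℝ, (Plane × Fib E) →L[ℝ] E) ∞ (u.localFrame z₀)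
      (u.trivDomain z₀) :=
  ((u.contMDiffOn_localD z₀).clm_comp contMDiffOn_const).add contMDiffOn_const

/-- The domain of the local trivialization of the normal bundle around `z₀`. -/
def normalDomain (u : SmoothImmersion S E M) (z₀ : S) : Set S :=
  u.trivDomain z₀ ∩ u.localFrame z₀ ⁻¹'
    range ((↑) : ((Plane × Fib E) ≃L[ℝ] E) → ((Plane × Fib E) →L[ℝ] E))

theorem isOpen_normalDomain (u : SmoothImmersion S E M) (z₀ : S) :
    IsOpen (u.normalDomain z₀) :=
  (u.contMDiffOn_localFrame z₀).continuousOn.isOpen_inter_preimage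
    (u.isOpen_trivDomain z₀) ContinuousLinearEquiv.isOpen

theorem mem_normalDomain (u : SmoothImmersion S E M) (z₀ : S) : z₀ ∈ u.normalDomain z₀ := by
  refine ⟨u.mem_trivDomain z₀, u.frame z₀, ?_⟩
  refine ContinuousLinearMap.ext fun p => ?_
  have h : p = (p.1, 0) + (0, p.2) := by simp
  conv_lhs => rw [h]
  rw [map_add]
  simp [localFrame, incl, frame_apply]

/-- The fibre coordinate on `T_{u(z)} M` modulo `du(T_z S)`. -/
def toFib (u : SmoothImmersion S E M) (z₀ z : S) : u.Pull z →L[ℝ] Fib E :=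
  (ContinuousLinearMap.snd ℝ Plane (Fib E)).comp
    ((u.localFrame z₀ z).inverse.comp
      ((trivializationAt E u.Pull z₀).continuousLinearMapAt ℝ z))

/-- The vector of `T_{u(z)} M` with given fibre coordinate. -/
def ofFib (u : SmoothImmersion S E M) (z₀ z : S) : Fib E →L[ℝ] u.Pull z :=
  ((trivializationAt E u.Pull z₀).symmL ℝ z).comp (u.incl z₀)

theorem continuousLinearMapAt_d (u : SmoothImmersion S E M) {z₀ z : S}
    (hz : z ∈ u.trivDomain z₀) (x : TangentSpace 𝓘(ℝ, Plane) z) :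
    (trivializationAt E u.Pull z₀).continuousLinearMapAt ℝ z (u.d z x) =
      u.localFrame z₀ z ((trivializationAt Plane
        (TangentSpace 𝓘(ℝ, Plane)) z₀).continuousLinearMapAt ℝ z x, 0) := by
  have h := Trivialization.symmL_continuousLinearMapAt (R := ℝ)
    (trivializationAt Plane (TangentSpace 𝓘(ℝ, Plane)) z₀) hz.1 x
  simp only [localFrame, add_apply, ContinuousLinearMap.comp_apply, localD,
    ContinuousLinearMap.coe_fst', ContinuousLinearMap.coe_snd', map_zero, add_zero]
  rw [h]

theorem toFib_d (u : SmoothImmersion S E M) {z₀ z : S} (hz : z ∈ u.normalDomain z₀)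
    (x : TangentSpace 𝓘(ℝ, Plane) z) : u.toFib z₀ z (u.d z x) = 0 := by
  have h := u.continuousLinearMapAt_d hz.1 x
  obtain ⟨f, hf⟩ := hz.2
  simp only [toFib, ContinuousLinearMap.comp_apply]
  rw [h, ← hf, ContinuousLinearMap.inverse_equiv]
  simp

theorem toFib_ofFib (u : SmoothImmersion S E M) {z₀ z : S} (hz : z ∈ u.normalDomain z₀)
    (y : Fib E) : u.toFib z₀ z (u.ofFib z₀ z y) = y := by
  have h := Trivialization.continuousLinearMapAt_symmL (R := ℝ)
    (trivializationAt E u.Pull z₀) hz.1.2 (u.incl z₀ y)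
  have h2 : u.incl z₀ y = u.localFrame z₀ z (0, y) := by simp [localFrame]
  obtain ⟨f, hf⟩ := hz.2
  simp only [toFib, ofFib, ContinuousLinearMap.comp_apply]
  rw [h, h2, ← hf, ContinuousLinearMap.inverse_equiv]
  simp

theorem ofFib_toFib (u : SmoothImmersion S E M) {z₀ z : S} (hz : z ∈ u.normalDomain z₀)
    (w : u.Pull z) : u.proj z (u.ofFib z₀ z (u.toFib z₀ z w)) = u.proj z w := by
  obtain ⟨f, hf⟩ := hz.2
  set e := trivializationAt E u.Pull z₀ with he
  set p := f.symm (e.continuousLinearMapAt ℝ z w) with hp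
  have h1 : e.continuousLinearMapAt ℝ z w = u.localD z₀ z p.1 + u.incl z₀ p.2 := by
    have : e.continuousLinearMapAt ℝ z w = (f : (Plane × Fib E) →L[ℝ] E) p := by simp [hp]
    rw [this, hf]
    simp [localFrame]
  have h2 : u.toFib z₀ z w = p.2 := by
    simp only [toFib, ContinuousLinearMap.comp_apply]
    rw [← hf, ContinuousLinearMap.inverse_equiv]
    rfl
  have h3 : w = e.symmL ℝ z (u.localD z₀ z p.1) + e.symmL ℝ z (u.incl z₀ p.2) := by
    rw [← map_add, ← h1]
    exact (e.symmL_continuousLinearMapAt hz.1.2 w).symm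
  have h4 : e.symmL ℝ z (u.localD z₀ z p.1) =
      u.d z ((trivializationAt Plane (TangentSpace 𝓘(ℝ, Plane)) z₀).symmL ℝ z p.1) := by
    simp only [localD, ContinuousLinearMap.comp_apply]
    exact e.symmL_continuousLinearMapAt hz.1.2 _
  rw [h2]
  refine ((Submodule.Quotient.eq _).2 ?_)
  refine ⟨-((trivializationAt Plane (TangentSpace 𝓘(ℝ, Plane)) z₀).symmL ℝ z p.1), ?_⟩
  rw [map_neg]
  change -(u.d z _) = _
  rw [← h4]
  rw [eq_sub_iff_add_eq, neg_add_eq_iff_eq_add]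
  exact h3

theorem toFib_out (u : SmoothImmersion S E M) {z₀ z : S} (hz : z ∈ u.normalDomain z₀)
    (w : u.Pull z) :
    u.toFib z₀ z (Quotient.out (u.proj z w) : u.Pull z) =
      u.toFib z₀ z w := by
  have h : u.proj z (Quotient.out (u.proj z w) : u.Pull z) =
      u.proj z w := Quotient.out_eq _
  rw [← u.toFib_ofFib hz (u.toFib z₀ z w), ← sub_eq_zero]
  obtain ⟨x, hx⟩ := (Submodule.Quotient.eq _).1 (h.trans (u.ofFib_toFib hz w).symm)
  have h' := u.toFib_d hz x
  rw [← map_sub]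
  rw [← h']
  exact congrArg (u.toFib z₀ z) hx.symm

/-- The local trivialization of the normal bundle around `z₀`. -/
def pretriv (u : SmoothImmersion S E M) (z₀ : S) :
    Pretrivialization (Fib E) (π (Fib E) u.Normal) where
  toFun p := (p.1, u.toFib z₀ p.1 (Quotient.out p.2 : u.Pull p.1))
  invFun q := ⟨q.1, u.proj q.1 (u.ofFib z₀ q.1 q.2)⟩
  source := π (Fib E) u.Normal ⁻¹' u.normalDomain z₀
  target := u.normalDomain z₀ ×ˢ univ
  baseSet := u.normalDomain z₀
  map_source' p hp := ⟨hp, mem_univ _⟩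
  map_target' q hq := hq.1
  left_inv' p hp := by
    obtain ⟨z, n⟩ := p
    have h := u.ofFib_toFib hp (Quotient.out n : u.Pull z)
    exact congrArg (TotalSpace.mk z) (h.trans (Quotient.out_eq n))
  right_inv' q hq := by
    obtain ⟨z, y⟩ := q
    exact Prod.ext rfl ((u.toFib_out hq.1 _).trans (u.toFib_ofFib hq.1 y))
  open_target := (u.isOpen_normalDomain z₀).prod isOpen_univ
  open_baseSet := u.isOpen_normalDomain z₀
  source_eq := rfl
  target_eq := rfl
  proj_toFun _ _ := rfl

theorem pretriv_apply (u : SmoothImmersion S E M) {z₀ z : S} (hz : z ∈ u.normalDomain z₀)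
    (w : u.Pull z) : u.pretriv z₀ ⟨z, u.proj z w⟩ = (z, u.toFib z₀ z w) :=
  Prod.ext rfl (u.toFib_out hz w)

theorem pretriv_symm (u : SmoothImmersion S E M) {z₀ z : S} (hz : z ∈ u.normalDomain z₀)
    (y : Fib E) : (u.pretriv z₀).symm z y = u.proj z (u.ofFib z₀ z y) := by
  have h := (u.pretriv z₀).mk_symm hz y
  exact TotalSpace.mk_injective z h

/-- The coordinate changes of the normal bundle. -/
def fibChange (u : SmoothImmersion S E M) (z₀ z₁ z : S) : Fib E →L[ℝ] Fib E :=
  (ContinuousLinearMap.snd ℝ Plane (Fib E)).comp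
    ((u.localFrame z₁ z).inverse.comp
      ((((trivializationAt E u.Pull z₀).coordChangeL ℝ (trivializationAt E u.Pull z₁) z :
        E ≃L[ℝ] E) : E →L[ℝ] E).comp (u.incl z₀)))

theorem fibChange_apply (u : SmoothImmersion S E M) {z₀ z₁ z : S}
    (hz : z ∈ u.normalDomain z₀ ∩ u.normalDomain z₁) (y : Fib E) :
    u.fibChange z₀ z₁ z y = (u.pretriv z₁ ⟨z, (u.pretriv z₀).symm z y⟩).2 := by
  rw [u.pretriv_symm hz.1, u.pretriv_apply hz.2]
  simp only [fibChange, toFib, ofFib, ContinuousLinearMap.comp_apply]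
  congr 2
  rw [ContinuousLinearEquiv.coe_coe, Trivialization.coordChangeL_apply _ _ ⟨hz.1.1.2, hz.2.1.2⟩,
    Trivialization.continuousLinearMapAt_apply, Trivialization.symmL_apply _ hz.1.1.2,
    Trivialization.coe_linearMapAt_of_mem _ hz.2.1.2]

theorem contMDiffOn_fibChange (u : SmoothImmersion S E M) (z₀ z₁ : S) :
    ContMDiffOn 𝓘(ℝ, Plane) 𝓘(ℝ, Fib E →L[ℝ] Fib E) ∞ (u.fibChange z₀ z₁)
      (u.normalDomain z₀ ∩ u.normalDomain z₁) := by
  have h1 : ContMDiffOn 𝓘(ℝ, Plane) 𝓘(ℝ, E →L[ℝ] (Plane × Fib E)) ∞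
      (fun z => (u.localFrame z₁ z).inverse) (u.normalDomain z₀ ∩ u.normalDomain z₁) := by
    intro z hz
    obtain ⟨f, hf⟩ := hz.2.2
    have h := (u.contMDiffOn_localFrame z₁ z hz.2.1).mono
      (inter_subset_right.trans inter_subset_left :
        u.normalDomain z₀ ∩ u.normalDomain z₁ ⊆ u.trivDomain z₁)
    have h' : ContDiffAt ℝ ∞ ContinuousLinearMap.inverse (u.localFrame z₁ z) := by
      rw [← hf]
      exact contDiffAt_map_inverse f
    exact h'.contMDiffAt.comp_contMDiffWithinAt z h
  have h2 : ContMDiffOn 𝓘(ℝ, Plane) 𝓘(ℝ, E →L[ℝ] E) ∞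
      (fun z => (((trivializationAt E u.Pull z₀).coordChangeL ℝ (trivializationAt E u.Pull z₁) z :
        E ≃L[ℝ] E) : E →L[ℝ] E)) (u.normalDomain z₀ ∩ u.normalDomain z₁) :=
    (contMDiffOn_coordChangeL (trivializationAt E u.Pull z₀) (trivializationAt E u.Pull z₁)).mono
      fun z hz => ⟨hz.1.1.2, hz.2.1.2⟩
  exact contMDiffOn_const.clm_comp (h1.clm_comp (h2.clm_comp contMDiffOn_const))

/-- The normal bundle, presented by its local trivializations. -/
def normalPrebundle (u : SmoothImmersion S E M) : VectorPrebundle ℝ (Fib E) u.Normal where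
  pretrivializationAtlas := range u.pretriv
  pretrivialization_linear' := by
    rintro _ ⟨z₀, rfl⟩
    refine ⟨fun z hz => ⟨fun n m => ?_, fun c n => ?_⟩⟩
    · obtain ⟨w, rfl⟩ := Submodule.mkQ_surjective _ n
      obtain ⟨v, rfl⟩ := Submodule.mkQ_surjective _ m
      have h1 := congrArg Prod.snd (u.pretriv_apply hz w)
      have h2 := congrArg Prod.snd (u.pretriv_apply hz v)
      have h3 := congrArg Prod.snd (u.pretriv_apply hz (w + v))
      rw [map_add] at h3
      exact h3.trans ((map_add _ w v).trans (congrArg₂ (· + ·) h1.symm h2.symm))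
    · obtain ⟨w, rfl⟩ := Submodule.mkQ_surjective _ n
      have h1 := congrArg Prod.snd (u.pretriv_apply hz w)
      have h3 := congrArg Prod.snd (u.pretriv_apply hz (c • w))
      rw [map_smul] at h3
      exact h3.trans ((map_smul _ c w).trans (congrArg (c • ·) h1.symm))
  pretrivializationAt := u.pretriv
  mem_base_pretrivializationAt := u.mem_normalDomain
  pretrivialization_mem_atlas z := mem_range_self z
  exists_coordChange := by
    rintro _ ⟨z₀, rfl⟩ _ ⟨z₁, rfl⟩
    exact ⟨u.fibChange z₀ z₁, (u.contMDiffOn_fibChange z₀ z₁).continuousOn,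
      fun z hz y => u.fibChange_apply hz y⟩
  totalSpaceMk_isInducing z := by
    have hz := u.mem_normalDomain z
    have hc : Continuous (fun n : u.Normal z => u.pretriv z ⟨z, n⟩) := by
      refine (Submodule.isQuotientMap_mkQ _).continuous_iff.2 ?_
      have : (fun n : u.Normal z => u.pretriv z ⟨z, n⟩) ∘ (u.d z).range.mkQ =
          fun w => (z, u.toFib z z w) := funext fun w => u.pretriv_apply hz w
      rw [this]
      exact continuous_const.prodMk (u.toFib z z).continuous
    have hi : Continuous (fun q : S × Fib E => u.proj z (u.ofFib z z q.2)) :=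
      (u.proj z).continuous.comp ((u.ofFib z z).continuous.comp continuous_snd)
    refine IsInducing.of_comp hc hi ?_
    have : (fun q : S × Fib E => u.proj z (u.ofFib z z q.2)) ∘
        (fun n : u.Normal z => u.pretriv z ⟨z, n⟩) = id := by
      funext n
      obtain ⟨w, rfl⟩ := Submodule.mkQ_surjective _ n
      have h1 := congrArg Prod.snd (u.pretriv_apply hz w)
      exact (congrArg (fun y => u.proj z (u.ofFib z z y)) h1).trans (u.ofFib_toFib hz w)
    exact this ▸ IsInducing.id

instance (u : SmoothImmersion S E M) : TopologicalSpace (TotalSpace (Fib E) u.Normal) :=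
  u.normalPrebundle.totalSpaceTopology

instance (u : SmoothImmersion S E M) : FiberBundle (Fib E) u.Normal :=
  u.normalPrebundle.toFiberBundle

instance (u : SmoothImmersion S E M) : VectorBundle ℝ (Fib E) u.Normal :=
  u.normalPrebundle.toVectorBundle

instance (u : SmoothImmersion S E M) : u.normalPrebundle.IsContMDiff 𝓘(ℝ, Plane) ∞ where
  exists_contMDiffCoordChange := by
    rintro _ ⟨z₀, rfl⟩ _ ⟨z₁, rfl⟩
    exact ⟨u.fibChange z₀ z₁, u.contMDiffOn_fibChange z₀ z₁,
      fun z hz y => u.fibChange_apply hz y⟩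

instance (u : SmoothImmersion S E M) :
    ContMDiffVectorBundle ∞ (Fib E) u.Normal 𝓘(ℝ, Plane) :=
  u.normalPrebundle.contMDiffVectorBundle 𝓘(ℝ, Plane)

/-! ### Sections and forms -/

/-- `C^∞(u^*TM)`. -/
abbrev PullSection (u : SmoothImmersion S E M) : Type _ :=
  Cₛ^∞⟮𝓘(ℝ, Plane); E, u.Pull⟯

/-- `C^∞(N)`, for the normal bundle `N` of `u`. -/
abbrev NormalSection (u : SmoothImmersion S E M) : Type _ :=
  Cₛ^∞⟮𝓘(ℝ, Plane); Fib E, u.Normal⟯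

/-- The smooth one-forms on `S` with values in `u^*TM`. -/
abbrev PullForm (u : SmoothImmersion S E M) : Type _ :=
  Cₛ^∞⟮𝓘(ℝ, Plane); Plane →L[ℝ] E,
    fun z : S => TangentSpace 𝓘(ℝ, Plane) z →L[ℝ] u.Pull z⟯

/-- The smooth one-forms on `S` with values in the normal bundle of `u`. -/
abbrev NormalForm (u : SmoothImmersion S E M) : Type _ :=
  Cₛ^∞⟮𝓘(ℝ, Plane); Plane →L[ℝ] Fib E,
    fun z : S => TangentSpace 𝓘(ℝ, Plane) z →L[ℝ] u.Normal z⟯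

/-- The section `du(X)` of `u^*TM` for a vector field `X` on `S`. -/
def push (u : SmoothImmersion S E M) (X : VectorFields S) : u.PullSection :=
  ⟨fun z => u.d z (X z), u.contMDiff_push X⟩

theorem contMDiff_toNormal (u : SmoothImmersion S E M) (v : u.PullSection) :
    ContMDiff 𝓘(ℝ, Plane) (𝓘(ℝ, Plane).prod 𝓘(ℝ, Fib E)) ∞
      (fun z => TotalSpace.mk' (Fib E) (E := u.Normal) z (u.proj z (v z))) := by
  intro z₀
  rw [contMDiffAt_section]
  have hz := u.mem_normalDomain z₀
  obtain ⟨f, hf⟩ := hz.2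
  have h1 : ContMDiffAt 𝓘(ℝ, Plane) 𝓘(ℝ, E →L[ℝ] (Plane × Fib E)) ∞
      (fun z => (u.localFrame z₀ z).inverse) z₀ := by
    have h := (u.contMDiffOn_localFrame z₀).contMDiffAt
      ((u.isOpen_trivDomain z₀).mem_nhds (u.mem_trivDomain z₀))
    have h' : ContDiffAt ℝ ∞ ContinuousLinearMap.inverse (u.localFrame z₀ z₀) := by
      rw [← hf]
      exact contDiffAt_map_inverse f
    exact h'.contMDiffAt.comp z₀ h
  have h2 := (contMDiffAt_section z₀).1 (v.contMDiff z₀)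
  have h3 : ContMDiffAt 𝓘(ℝ, Plane) 𝓘(ℝ, Fib E) ∞
      (fun z => ((u.localFrame z₀ z).inverse (trivializationAt E u.Pull z₀ ⟨z, v z⟩).2).2) z₀ :=
    (ContinuousLinearMap.snd ℝ Plane (Fib E)).contMDiff.contMDiffAt.comp z₀ (h1.clm_apply h2)
  refine h3.congr_of_eventuallyEq ?_
  filter_upwards [(u.isOpen_normalDomain z₀).mem_nhds hz] with z hz
  refine (congrArg Prod.snd (u.pretriv_apply hz (v z))).trans ?_
  simp only [toFib, ContinuousLinearMap.comp_apply, ContinuousLinearMap.coe_snd',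
    Trivialization.continuousLinearMapAt_apply, Trivialization.coe_linearMapAt_of_mem _ hz.1.2]

/-- The section of the normal bundle represented by a section of `u^*TM`. -/
def toNormal (u : SmoothImmersion S E M) (v : u.PullSection) : u.NormalSection :=
  ⟨fun z => u.proj z (v z), u.contMDiff_toNormal v⟩

end
end SmoothImmersion

noncomputable section

/-- A smooth almost complex structure on a manifold. -/
structure AlmostComplexStructure (E : Type*) [NormedAddCommGroup E] [NormedSpace ℝ E]
    (M : Type*) [TopologicalSpace M] [ChartedSpace E M] [IsManifold 𝓘(ℝ, E) ∞ M] where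
  toSection : Cₛ^∞⟮𝓘(ℝ, E); E →L[ℝ] E,
    fun x : M => TangentSpace 𝓘(ℝ, E) x →L[ℝ] TangentSpace 𝓘(ℝ, E) x⟯
  sq : ∀ (x : M) (v : TangentSpace 𝓘(ℝ, E) x), toSection x (toSection x v) = -v

/-- The velocity `c'(0)` of a curve, as an element of the tangent bundle. -/
def velocity {E H : Type*} [NormedAddCommGroup E] [NormedSpace ℝ E] [TopologicalSpace H]
    (I : ModelWithCorners ℝ E H) {M : Type*} [TopologicalSpace M] [ChartedSpace H M]
    (c : ℝ → M) : TangentBundle I M :=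
  ⟨c 0, mfderiv 𝓘(ℝ, ℝ) I c 0 (1 : ℝ)⟩

section

variable {S : Type*} [TopologicalSpace S] [ChartedSpace Plane S] [IsManifold 𝓘(ℝ, Plane) ∞ S]
  {E : Type*} [NormedAddCommGroup E] [NormedSpace ℝ E]
  {M : Type*} [TopologicalSpace M] [ChartedSpace E M] [IsManifold 𝓘(ℝ, E) ∞ M]

/-- The nonlinear Cauchy-Riemann operator `∂̄_J f = ½ (df + J ∘ df ∘ j)`. -/
def dbar (j : AlmostComplexStructure Plane S) (J : AlmostComplexStructure E M) (f : S → M)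
    (z : S) (ζ : TangentSpace 𝓘(ℝ, Plane) z) : TangentSpace 𝓘(ℝ, E) (f z) :=
  (1 / 2 : ℝ) • (mfderiv 𝓘(ℝ, Plane) 𝓘(ℝ, E) f z ζ +
    J.toSection (f z) (mfderiv 𝓘(ℝ, Plane) 𝓘(ℝ, E) f z (j.toSection z ζ)))

/-- The Cauchy-Riemann operator of the tangent bundle of a surface, evaluated on a vector field:
`∂̄_Z X = ½ ([Z, X] + j [j Z, X])`. -/
def dbarTangent (j : AlmostComplexStructure Plane S) (X Z : VectorFields S) (z : S) :
    TangentSpace 𝓘(ℝ, Plane) z :=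
  (1 / 2 : ℝ) • (VectorField.mlieBracket 𝓘(ℝ, Plane) Z X z +
    j.toSection z (VectorField.mlieBracket 𝓘(ℝ, Plane) (fun w => j.toSection w (Z w)) X z))

namespace SmoothImmersion

/-- The complex structure `J_{u(z)}` on the fibre of `u^*TM`. -/
def pullJ (J : AlmostComplexStructure E M) (u : SmoothImmersion S E M) (z : S) :
    u.Pull z →L[ℝ] u.Pull z :=
  J.toSection (u.toMap z)

/-- `u` is pseudoholomorphic: `J ∘ du = du ∘ j`. -/
def IsPseudoholomorphic (j : AlmostComplexStructure Plane S) (J : AlmostComplexStructure E M)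
    (u : SmoothImmersion S E M) : Prop :=
  ∀ (z : S) (ζ : TangentSpace 𝓘(ℝ, Plane) z), u.pullJ J z (u.d z ζ) = u.d z (j.toSection z ζ)

/-- The complex structure induced by `J` on the fibre of the normal bundle. -/
def normalJ {j : AlmostComplexStructure Plane S} {J : AlmostComplexStructure E M}
    {u : SmoothImmersion S E M} (hu : u.IsPseudoholomorphic j J) (z : S) :
    u.Normal z →ₗ[ℝ] u.Normal z :=
  Submodule.mapQ (u.d z).range (u.d z).range (u.pullJ J z : u.Pull z →ₗ[ℝ] u.Pull z) (by
    rintro _ ⟨ζ, rfl⟩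
    exact ⟨j.toSection z ζ, (hu z ζ).symm⟩)

/-- `Ω^{0,1}(u^*TM)`: the smooth one-forms `α` with `α ∘ j = -J ∘ α`. -/
def PullForm01 (j : AlmostComplexStructure Plane S) (J : AlmostComplexStructure E M)
    (u : SmoothImmersion S E M) : Submodule ℝ u.PullForm where
  carrier := {α | ∀ (z : S) (ζ : TangentSpace 𝓘(ℝ, Plane) z),
    α z (j.toSection z ζ) = -u.pullJ J z (α z ζ)}
  add_mem' := by
    intro α β hα hβ z ζ
    simp only [ContMDiffSection.coe_add, Pi.add_apply, add_apply, map_add, hα z ζ, hβ z ζ]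
    abel
  zero_mem' := by
    intro z ζ
    simp
  smul_mem' := by
    intro c α hα z ζ
    simp only [ContMDiffSection.coe_smul, Pi.smul_apply, smul_apply, map_smul, hα z ζ, smul_neg]

/-- `U` is, near `(0, z)`, a smooth family of maps `U t : S → M` with `U 0 = u` and
`∂U/∂t = v` at `t = 0`. -/
def IsVariationAt (u : SmoothImmersion S E M) (v : u.PullSection) (U : ℝ → S → M) (z : S) :
    Prop :=
  ContMDiffAt (𝓘(ℝ, ℝ).prod 𝓘(ℝ, Plane)) 𝓘(ℝ, E) ∞ (Function.uncurry U) ((0 : ℝ), z) ∧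
  ∀ᶠ w in 𝓝 z, velocity 𝓘(ℝ, E) (fun t => U t w) = ⟨u.toMap w, v w⟩

/-- The one-form `α` is the linearization of `∂̄_J` at `u` in the direction `v`: the derivative of
`∂̄_J (U t)` at `t = 0` for every variation `U` of `u` in the direction `v`. Fibre coordinates of
`TM` around `u z` are used to differentiate; as `∂̄_J u = 0`, the result does not depend on them. -/
def IsLinearization (j : AlmostComplexStructure Plane S) (J : AlmostComplexStructure E M)
    (u : SmoothImmersion S E M) (v : u.PullSection) (α : u.PullForm) : Prop :=
  ∀ (z : S) (U : ℝ → S → M), u.IsVariationAt v U z → ∀ ζ : TangentSpace 𝓘(ℝ, Plane) z,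
    HasDerivAt
      (fun t => (trivializationAt E (TangentSpace 𝓘(ℝ, E)) (u.toMap z)
        (⟨U t z, dbar j J (U t) z ζ⟩ : TangentBundle 𝓘(ℝ, E) M)).2)
      (trivializationAt E (TangentSpace 𝓘(ℝ, E)) (u.toMap z)
        (⟨u.toMap z, α z ζ⟩ : TangentBundle 𝓘(ℝ, E) M)).2 0

/-- `D` is Gromov's operator `D_u : C^∞(u^*TM) → Ω^{0,1}(u^*TM)`, the linearization of `∂̄_J`
at `u`. -/
def IsGromovOperator (j : AlmostComplexStructure Plane S) (J : AlmostComplexStructure E M)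
    (u : SmoothImmersion S E M) (D : u.PullSection →ₗ[ℝ] u.PullForm01 j J) : Prop :=
  ∀ v : u.PullSection, u.IsLinearization j J v (D v : u.PullForm)

variable [FiniteDimensional ℝ E]

/-- `Ω^{0,1}(N)`: the smooth one-forms `α` with values in the normal bundle that satisfy
`α ∘ j = -J ∘ α`. -/
def NormalForm01 {j : AlmostComplexStructure Plane S} {J : AlmostComplexStructure E M}
    {u : SmoothImmersion S E M} (hu : u.IsPseudoholomorphic j J) : Submodule ℝ u.NormalForm where
  carrier := {α | ∀ (z : S) (ζ : TangentSpace 𝓘(ℝ, Plane) z),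
    α z (j.toSection z ζ) = -normalJ hu z (α z ζ)}
  add_mem' := by
    intro α β hα hβ z ζ
    simp only [ContMDiffSection.coe_add, Pi.add_apply, add_apply, map_add, hα z ζ, hβ z ζ]
    abel
  zero_mem' := by
    intro z ζ
    simp
  smul_mem' := by
    intro c α hα z ζ
    simp only [ContMDiffSection.coe_smul, Pi.smul_apply, smul_apply, map_smul, hα z ζ, smul_neg]

/-- `D'` is the operator induced by `D` on the normal bundle: `D' [v] = [D v]`. -/
def IsDescent {j : AlmostComplexStructure Plane S} {J : AlmostComplexStructure E M}
    {u : SmoothImmersion S E M} (hu : u.IsPseudoholomorphic j J)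
    (D : u.PullSection →ₗ[ℝ] u.PullForm01 j J)
    (D' : u.NormalSection →ₗ[ℝ] NormalForm01 hu) : Prop :=
  ∀ (v : u.PullSection) (z : S) (ζ : TangentSpace 𝓘(ℝ, Plane) z),
    (D' (u.toNormal v) : u.NormalForm) z ζ = u.proj z ((D v : u.PullForm) z ζ)

/-- The total space of the normal bundle. -/
abbrev NormalTotal (u : SmoothImmersion S E M) : Type _ := TotalSpace (Fib E) u.Normal

/-- The model with corners of the total space of the normal bundle. -/
abbrev normalModel (E : Type*) [NormedAddCommGroup E] [NormedSpace ℝ E] :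
    ModelWithCorners ℝ (Plane × Fib E) (ModelProd Plane (Fib E)) :=
  𝓘(ℝ, Plane).prod 𝓘(ℝ, Fib E)

/-- `φ` is, near the zero vector over `z`, a smooth tubular parametrization of a neighbourhood
of `u` by its normal bundle: `t ↦ φ (t n)` starts at the base point `u w` of `n`, and its initial
velocity represents `n`. -/
def IsTubularAt (u : SmoothImmersion S E M) (φ : u.NormalTotal → M) (z : S) : Prop :=
  ContMDiffAt (normalModel E) 𝓘(ℝ, E) ∞ φ (⟨z, 0⟩ : u.NormalTotal) ∧
  ∀ᶠ w in 𝓝 z, ∀ n : u.Normal w, ∃ v : u.Pull w, u.proj w v = n ∧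
    velocity 𝓘(ℝ, E) (fun t : ℝ => φ ⟨w, t • n⟩) = ⟨u.toMap w, v⟩

/-- The fibrewise dilatation `R^t`. -/
def dilate (u : SmoothImmersion S E M) (t : ℝ) (a : u.NormalTotal) : u.NormalTotal :=
  ⟨a.1, t • a.2⟩

/-- The endomorphism `(dψ_a)⁻¹ ∘ J ∘ dψ_a`, i.e. the structure `ψ_*⁻¹ J ψ_*` at `a`. -/
def conjJ (J : AlmostComplexStructure E M) (u : SmoothImmersion S E M) (ψ : u.NormalTotal → M)
    (a : u.NormalTotal) :
    TangentSpace (normalModel E) a →L[ℝ] TangentSpace (normalModel E) a :=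
  (mfderiv (normalModel E) 𝓘(ℝ, E) ψ a).inverse.comp
    ((J.toSection (ψ a)).comp (mfderiv (normalModel E) 𝓘(ℝ, E) ψ a))

/-- `Jc` is the NB-II structure on the total space of the normal bundle: the limit, as `t → 0`, of
the dilatations `J_t = R^{1/t}_* (φ_*⁻¹ J φ_*) R^t_* = (φ R^t)_*⁻¹ J (φ R^t)_*`
for every tubular parametrization `φ`. -/
def IsNBII (J : AlmostComplexStructure E M) (u : SmoothImmersion S E M)
    (Jc : ∀ a : u.NormalTotal,
      TangentSpace (normalModel E) a →L[ℝ] TangentSpace (normalModel E) a) : Prop :=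
  ∀ (a : u.NormalTotal) (φ : u.NormalTotal → M), u.IsTubularAt φ a.1 →
    ∀ ξ : TangentSpace (normalModel E) a,
      Tendsto (fun t : ℝ => u.conjJ J (φ ∘ u.dilate t) a ξ) (𝓝[≠] 0) (𝓝 (Jc a ξ))

/-- `P` is the Cauchy-Riemann operator of the structure `Jc` on the total space of the normal
bundle: for a section `s`, viewed as a map from `S` to the total space,
`½ (ds + Jc ∘ ds ∘ j)(ζ)` is the vertical vector at `s(z)` given by `P s (ζ)`. -/
def IsCauchyRiemann {j : AlmostComplexStructure Plane S} {J : AlmostComplexStructure E M}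
    {u : SmoothImmersion S E M} (hu : u.IsPseudoholomorphic j J)
    (Jc : ∀ a : u.NormalTotal,
      TangentSpace (normalModel E) a →L[ℝ] TangentSpace (normalModel E) a)
    (P : u.NormalSection →ₗ[ℝ] NormalForm01 hu) : Prop :=
  ∀ (s : u.NormalSection) (z : S) (ζ : TangentSpace 𝓘(ℝ, Plane) z),
    let σ : S → u.NormalTotal := fun w => ⟨w, s w⟩
    let ds := mfderiv 𝓘(ℝ, Plane) (normalModel E) σ z
    (⟨σ z, (1 / 2 : ℝ) • (ds ζ + Jc (σ z) (ds (j.toSection z ζ)))⟩ :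
        TangentBundle (normalModel E) u.NormalTotal) =
      velocity (normalModel E)
        (fun t : ℝ => (⟨z, s z + t • (P s : u.NormalForm) z ζ⟩ : u.NormalTotal))

end SmoothImmersion

end

end

/-! The whole proposition is a computation in charts, carried out on normed spaces and then
transported to the manifolds.

In charts an immersion `u` with `J ∘ du = du ∘ j` is a map between vector spaces, and the
linearization of `∂̄_J` in the direction `v` is
`½ (dv + dJ(v) ∘ du ∘ j + J ∘ dv ∘ j)` (`LocalCauchyRiemann.linCR`, `hasDerivAt_dbar`), by the
symmetry of the second derivatives of a variation of `u`. Since `∂̄_J u = 0`, the derivative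
does not depend on the fibre coordinates used to take it, so the local formulas fit together to a global
operator, Gromov's operator (`pullCoord_gromovAt`, `gromov`).

Differentiating `J ∘ du = du ∘ j` shows that a tangential direction `du(X)` is mapped to `du(∂̄ X)`
(`linCR_tangential`). Hence the normal part of the linearization depends only on the normal part of
the direction (`normalCoord_linCR_congr`). This is used three times.

* It gives the descent to the normal bundle `N`, because every section of `N` lifts to a section of
  `u^*TM` by a partition of unity (`surjective_toNormal`).
* It gives the limit defining the NB-II structure. With a complement `i` of the image of `du` as
  model fibre, the structure at `(x, y)` is `(ξ, η) ↦ (j ξ, [dJ(i y) du ξ + J (i η)])`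
  (`localNBII`). For a tubular parametrization `φ` the dilated structures converge to the first
  jet along the zero section of `φ_*⁻¹ J φ_*`; this involves the derivative of
  `b = ∂φ/∂y (y)`, a field along `u` that agrees with `i y` only modulo the tangent space, and the
  terms in question are those of the linearization in the direction `b`, so that `b` may be replaced
  by `i y` (`hasDerivAt_conj`, `tendsto_conj_dilate`). The limit is therefore independent of `φ`,
  and its square is `-1` because of the identity `J² = -1` and its derivative (`localNBII_sq`).
* It allows the normal part of Gromov's operator to be computed in the direction `i s`, where it is
  visibly `½ (ds + J̌ ∘ ds ∘ j)` (`normalCoord_linCR_incl`, `isCauchyRiemann_of_isDescent`).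
-/

/-! ### The linearized Cauchy-Riemann operator on vector spaces -/

noncomputable section

namespace LocalCauchyRiemann

variable {P F E : Type*} [NormedAddCommGroup P] [NormedSpace ℝ P]
  [NormedAddCommGroup F] [NormedSpace ℝ F] [NormedAddCommGroup E] [NormedSpace ℝ E]

/-- The linearization of `∂̄_J f = ½ (df + J ∘ df ∘ j)` at a map `u` between vector spaces, in the
direction of the vector field `v` along `u`. -/
def linCR (u : P → E) (J : E → E →L[ℝ] E) (j : P → P →L[ℝ] P) (v : P → E) (x : P) : P →L[ℝ] E :=
  (1 / 2 : ℝ) • (fderiv ℝ v x +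
    ((fderiv ℝ J (u x) (v x)).comp ((fderiv ℝ u x).comp (j x)) +
      (J (u x)).comp ((fderiv ℝ v x).comp (j x))))

theorem linCR_apply (u : P → E) (J : E → E →L[ℝ] E) (j : P → P →L[ℝ] P) (v : P → E) (x ζ : P) :
    linCR u J j v x ζ = (1 / 2 : ℝ) • (fderiv ℝ v x ζ +
      (fderiv ℝ J (u x) (v x) (fderiv ℝ u x (j x ζ)) + J (u x) (fderiv ℝ v x (j x ζ)))) :=
  rfl

theorem linCR_add (u : P → E) (J : E → E →L[ℝ] E) (j : P → P →L[ℝ] P) {v w : P → E} {x : P}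
    (hv : DifferentiableAt ℝ v x) (hw : DifferentiableAt ℝ w x) :
    linCR u J j (v + w) x = linCR u J j v x + linCR u J j w x := by
  ext ζ
  simp only [linCR_apply, fderiv_add hv hw, Pi.add_apply, map_add, add_apply]
  rw [← smul_add]
  congr 1
  abel

theorem linCR_smul (u : P → E) (J : E → E →L[ℝ] E) (j : P → P →L[ℝ] P) {v : P → E} {x : P}
    (c : ℝ) (hv : DifferentiableAt ℝ v x) :
    linCR u J j (c • v) x = c • linCR u J j v x := by
  ext ζ
  simp only [linCR_apply, fderiv_const_smul hv, Pi.smul_apply, map_smul, smul_apply]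
  rw [smul_comm]
  simp only [smul_add]

theorem linCR_congr {u u' : P → E} {J : E → E →L[ℝ] E} {j : P → P →L[ℝ] P} {v v' : P → E}
    {x : P} (hu : u =ᶠ[𝓝 x] u') (hv : v =ᶠ[𝓝 x] v') :
    linCR u J j v x = linCR u' J j v' x := by
  rw [linCR, linCR, hu.fderiv_eq, hv.fderiv_eq, hu.eq_of_nhds, hv.eq_of_nhds]

theorem contDiffAt_linCR {u : P → E} {J : E → E →L[ℝ] E} {j : P → P →L[ℝ] P} {v : P → E} {x : P}
    (hu : ContDiffAt ℝ ∞ u x) (hJ : ContDiffAt ℝ ∞ J (u x)) (hj : ContDiffAt ℝ ∞ j x)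
    (hv : ContDiffAt ℝ ∞ v x) : ContDiffAt ℝ ∞ (linCR u J j v) x := by
  have hdu : ContDiffAt ℝ ∞ (fderiv ℝ u) x := hu.fderiv_right (m := ∞) le_rfl
  have hdv : ContDiffAt ℝ ∞ (fderiv ℝ v) x := hv.fderiv_right (m := ∞) le_rfl
  have hdJ : ContDiffAt ℝ ∞ (fun y => fderiv ℝ J (u y)) x :=
    (hJ.fderiv_right (m := ∞) le_rfl).comp x hu
  exact (hdv.add (((hdJ.clm_apply hv).clm_comp (hdu.clm_comp hj)).add
    ((hJ.comp x hu).clm_comp (hdv.clm_comp hj)))).const_smul (1 / 2 : ℝ)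

/-- Differentiating `J² = -1`. -/
theorem fderiv_anticomm {J : E → E →L[ℝ] E} {y : E} (hJ : DifferentiableAt ℝ J y)
    (hsq : ∀ᶠ y' in 𝓝 y, ∀ w, J y' (J y' w) = -w) (v w : E) :
    fderiv ℝ J y v (J y w) = -J y (fderiv ℝ J y v w) := by
  have h1 : HasFDerivAt (fun y' => J y' (J y' w)) _ y :=
    hJ.hasFDerivAt.clm_apply (hJ.hasFDerivAt.clm_apply (hasFDerivAt_const w y))
  have h2 : HasFDerivAt (fun y' => J y' (J y' w)) (0 : E →L[ℝ] E) y :=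
    (hasFDerivAt_const (-w) y).congr_of_eventuallyEq (hsq.mono fun y' h => h w)
  have h3 := congrArg (fun A : E →L[ℝ] E => A v) (h1.unique h2)
  simp at h3
  rw [add_comm] at h3
  exact eq_neg_of_add_eq_zero_left h3

/-- The linearization is complex antilinear. -/
theorem linCR_antilinear {u : P → E} {J : E → E →L[ℝ] E} {j : P → P →L[ℝ] P} {v : P → E} {x : P}
    (hJ : DifferentiableAt ℝ J (u x)) (hJsq : ∀ᶠ y in 𝓝 (u x), ∀ w, J y (J y w) = -w)
    (hjsq : ∀ ζ, j x (j x ζ) = -ζ)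
    (hhol : ∀ ζ, J (u x) (fderiv ℝ u x ζ) = fderiv ℝ u x (j x ζ)) (ζ : P) :
    linCR u J j v x (j x ζ) = -J (u x) (linCR u J j v x ζ) := by
  have h := fderiv_anticomm hJ hJsq (v x) (fderiv ℝ u x ζ)
  rw [hhol] at h
  simp only [linCR_apply, hjsq, map_neg, map_smul, map_add, h, hJsq.self_of_nhds]
  rw [← smul_neg]
  congr 1
  abel

/-- Differentiating `J ∘ du = du ∘ j`. -/
theorem fderiv_holomorphic {u : P → E} {J : E → E →L[ℝ] E} {j : P → P →L[ℝ] P} {x : P}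
    (hu : ContDiffAt ℝ ∞ u x) (hJ : DifferentiableAt ℝ J (u x)) (hj : DifferentiableAt ℝ j x)
    (hhol : ∀ᶠ x' in 𝓝 x, ∀ ζ, J (u x') (fderiv ℝ u x' ζ) = fderiv ℝ u x' (j x' ζ)) (ξ ζ : P) :
    fderiv ℝ J (u x) (fderiv ℝ u x ξ) (fderiv ℝ u x ζ) +
        J (u x) (fderiv ℝ (fderiv ℝ u) x ξ ζ) =
      fderiv ℝ (fderiv ℝ u) x ξ (j x ζ) + fderiv ℝ u x (fderiv ℝ j x ξ ζ) := by
  have hu1 : HasFDerivAt u (fderiv ℝ u x) x := (hu.differentiableAt (by simp)).hasFDerivAt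
  have hdu : HasFDerivAt (fderiv ℝ u) (fderiv ℝ (fderiv ℝ u) x) x :=
    ((hu.fderiv_right (m := ∞) le_rfl).differentiableAt (by simp)).hasFDerivAt
  have hJu : HasFDerivAt (fun x' => J (u x')) _ x := hJ.hasFDerivAt.comp x hu1
  have h1 := hJu.clm_apply (hdu.clm_apply (hasFDerivAt_const ζ x))
  have h2 := hdu.clm_apply (hj.hasFDerivAt.clm_apply (hasFDerivAt_const ζ x))
  have h3 := h1.unique (h2.congr_of_eventuallyEq (hhol.mono fun x' h => h ζ))
  have h4 := congrArg (fun A : P →L[ℝ] E => A ξ) h3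
  simp at h4
  rw [add_comm, h4, add_comm]

/-- The linearization in the direction of a tangential field `du(X)` is `du(∂̄ X)`. -/
theorem linCR_tangential {u : P → E} {J : E → E →L[ℝ] E} {j : P → P →L[ℝ] P} {X : P → P} {x : P}
    (hu : ContDiffAt ℝ ∞ u x) (hJ : DifferentiableAt ℝ J (u x)) (hj : DifferentiableAt ℝ j x)
    (hX : DifferentiableAt ℝ X x) (hjsq : ∀ ζ, j x (j x ζ) = -ζ)
    (hhol : ∀ᶠ x' in 𝓝 x, ∀ ζ, J (u x') (fderiv ℝ u x' ζ) = fderiv ℝ u x' (j x' ζ)) (ζ : P) :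
    linCR u J j (fun x' => fderiv ℝ u x' (X x')) x ζ =
      fderiv ℝ u x ((1 / 2 : ℝ) • (fderiv ℝ X x ζ + (fderiv ℝ j x (X x) (j x ζ) +
        j x (fderiv ℝ X x (j x ζ))))) := by
  have hdu : HasFDerivAt (fderiv ℝ u) (fderiv ℝ (fderiv ℝ u) x) x :=
    ((hu.fderiv_right (m := ∞) le_rfl).differentiableAt (by simp)).hasFDerivAt
  have hd := (hdu.clm_apply hX.hasFDerivAt).fderiv
  have hsymm : ∀ a b, fderiv ℝ (fderiv ℝ u) x a b = fderiv ℝ (fderiv ℝ u) x b a := fun a b =>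
    (hu.isSymmSndFDerivAt (by simpa using ENat.LEInfty.out)).eq a b
  have h := fderiv_holomorphic hu hJ hj hhol (X x) (j x ζ)
  rw [hjsq, map_neg] at h
  rw [linCR_apply, hd]
  simp only [add_apply, ContinuousLinearMap.comp_apply,
    ContinuousLinearMap.flip_apply, map_smul, map_add, hhol.self_of_nhds]
  rw [hsymm ζ (X x), hsymm (j x ζ) (X x)]
  congr 1
  linear_combination (norm := module) h

/-- The derivative of `∂̄_J` along a variation `U t` of `u` is `linCR`. -/
theorem hasDerivAt_dbar {u : P → E} {J : E → E →L[ℝ] E} {j : P →L[ℝ] P} {v : P → E} {x : P}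
    {U : ℝ × P → E} (hU : ContDiffAt ℝ ∞ U (0, x)) (hu : ∀ᶠ x' in 𝓝 x, U (0, x') = u x')
    (hv : ∀ᶠ x' in 𝓝 x, fderiv ℝ U (0, x') (1, 0) = v x') (hJ : DifferentiableAt ℝ J (u x))
    (ζ : P) :
    HasDerivAt (fun t : ℝ => (1 / 2 : ℝ) • (fderiv ℝ U (t, x) (0, ζ) +
      J (U (t, x)) (fderiv ℝ U (t, x) (0, j ζ)))) (linCR u J (fun _ => j) v x ζ) 0 := by
  have hdU : HasFDerivAt (fderiv ℝ U) (fderiv ℝ (fderiv ℝ U) (0, x)) (0, x) :=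
    ((hU.fderiv_right (m := ∞) le_rfl).differentiableAt (by simp)).hasFDerivAt
  have hU1 : HasFDerivAt U (fderiv ℝ U (0, x)) (0, x) :=
    (hU.differentiableAt (by simp)).hasFDerivAt
  have hline : HasDerivAt (fun t : ℝ => (t, x)) ((1 : ℝ), (0 : P)) 0 :=
    (hasDerivAt_id (0 : ℝ)).prodMk (hasDerivAt_const (0 : ℝ) x)
  have hslice : HasFDerivAt (fun x' : P => ((0 : ℝ), x'))
      ((0 : P →L[ℝ] ℝ).prod (ContinuousLinearMap.id ℝ P)) x :=
    (hasFDerivAt_const (0 : ℝ) x).prodMk (hasFDerivAt_id x)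
  have hUt : HasDerivAt (fun t : ℝ => U (t, x)) (v x) 0 := by
    have := hU1.comp_hasDerivAt (0 : ℝ) hline
    rwa [hv.self_of_nhds] at this
  have hdUt : HasDerivAt (fun t : ℝ => fderiv ℝ U (t, x)) _ 0 := hdU.comp_hasDerivAt (0 : ℝ) hline
  have hux : HasFDerivAt u ((fderiv ℝ U (0, x)).comp
      ((0 : P →L[ℝ] ℝ).prod (ContinuousLinearMap.id ℝ P))) x :=
    (hU1.comp x hslice).congr_of_eventuallyEq (hu.mono fun _ h => h.symm)
  have hvx : HasFDerivAt v _ x :=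
    ((hdU.comp x hslice).clm_apply (hasFDerivAt_const ((1 : ℝ), (0 : P)) x)).congr_of_eventuallyEq
      (hv.mono fun _ h => h.symm)
  have hsymm : ∀ a b, fderiv ℝ (fderiv ℝ U) (0, x) a b = fderiv ℝ (fderiv ℝ U) (0, x) b a :=
    fun a b => (hU.isSymmSndFDerivAt (by simpa using ENat.LEInfty.out)).eq a b
  have hJt : HasDerivAt (fun t : ℝ => J (U (t, x))) (fderiv ℝ J (u x) (v x)) 0 := by
    have hJ' : HasFDerivAt J (fderiv ℝ J (u x)) (U (0, x)) := by
      rw [hu.self_of_nhds]; exact hJ.hasFDerivAt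
    exact hJ'.comp_hasDerivAt (0 : ℝ) hUt
  have h1 : ∀ w : P, HasDerivAt (fun t : ℝ => fderiv ℝ U (t, x) (0, w)) (fderiv ℝ v x w) 0 := by
    intro w
    have := hdUt.clm_apply (hasDerivAt_const (0 : ℝ) ((0 : ℝ), w))
    rw [hvx.fderiv]
    simpa [hsymm (1, 0) (0, w)] using this
  have h2 := ((h1 ζ).add (hJt.clm_apply (h1 (j ζ)))).const_smul (1 / 2 : ℝ)
  rw [linCR_apply, hux.fderiv]
  simp only [ContinuousLinearMap.comp_apply, ContinuousLinearMap.prod_apply, zero_apply,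
    ContinuousLinearMap.id_apply]
  rwa [hu.self_of_nhds] at h2

end LocalCauchyRiemann
end

/-! ### Normal coordinates and the NB-II structure on vector spaces -/

noncomputable section

namespace LocalCauchyRiemann

variable {P F E : Type*} [NormedAddCommGroup P] [NormedSpace ℝ P]
  [NormedAddCommGroup F] [NormedSpace ℝ F] [NormedAddCommGroup E] [NormedSpace ℝ E]

/-- The moving frame `(ξ, η) ↦ du ξ + i η` along `u`. -/
def movingFrame (u : P → E) (i : F →L[ℝ] E) (x : P) : P × F →L[ℝ] E :=
  (fderiv ℝ u x).comp (ContinuousLinearMap.fst ℝ P F) + i.comp (ContinuousLinearMap.snd ℝ P F)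

/-- The coordinate in the model fibre `F` of a vector modulo the tangent space of `u`. -/
def normalCoord (u : P → E) (i : F →L[ℝ] E) (x : P) : E →L[ℝ] F :=
  (ContinuousLinearMap.snd ℝ P F).comp (movingFrame u i x).inverse

/-- The NB-II structure over a coordinate chart, in closed form: at `(x, y)` it maps `(ξ, η)` to
`(j ξ, [dJ(i y) du ξ + J (i η)])`. -/
def localNBII (u : P → E) (J : E → E →L[ℝ] E) (j : P →L[ℝ] P) (i : F →L[ℝ] E) (x : P) (y : F) :
    P × F →L[ℝ] P × F :=
  (j.comp (ContinuousLinearMap.fst ℝ P F)).prod ((normalCoord u i x).comp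
    (((fderiv ℝ J (u x) (i y)).comp (fderiv ℝ u x)).comp (ContinuousLinearMap.fst ℝ P F) +
      ((J (u x)).comp i).comp (ContinuousLinearMap.snd ℝ P F)))

section normalCoord

variable {u : P → E} {i : F →L[ℝ] E} {x : P}

theorem movingFrame_apply (p : P × F) : movingFrame u i x p = fderiv ℝ u x p.1 + i p.2 :=
  rfl

theorem normalCoord_fderiv (h : (movingFrame u i x).IsInvertible) (ξ : P) :
    normalCoord u i x (fderiv ℝ u x ξ) = 0 := by
  have h1 : fderiv ℝ u x ξ = movingFrame u i x (ξ, 0) := by simp [movingFrame_apply]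
  rw [normalCoord, ContinuousLinearMap.comp_apply, h1, h.inverse_apply_self]
  rfl

theorem normalCoord_incl (h : (movingFrame u i x).IsInvertible) (η : F) :
    normalCoord u i x (i η) = η := by
  have h1 : i η = movingFrame u i x (0, η) := by simp [movingFrame_apply]
  rw [normalCoord, ContinuousLinearMap.comp_apply, h1, h.inverse_apply_self]
  rfl

theorem fderiv_add_incl_normalCoord (h : (movingFrame u i x).IsInvertible) (w : E) :
    fderiv ℝ u x ((movingFrame u i x).inverse w).1 + i (normalCoord u i x w) = w :=
  h.self_apply_inverse w

/-- A complex structure preserving the tangent space of `u` is well defined on normal coordinates. -/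
theorem normalCoord_map_incl (h : (movingFrame u i x).IsInvertible) {A : E →L[ℝ] E} {j : P →L[ℝ] P}
    (hA : ∀ ξ, A (fderiv ℝ u x ξ) = fderiv ℝ u x (j ξ)) (w : E) :
    normalCoord u i x (A (i (normalCoord u i x w))) = normalCoord u i x (A w) := by
  conv_rhs => rw [← fderiv_add_incl_normalCoord h w]
  rw [map_add, map_add, hA, normalCoord_fderiv h, zero_add]

theorem eventually_isInvertible [CompleteSpace P] [CompleteSpace F] (hu : ContDiffAt ℝ ∞ u x)
    (h : (movingFrame u i x).IsInvertible) : ∀ᶠ x' in 𝓝 x, (movingFrame u i x').IsInvertible := by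
  obtain ⟨e, he⟩ := h
  have hc : ContinuousAt (movingFrame u i) x :=
    (((hu.fderiv_right (m := ∞) le_rfl).clm_comp contDiffAt_const).add
      contDiffAt_const).continuousAt
  have h1 := e.nhds
  rw [he] at h1
  exact hc h1

theorem contDiffAt_movingFrame_inverse [CompleteSpace P] [CompleteSpace F]
    (hu : ContDiffAt ℝ ∞ u x) (h : (movingFrame u i x).IsInvertible) :
    ContDiffAt ℝ ∞ (fun x' => (movingFrame u i x').inverse) x := by
  obtain ⟨e, he⟩ := h
  have hc : ContDiffAt ℝ ∞ (movingFrame u i) x :=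
    ((hu.fderiv_right (m := ∞) le_rfl).clm_comp contDiffAt_const).add contDiffAt_const
  have h1 : ContDiffAt ℝ ∞ ContinuousLinearMap.inverse (movingFrame u i x) := by
    rw [← he]; exact contDiffAt_map_inverse e
  exact h1.comp x hc

end normalCoord

section

variable {u : P → E} {J : E → E →L[ℝ] E} {j : P → P →L[ℝ] P} {i : F →L[ℝ] E} {x : P}

/-- Modulo the tangent space, the linearization depends only on the normal coordinate of the
direction. -/
theorem normalCoord_linCR_congr [CompleteSpace P] [CompleteSpace F] {v w : P → E}
    (hu : ContDiffAt ℝ ∞ u x) (hJ : DifferentiableAt ℝ J (u x)) (hj : DifferentiableAt ℝ j x)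
    (hjsq : ∀ ζ, j x (j x ζ) = -ζ)
    (hhol : ∀ᶠ x' in 𝓝 x, ∀ ζ, J (u x') (fderiv ℝ u x' ζ) = fderiv ℝ u x' (j x' ζ))
    (hinv : (movingFrame u i x).IsInvertible)
    (hv : DifferentiableAt ℝ v x) (hw : DifferentiableAt ℝ w x)
    (h : ∀ᶠ x' in 𝓝 x, normalCoord u i x' (v x') = normalCoord u i x' (w x')) (ζ : P) :
    normalCoord u i x (linCR u J j v x ζ) = normalCoord u i x (linCR u J j w x ζ) := by
  set X : P → P := fun x' => ((movingFrame u i x').inverse (v x' - w x')).1 with hXdef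
  have hX : DifferentiableAt ℝ X x :=
    (((contDiffAt_movingFrame_inverse hu hinv).differentiableAt (by simp)).clm_apply
      (hv.sub hw)).fst
  have hduX : DifferentiableAt ℝ (fun x' => fderiv ℝ u x' (X x')) x :=
    ((hu.fderiv_right (m := ∞) le_rfl).differentiableAt (by simp)).clm_apply hX
  have h1 : v =ᶠ[𝓝 x] w + fun x' => fderiv ℝ u x' (X x') := by
    filter_upwards [h, eventually_isInvertible hu hinv] with x' hx' hx'inv
    have h2 := fderiv_add_incl_normalCoord hx'inv (v x' - w x')
    rw [map_sub (normalCoord u i x'), hx', sub_self, map_zero, add_zero] at h2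
    rw [Pi.add_apply, ← sub_eq_iff_eq_add', ← h2]
  rw [linCR_congr (EventuallyEq.refl _ u) h1, linCR_add _ _ _ hw hduX, add_apply, map_add,
    linCR_tangential hu hJ hj hX hjsq hhol, normalCoord_fderiv hinv, add_zero]

/-- The normal part of the linearization in the direction `i s` is half the sum of the
derivative of `s` and of the `F`-component of the NB-II structure. -/
theorem normalCoord_linCR_incl {s : P → F} (hinv : (movingFrame u i x).IsInvertible)
    (hs : DifferentiableAt ℝ s x) (ζ : P) :
    normalCoord u i x (linCR u J j (fun x' => i (s x')) x ζ) =
      (1 / 2 : ℝ) • (fderiv ℝ s x ζ +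
        (localNBII u J (j x) i x (s x) (j x ζ, fderiv ℝ s x (j x ζ))).2) := by
  have h : fderiv ℝ (fun x' => i (s x')) x = i.comp (fderiv ℝ s x) :=
    (i.hasFDerivAt.comp x hs.hasFDerivAt).fderiv
  rw [linCR_apply, h, map_smul, map_add, ContinuousLinearMap.comp_apply, normalCoord_incl hinv]
  rfl

theorem localNBII_sq (hJ : DifferentiableAt ℝ J (u x))
    (hJsq : ∀ᶠ y in 𝓝 (u x), ∀ w, J y (J y w) = -w) (hjsq : ∀ ζ, j x (j x ζ) = -ζ)
    (hhol : ∀ ζ, J (u x) (fderiv ℝ u x ζ) = fderiv ℝ u x (j x ζ))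
    (hinv : (movingFrame u i x).IsInvertible) (y : F) (p : P × F) :
    localNBII u J (j x) i x y (localNBII u J (j x) i x y p) = -p := by
  refine Prod.ext (hjsq p.1) ?_
  change normalCoord u i x (fderiv ℝ J (u x) (i y) (fderiv ℝ u x (j x p.1)) + J (u x) (i
    (normalCoord u i x (fderiv ℝ J (u x) (i y) (fderiv ℝ u x p.1) + J (u x) (i p.2))))) = -p.2
  rw [map_add, normalCoord_map_incl hinv hhol, ← map_add, map_add (J (u x)), hJsq.self_of_nhds,
    ← hhol, fderiv_anticomm hJ hJsq, neg_add_cancel_left, map_neg, normalCoord_incl hinv]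

/-- A linear map that agrees with the moving frame modulo the tangent space is invertible. -/
theorem isInvertible_of_normalCoord {A : P × F →L[ℝ] E} (hinv : (movingFrame u i x).IsInvertible)
    (hP : ∀ ξ, A (ξ, 0) = fderiv ℝ u x ξ) (hF : ∀ η, normalCoord u i x (A (0, η)) = η) :
    A.IsInvertible := by
  -- `A` is the moving frame composed with a shear `(ξ, η) ↦ (ξ + K η, η)`
  let K : F →L[ℝ] P := (ContinuousLinearMap.fst ℝ P F).comp ((movingFrame u i x).inverse.comp
    (A.comp (ContinuousLinearMap.inr ℝ P F)))
  have hT : ((ContinuousLinearMap.fst ℝ P F + K.comp (ContinuousLinearMap.snd ℝ P F)).prod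
      (ContinuousLinearMap.snd ℝ P F)).IsInvertible :=
    .of_inverse (g := (ContinuousLinearMap.fst ℝ P F - K.comp (ContinuousLinearMap.snd ℝ P F)).prod
      (ContinuousLinearMap.snd ℝ P F)) (by ext <;> simp) (by ext <;> simp)
  have hcomp : A = (movingFrame u i x).comp
      ((ContinuousLinearMap.fst ℝ P F + K.comp (ContinuousLinearMap.snd ℝ P F)).prod
        (ContinuousLinearMap.snd ℝ P F)) := by
    refine ContinuousLinearMap.ext fun p => ?_
    have h1 := fderiv_add_incl_normalCoord hinv (A (0, p.2))
    rw [hF] at h1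
    have h2 : A p = A (p.1, 0) + A (0, p.2) := by rw [← map_add]; simp
    change _ = fderiv ℝ u x (p.1 + ((movingFrame u i x).inverse (A (0, p.2))).1) + i p.2
    rw [h2, hP, map_add, add_assoc, h1]
  rw [hcomp]
  exact hinv.comp hT

/-- The linear dilatation `(ξ, η) ↦ (ξ, t η)`. -/
def dilation (P F : Type*) [NormedAddCommGroup P] [NormedSpace ℝ P]
    [NormedAddCommGroup F] [NormedSpace ℝ F] (t : ℝ) : P × F →L[ℝ] P × F :=
  (ContinuousLinearMap.fst ℝ P F).prod (t • ContinuousLinearMap.snd ℝ P F)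

theorem isInvertible_dilation {t : ℝ} (ht : t ≠ 0) : (dilation P F t).IsInvertible :=
  .of_inverse (g := dilation P F t⁻¹) (by ext <;> simp [dilation, ht])
    (by ext <;> simp [dilation, ht])

theorem inverse_dilation {t : ℝ} (ht : t ≠ 0) (q : P × F) :
    (dilation P F t).inverse q = (q.1, t⁻¹ • q.2) := by
  refine (isInvertible_dilation ht).inverse_apply_eq.2 ?_
  ext <;> simp [dilation, ht]

theorem tendsto_smul_zero {P : Type*} [TopologicalSpace P] (x : P) (y : F) :
    Tendsto (fun t : ℝ => (x, t • y)) (𝓝 0) (𝓝 (x, 0)) := by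
  have h : Continuous (fun t : ℝ => (x, t • y)) := by fun_prop
  simpa using h.tendsto 0

/-- The derivative of a dilated map factors through the linear dilatation. -/
theorem fderiv_comp_dilate {φ : P × F → E} (hφ : ContDiffAt ℝ ∞ φ (x, 0)) (y : F) :
    ∀ᶠ t : ℝ in 𝓝 0, fderiv ℝ (fun p : P × F => φ (p.1, t • p.2)) (x, y) =
      (fderiv ℝ φ (x, t • y)).comp (dilation P F t) := by
  have h1 : ∀ᶠ q in 𝓝 ((x, 0) : P × F), DifferentiableAt ℝ φ q :=
    ((hφ.of_le (m := 1) (mod_cast le_top)).eventually (by simp)).mono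
      fun q hq => hq.differentiableAt (by simp)
  filter_upwards [(tendsto_smul_zero x y).eventually h1] with t ht
  have h2 : HasFDerivAt (fun p : P × F => (p.1, t • p.2)) (dilation P F t) (x, y) :=
    (ContinuousLinearMap.fst ℝ P F).hasFDerivAt.prodMk
      ((ContinuousLinearMap.snd ℝ P F).hasFDerivAt.const_smul t)
  have h3 : HasFDerivAt φ (fderiv ℝ φ (x, t • y)) ((fun p : P × F => (p.1, t • p.2)) (x, y)) :=
    ht.hasFDerivAt
  exact (h3.comp (x, y) h2).fderiv

theorem eventually_isInvertible_of_continuousAt [CompleteSpace P] {A : ℝ → P →L[ℝ] E}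
    (hA : ContinuousAt A 0) (h0 : (A 0).IsInvertible) : ∀ᶠ t in 𝓝 0, (A t).IsInvertible := by
  obtain ⟨e, he⟩ := h0
  have h1 := e.nhds
  rw [he] at h1
  exact hA h1

/-- The derivative `G'` of `A_t⁻¹ h_t` satisfies `A' (A_0⁻¹ h_0) + A_0 G' = h'`. -/
theorem hasDerivAt_inverse_apply [CompleteSpace P] {A : ℝ → P →L[ℝ] E} {h : ℝ → E}
    {A' : P →L[ℝ] E} {h' : E} (hA : HasDerivAt A A' 0) (hh : HasDerivAt h h' 0)
    (h0 : (A 0).IsInvertible) :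
    ∃ G' : P, HasDerivAt (fun t => (A t).inverse (h t)) G' 0 ∧
      A' ((A 0).inverse (h 0)) + A 0 G' = h' := by
  have hev := eventually_isInvertible_of_continuousAt hA.continuousAt h0
  have hd : DifferentiableAt ℝ (fun t => (A t).inverse) 0 := by
    obtain ⟨e, he⟩ := h0
    have h1 : ContDiffAt ℝ ∞ ContinuousLinearMap.inverse (A 0) := by
      rw [← he]; exact contDiffAt_map_inverse e
    exact (h1.differentiableAt (by simp)).comp (0 : ℝ) hA.differentiableAt
  have hG := (hd.clm_apply hh.differentiableAt).hasDerivAt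
  exact ⟨_, hG, (hA.clm_apply hG).unique
    (hh.congr_of_eventuallyEq (hev.mono fun t ht => ht.self_apply_inverse (h t)))⟩

/-- With `F_t = dφ(x, t y)`, the map `F_t⁻¹ J F_t` applied to `(ξ, t η)` starts at `(j ξ, 0)`, and
the normal component of its initial velocity is that of the NB-II structure. -/
theorem hasDerivAt_conj [CompleteSpace P] [CompleteSpace F] {φ : P × F → E}
    (hu : ContDiffAt ℝ ∞ u x)
    (hJ : DifferentiableAt ℝ J (u x)) (hj : DifferentiableAt ℝ j x)
    (hjsq : ∀ ζ, j x (j x ζ) = -ζ)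
    (hhol : ∀ᶠ x' in 𝓝 x, ∀ ζ, J (u x') (fderiv ℝ u x' ζ) = fderiv ℝ u x' (j x' ζ))
    (hinv : (movingFrame u i x).IsInvertible)
    (hφ : ContDiffAt ℝ ∞ φ (x, 0)) (hφ0 : ∀ᶠ x' in 𝓝 x, φ (x', 0) = u x')
    (hφ1 : ∀ᶠ x' in 𝓝 x, ∀ η, normalCoord u i x' (fderiv ℝ φ (x', 0) (0, η)) = η) (y : F)
    (p : P × F) :
    (∀ᶠ t : ℝ in 𝓝 0, (fderiv ℝ φ (x, t • y)).IsInvertible) ∧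
    (fderiv ℝ φ (x, 0)).inverse (J (φ (x, 0)) (fderiv ℝ φ (x, 0) (p.1, 0))) = (j x p.1, 0) ∧
    ∃ G' : P × F, G'.2 = (localNBII u J (j x) i x y p).2 ∧
      HasDerivAt (fun t : ℝ => (fderiv ℝ φ (x, t • y)).inverse
        (J (φ (x, t • y)) (fderiv ℝ φ (x, t • y) (p.1, t • p.2)))) G' 0 := by
  have hdφ : ContDiffAt ℝ ∞ (fderiv ℝ φ) (x, 0) := hφ.fderiv_right (m := ∞) le_rfl
  have hline : HasDerivAt (fun t : ℝ => (x, t • y)) ((0 : P), y) 0 := by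
    simpa using (hasDerivAt_const (0 : ℝ) x).prodMk ((hasDerivAt_id (0 : ℝ)).smul_const y)
  have h00 : ((x, (0 : ℝ) • y) : P × F) = (x, 0) := by rw [zero_smul]
  have hslice : HasFDerivAt (fun x' : P => (x', (0 : F)))
      ((ContinuousLinearMap.id ℝ P).prod (0 : P →L[ℝ] F)) x :=
    (hasFDerivAt_id x).prodMk (hasFDerivAt_const (0 : F) x)
  have hφ' : HasFDerivAt φ (fderiv ℝ φ (x, 0)) (x, 0) :=
    (hφ.differentiableAt (by simp)).hasFDerivAt
  have hdφ' : HasFDerivAt (fderiv ℝ φ) (fderiv ℝ (fderiv ℝ φ) (x, 0)) (x, 0) :=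
    (hdφ.differentiableAt (by simp)).hasFDerivAt
  -- the derivatives of `φ` at `(x, 0)` in the two directions
  have hux : fderiv ℝ u x = (fderiv ℝ φ (x, 0)).comp
      ((ContinuousLinearMap.id ℝ P).prod (0 : P →L[ℝ] F)) :=
    ((hφ'.comp x hslice).congr_of_eventuallyEq (hφ0.mono fun _ h => h.symm)).fderiv
  have hφP : ∀ ξ, fderiv ℝ φ (x, 0) (ξ, 0) = fderiv ℝ u x ξ := fun ξ => by rw [hux]; rfl
  have hφF : ∀ η, normalCoord u i x (fderiv ℝ φ (x, 0) (0, η)) = η := hφ1.self_of_nhds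
  have hsplit : ∀ p : P × F, fderiv ℝ φ (x, 0) p =
      fderiv ℝ u x p.1 + fderiv ℝ φ (x, 0) (0, p.2) := fun p => by
    rw [← hφP, ← map_add]; simp
  have hcoord : ∀ p : P × F, normalCoord u i x (fderiv ℝ φ (x, 0) p) = p.2 := fun p => by
    rw [hsplit, map_add, normalCoord_fderiv hinv, hφF, zero_add]
  have hF0 := isInvertible_of_normalCoord hinv hφP hφF
  have hFt : HasDerivAt (fun t : ℝ => fderiv ℝ φ (x, t • y))
      (fderiv ℝ (fderiv ℝ φ) (x, 0) (0, y)) 0 := by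
    rw [← h00] at hdφ'
    have := hdφ'.comp_hasDerivAt (0 : ℝ) hline
    rwa [h00] at this
  have hφt : HasDerivAt (fun t : ℝ => φ (x, t • y)) (fderiv ℝ φ (x, 0) (0, y)) 0 := by
    rw [← h00] at hφ'
    have := hφ'.comp_hasDerivAt (0 : ℝ) hline
    rwa [h00] at this
  have hJt : HasDerivAt (fun t : ℝ => J (φ (x, t • y)))
      (fderiv ℝ J (u x) (fderiv ℝ φ (x, 0) (0, y))) 0 := by
    have h2 : HasFDerivAt J (fderiv ℝ J (u x)) (φ (x, (0 : ℝ) • y)) := by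
      rw [h00, hφ0.self_of_nhds]; exact hJ.hasFDerivAt
    exact h2.comp_hasDerivAt (0 : ℝ) hφt
  have hpt : HasDerivAt (fun t : ℝ => (p.1, t • p.2)) ((0 : P), p.2) 0 := by
    simpa using (hasDerivAt_const (0 : ℝ) p.1).prodMk ((hasDerivAt_id (0 : ℝ)).smul_const p.2)
  have hder := hJt.clm_apply (hFt.clm_apply hpt)
  have hF0' : (fderiv ℝ φ (x, (0 : ℝ) • y)).IsInvertible := by rwa [h00]
  have hG0 : (fderiv ℝ φ (x, 0)).inverse (J (φ (x, 0)) (fderiv ℝ φ (x, 0) (p.1, 0))) =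
      (j x p.1, 0) := by
    rw [hφP, hφ0.self_of_nhds, hhol.self_of_nhds, ← hφP, hF0.inverse_apply_self]
  obtain ⟨G', hG', h2⟩ := hasDerivAt_inverse_apply hFt hder hF0'
  refine ⟨eventually_isInvertible_of_continuousAt hFt.continuousAt hF0', hG0, G', ?_, hG'⟩
  -- it remains to identify the normal component of `G'`
  simp only [zero_smul] at h2
  rw [hG0, hφP, hφ0.self_of_nhds] at h2
  have hbd := (hdφ'.comp x hslice).clm_apply (hasFDerivAt_const ((0 : P), y) x)
  have hsymm : ∀ ξ, fderiv ℝ (fderiv ℝ φ) (x, 0) (0, y) (ξ, 0) =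
      fderiv ℝ (fun x' => fderiv ℝ φ (x', 0) (0, y)) x ξ := fun ξ => by
    have h3 := hbd.fderiv
    simp only [Function.comp_apply] at h3
    rw [(hφ.isSymmSndFDerivAt (by simpa using ENat.LEInfty.out)).eq, h3]
    simp
  -- the direction `∂φ/∂y (y)` agrees with `i y` modulo the tangent space
  have h3 := normalCoord_linCR_congr (v := fun x' => fderiv ℝ φ (x', 0) (0, y)) (w := fun _ => i y)
    hu hJ hj hjsq hhol hinv hbd.differentiableAt (differentiableAt_const _)
    (by filter_upwards [hφ1, eventually_isInvertible hu hinv] with x' hx' hx'i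
        rw [normalCoord_incl hx'i, hx']) (j x p.1)
  rw [linCR_apply, linCR_apply, hjsq] at h3
  simp only [fderiv_fun_const, map_neg, map_smul, map_add, Pi.zero_apply, zero_apply, zero_add,
    map_zero] at h3
  rw [hsymm, hsymm] at h2
  -- the normal part of the equation that `G'` satisfies
  have h4 := congrArg (normalCoord u i x) h2
  have h5 := normalCoord_map_incl hinv (A := J (u x)) hhol.self_of_nhds
    (fderiv ℝ φ (x, 0) (0, p.2))
  rw [hφF] at h5
  simp only [map_add, hcoord] at h4
  change _ = normalCoord u i x (fderiv ℝ J (u x) (i y) (fderiv ℝ u x p.1) + J (u x) (i p.2))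
  rw [map_add, h5]
  -- the factor `2` cancels the `½` in the linearization
  linear_combination (norm := module) h4 - (2 : ℝ) • h3

/-- The dilatations of a tubular parametrization converge to the NB-II structure. -/
theorem tendsto_conj_dilate [CompleteSpace P] [CompleteSpace F] {φ : P × F → E}
    (hu : ContDiffAt ℝ ∞ u x)
    (hJ : DifferentiableAt ℝ J (u x)) (hj : DifferentiableAt ℝ j x)
    (hjsq : ∀ ζ, j x (j x ζ) = -ζ)
    (hhol : ∀ᶠ x' in 𝓝 x, ∀ ζ, J (u x') (fderiv ℝ u x' ζ) = fderiv ℝ u x' (j x' ζ))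
    (hinv : (movingFrame u i x).IsInvertible)
    (hφ : ContDiffAt ℝ ∞ φ (x, 0)) (hφ0 : ∀ᶠ x' in 𝓝 x, φ (x', 0) = u x')
    (hφ1 : ∀ᶠ x' in 𝓝 x, ∀ η, normalCoord u i x' (fderiv ℝ φ (x', 0) (0, η)) = η) (y : F) :
    ∀ p : P × F, Tendsto (fun t : ℝ =>
      (fderiv ℝ (fun p : P × F => φ (p.1, t • p.2)) (x, y)).inverse
        (J (φ (x, t • y)) (fderiv ℝ (fun p : P × F => φ (p.1, t • p.2)) (x, y) p))) (𝓝[≠] 0)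
      (𝓝 (localNBII u J (j x) i x y p)) := by
  have hne : ∀ᶠ t : ℝ in 𝓝[≠] 0, t ≠ 0 := eventually_mem_nhdsWithin
  have hfac := (fderiv_comp_dilate hφ y).filter_mono (nhdsWithin_le_nhds (s := {0}ᶜ))
  have hinvt := (hasDerivAt_conj hu hJ hj hjsq hhol hinv hφ hφ0 hφ1 y 0).1.filter_mono
    (nhdsWithin_le_nhds (s := {0}ᶜ))
  intro p
  obtain ⟨-, hG0, G', hG2, hG⟩ := hasDerivAt_conj hu hJ hj hjsq hhol hinv hφ hφ0 hφ1 y p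
  have h1 := hG.continuousAt.fst.tendsto
  have h2 : HasDerivAt (fun t : ℝ => ((fderiv ℝ φ (x, t • y)).inverse
        (J (φ (x, t • y)) (fderiv ℝ φ (x, t • y) (p.1, t • p.2)))).2) G'.2 0 :=
    (ContinuousLinearMap.snd ℝ P F).hasFDerivAt.comp_hasDerivAt (0 : ℝ) hG
  -- the second component of the conjugated structure is a difference quotient at `0`, because of
  -- the factor `t⁻¹` in the inverse dilatation
  have h3 := hasDerivAt_iff_tendsto_slope.1 h2
  simp only [zero_smul, hG0] at h1
  rw [hG2] at h3
  refine ((h1.mono_left nhdsWithin_le_nhds).prodMk_nhds h3).congr' ?_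
  filter_upwards [hne, hinvt, hfac] with t ht h1 h2
  rw [h2, h1.inverse_comp_apply_of_left, inverse_dilation ht]
  simp only [slope, vsub_eq_sub, sub_zero, zero_smul, hG0]
  rfl

end

end LocalCauchyRiemann
end

/-! ### Tangent vectors, derivatives and velocities in charts -/

noncomputable section

section Coordinates

variable {E H M : Type*} [NormedAddCommGroup E] [NormedSpace ℝ E] [TopologicalSpace H]
  {I : ModelWithCorners ℝ E H} [TopologicalSpace M] [ChartedSpace H M]

/-- A property that holds near `x` holds near the coordinates of `x`. -/
theorem eventually_extChartAt_symm [I.Boundaryless] {x₀ x : M} (hx : x ∈ (chartAt H x₀).source)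
    {p : M → Prop} (h : ∀ᶠ x' in 𝓝 x, p x') :
    ∀ᶠ y in 𝓝 (extChartAt I x₀ x), y ∈ (extChartAt I x₀).target ∧ p ((extChartAt I x₀).symm y) := by
  rw [← extChartAt_source I] at hx
  have h1 := continuousAt_extChartAt_symm' hx
  have h2 : (extChartAt I x₀).symm (extChartAt I x₀ x) = x := (extChartAt I x₀).left_inv hx
  refine Filter.Eventually.and (extChartAt_target_mem_nhds' ((extChartAt I x₀).map_source hx))
    (h1.eventually ?_)
  rwa [h2]

variable [IsManifold I ∞ M]

/-- The coordinates of the tangent vectors at `x` in the chart at `x₀`. -/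
def tangentCoord (I : ModelWithCorners ℝ E H) [IsManifold I ∞ M] (x₀ x : M) :
    TangentSpace I x →L[ℝ] E :=
  (trivializationAt E (TangentSpace I) x₀).continuousLinearMapAt ℝ x

theorem tangentCoord_eq_mfderiv {x₀ x : M} (hx : x ∈ (chartAt H x₀).source) :
    tangentCoord I x₀ x = mfderiv I 𝓘(ℝ, E) (extChartAt I x₀) x :=
  have : IsManifold I 1 M := IsManifold.of_le (n := ∞) (mod_cast le_top)
  TangentBundle.continuousLinearMapAt_trivializationAt hx

/-- At its centre, the chart induces the identity: `TangentSpace I x` is by definition the model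
space, identified by the chart at `x`. -/
theorem tangentCoord_self (x : M) (v : TangentSpace I x) : tangentCoord I x x v = v := by
  have : IsManifold I 1 M := IsManifold.of_le (n := ∞) (mod_cast le_top)
  rw [tangentCoord_eq_mfderiv (mem_chart_source H x), mfderiv_extChartAt_self]
  rfl

theorem trivializationAt_tangent_snd {x₀ x : M} (hx : x ∈ (chartAt H x₀).source)
    (v : TangentSpace I x) :
    (trivializationAt E (TangentSpace I) x₀ (⟨x, v⟩ : TangentBundle I M)).2 =
      tangentCoord I x₀ x v := by
  rw [tangentCoord, Trivialization.continuousLinearMapAt_apply,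
    Trivialization.coe_linearMapAt_of_mem _ hx]

/-- The coordinates of the tangent vectors at `x` in the chart at `x₀`, as an equivalence. -/
def tangentCoordEquiv (I : ModelWithCorners ℝ E H) [IsManifold I ∞ M] {x₀ x : M}
    (hx : x ∈ (chartAt H x₀).source) : TangentSpace I x ≃L[ℝ] E :=
  (trivializationAt E (TangentSpace I) x₀).continuousLinearEquivAt ℝ x hx

theorem tangentCoordEquiv_apply {x₀ x : M} (hx : x ∈ (chartAt H x₀).source)
    (v : TangentSpace I x) : tangentCoordEquiv I hx v = tangentCoord I x₀ x v := by
  rw [← trivializationAt_tangent_snd hx]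
  rfl

theorem tangentCoord_injective {x₀ x : M} (hx : x ∈ (chartAt H x₀).source) :
    Function.Injective (tangentCoord I x₀ x) := by
  intro v w h
  rw [← tangentCoordEquiv_apply hx, ← tangentCoordEquiv_apply hx] at h
  exact (tangentCoordEquiv I hx).injective h

theorem tangentCoord_symmL {x₀ x : M} (hx : x ∈ (chartAt H x₀).source) (w : E) :
    tangentCoord I x₀ x ((trivializationAt E (TangentSpace I) x₀).symmL ℝ x w) = w :=
  (trivializationAt E (TangentSpace I) x₀).continuousLinearMapAt_symmL hx w

theorem symmL_tangentCoord {x₀ x : M} (hx : x ∈ (chartAt H x₀).source) (v : TangentSpace I x) :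
    (trivializationAt E (TangentSpace I) x₀).symmL ℝ x (tangentCoord I x₀ x v) = v :=
  (trivializationAt E (TangentSpace I) x₀).symmL_continuousLinearMapAt hx v

variable {E' H' M' : Type*} [NormedAddCommGroup E'] [NormedSpace ℝ E'] [TopologicalSpace H']
  {I' : ModelWithCorners ℝ E' H'} [TopologicalSpace M'] [ChartedSpace H' M']

/-- The derivative of a map in coordinates. -/
theorem fderiv_coord [I.Boundaryless] [IsManifold I' ∞ M'] {f : M → M'} {x₀ x : M} {y₀ : M'}
    (hf : MDifferentiableAt I I' f x)
    (hx : x ∈ (chartAt H x₀).source) (hy : f x ∈ (chartAt H' y₀).source) (v : TangentSpace I x) :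
    DifferentiableAt ℝ (fun a => extChartAt I' y₀ (f ((extChartAt I x₀).symm a)))
      (extChartAt I x₀ x) ∧
    fderiv ℝ (fun a => extChartAt I' y₀ (f ((extChartAt I x₀).symm a))) (extChartAt I x₀ x)
      (tangentCoord I x₀ x v) = tangentCoord I' y₀ (f x) (mfderiv I I' f x v) := by
  have : IsManifold I 1 M := IsManifold.of_le (n := ∞) (mod_cast le_top)
  have : IsManifold I' 1 M' := IsManifold.of_le (n := ∞) (mod_cast le_top)
  have hx' : x ∈ (extChartAt I x₀).source := by rwa [extChartAt_source]
  have hxx : (extChartAt I x₀).symm (extChartAt I x₀ x) = x := (extChartAt I x₀).left_inv hx'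
  have h1 : MDifferentiableAt I' 𝓘(ℝ, E') (extChartAt I' y₀) (f x) := mdifferentiableAt_extChartAt hy
  have h2 : MDifferentiableAt 𝓘(ℝ, E) I (extChartAt I x₀).symm (extChartAt I x₀ x) := by
    have := mdifferentiableWithinAt_extChartAt_symm ((extChartAt I x₀).map_source hx')
    rwa [I.range_eq_univ, mdifferentiableWithinAt_univ] at this
  have h3 : MDifferentiableAt I 𝓘(ℝ, E) (extChartAt I x₀) x := mdifferentiableAt_extChartAt hx
  have h4 : MDifferentiableAt I 𝓘(ℝ, E') (fun p => extChartAt I' y₀ (f p)) x := h1.comp x hf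
  have h5 : MDifferentiableAt 𝓘(ℝ, E) 𝓘(ℝ, E')
      (fun a => extChartAt I' y₀ (f ((extChartAt I x₀).symm a))) (extChartAt I x₀ x) := by
    refine MDifferentiableAt.comp (g := fun p => extChartAt I' y₀ (f p)) _ ?_ h2
    rwa [hxx]
  have h6 : (fun p => extChartAt I' y₀ (f p)) =ᶠ[𝓝 x]
      (fun a => extChartAt I' y₀ (f ((extChartAt I x₀).symm a))) ∘ extChartAt I x₀ := by
    filter_upwards [extChartAt_source_mem_nhds' hx'] with p hp
    simp only [Function.comp_apply, (extChartAt I x₀).left_inv hp]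
  have h7 := h6.mfderiv_eq (I := I) (I' := 𝓘(ℝ, E'))
  rw [mfderiv_comp x h5 h3] at h7
  have h8 := mfderiv_comp x h1 hf
  refine ⟨h5.differentiableAt, ?_⟩
  rw [tangentCoord_eq_mfderiv hx, tangentCoord_eq_mfderiv hy, ← mfderiv_eq_fderiv]
  have h9 := h7.symm.trans h8
  exact congrArg (fun A : E →L[ℝ] E' => A v) h9

/-- The velocity of a curve in coordinates. -/
theorem hasDerivAt_coord_of_velocity_eq {c : ℝ → M} {x₀ x : M} {v : TangentSpace I x}
    (hc : MDifferentiableAt 𝓘(ℝ, ℝ) I c 0) (hx : x ∈ (chartAt H x₀).source)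
    (h : velocity I c = ⟨x, v⟩) :
    HasDerivAt (fun t => extChartAt I x₀ (c t)) (tangentCoord I x₀ x v) 0 := by
  have h0 : c 0 = x := congrArg TotalSpace.proj h
  subst h0
  have h1 : mfderiv 𝓘(ℝ, ℝ) I c 0 (1 : ℝ) = v := TotalSpace.mk_injective _ h
  have h2 := fderiv_coord (x₀ := (0 : ℝ)) hc (mem_chart_source _ _) hx
    (1 : ℝ)
  have h3 : tangentCoord 𝓘(ℝ, ℝ) (0 : ℝ) (0 : ℝ) (1 : ℝ) = (1 : ℝ) := tangentCoord_self _ _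
  have h4 : fderiv ℝ (fun t => extChartAt I x₀ (c t)) (0 : ℝ) (1 : ℝ) =
      tangentCoord I x₀ (c 0) v := by
    rw [← h1, ← h2.2, h3]
    rfl
  have h5 : DifferentiableAt ℝ (fun t => extChartAt I x₀ (c t)) (0 : ℝ) := h2.1
  rw [← h4]
  exact h5.hasDerivAt

/-- A curve whose coordinates have the derivative of a tangent vector `v` has velocity `v`. -/
theorem velocity_eq {c : ℝ → M} {x₀ x : M} {v : TangentSpace I x}
    (hc : MDifferentiableAt 𝓘(ℝ, ℝ) I c 0) (h0 : c 0 = x) (hx : x ∈ (chartAt H x₀).source)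
    (h : HasDerivAt (fun t => extChartAt I x₀ (c t)) (tangentCoord I x₀ x v) 0) :
    velocity I c = ⟨x, v⟩ := by
  subst h0
  refine congrArg (TotalSpace.mk (c 0)) (tangentCoord_injective hx ?_)
  have h1 : velocity I c = ⟨c 0, mfderiv 𝓘(ℝ, ℝ) I c 0 (1 : ℝ)⟩ := rfl
  exact (hasDerivAt_coord_of_velocity_eq hc hx h1).unique h

/-- A curve in the tangent bundle that starts at a zero vector has, in every chart, an initial
derivative that is given by one and the same tangent vector. -/
theorem hasDerivAt_tangentCoord_change {c : ℝ → M} {β : ∀ t, TangentSpace I (c t)} {x₀ x₁ x : M}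
    {a : TangentSpace I x} (hc : ContinuousAt c 0) (hx : c 0 = x) (h0 : x ∈ (chartAt H x₀).source)
    (h1 : x ∈ (chartAt H x₁).source) (hβ : β 0 = 0)
    (h : HasDerivAt (fun t => tangentCoord I x₀ (c t) (β t)) (tangentCoord I x₀ x a) 0) :
    HasDerivAt (fun t => tangentCoord I x₁ (c t) (β t)) (tangentCoord I x₁ x a) 0 := by
  subst hx
  have : IsManifold I 1 M := IsManifold.of_le (n := ∞) (mod_cast le_top)
  let e₀ := trivializationAt E (TangentSpace I : M → Type _) x₀
  let e₁ := trivializationAt E (TangentSpace I : M → Type _) x₁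
  let C : M → E →L[ℝ] E := fun p => ((e₀.coordChangeL ℝ e₁ p : E ≃L[ℝ] E) : E →L[ℝ] E)
  have hmem : e₀.baseSet ∩ e₁.baseSet ∈ 𝓝 (c 0) :=
    (e₀.open_baseSet.inter e₁.open_baseSet).mem_nhds ⟨h0, h1⟩
  have hC : ContinuousAt C (c 0) := (continuousOn_coordChange ℝ e₀ e₁).continuousAt hmem
  have hCv : ∀ p ∈ e₀.baseSet ∩ e₁.baseSet, ∀ v : TangentSpace I p,
      C p (tangentCoord I x₀ p v) = tangentCoord I x₁ p v := by
    intro p hp v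
    change e₀.coordChangeL ℝ e₁ p (tangentCoord I x₀ p v) = _
    rw [Trivialization.coordChangeL_apply _ _ hp, ← Trivialization.symmL_apply e₀ hp.1 (R := ℝ)]
    change (e₁ ⟨p, (trivializationAt E (TangentSpace I) x₀).symmL ℝ p (tangentCoord I x₀ p v)⟩).2 = _
    rw [symmL_tangentCoord hp.1]
    exact trivializationAt_tangent_snd hp.2 v
  have hz : ∀ y : M, tangentCoord I y (c 0) (β 0) = 0 := fun y => by rw [hβ, map_zero]
  -- as the curve starts at a zero vector, its difference quotients are transformed linearly, and
  -- no derivative of the coordinate change enters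
  rw [hasDerivAt_iff_tendsto_slope] at h ⊢
  have h2 : Tendsto (fun t => C (c t)) (𝓝[≠] 0) (𝓝 (C (c 0))) :=
    (hC.comp hc).tendsto.mono_left nhdsWithin_le_nhds
  have h3 : Tendsto (fun t => C (c t) (slope (fun t => tangentCoord I x₀ (c t) (β t)) 0 t)) (𝓝[≠] 0)
      (𝓝 (C (c 0) (tangentCoord I x₀ (c 0) a))) :=
    (isBoundedBilinearMap_apply (𝕜 := ℝ) (E := E) (F := E)).continuous.continuousAt.tendsto.comp
      (h2.prodMk_nhds h)
  rw [hCv _ ⟨h0, h1⟩] at h3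
  refine h3.congr' ?_
  filter_upwards [(hc.eventually hmem).filter_mono nhdsWithin_le_nhds] with t ht
  simp only [slope, vsub_eq_sub, hz, sub_zero, map_smul, hCv _ ht]

end Coordinates
end

/-! ### Almost complex structures and immersions in charts -/

noncomputable section

/-- Smooth functions on a manifold are smooth functions of the coordinates. -/
theorem contDiffAt_comp_extChartAt_symm {E H M F : Type*} [NormedAddCommGroup E] [NormedSpace ℝ E]
    [TopologicalSpace H] {I : ModelWithCorners ℝ E H} [I.Boundaryless] [TopologicalSpace M]
    [ChartedSpace H M] [IsManifold I ∞ M] [NormedAddCommGroup F] [NormedSpace ℝ F] {f : M → F}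
    {x₀ x : M} (hx : x ∈ (chartAt H x₀).source) (hf : ContMDiffAt I 𝓘(ℝ, F) ∞ f x) :
    ContDiffAt ℝ ∞ (fun y => f ((extChartAt I x₀).symm y)) (extChartAt I x₀ x) := by
  have hx' : x ∈ (extChartAt I x₀).source := by rwa [extChartAt_source]
  have h1 : ContMDiffAt 𝓘(ℝ, E) I ∞ (extChartAt I x₀).symm (extChartAt I x₀ x) :=
    (contMDiffOn_extChartAt_symm x₀).contMDiffAt
      (extChartAt_target_mem_nhds' ((extChartAt I x₀).map_source hx'))
  refine ContMDiffAt.contDiffAt (ContMDiffAt.comp (g := f) _ ?_ h1)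
  rwa [(extChartAt I x₀).left_inv hx']

theorem ContMDiffAt.eventually_mdifferentiableAt {E H M E' H' M' : Type*}
    [NormedAddCommGroup E] [NormedSpace ℝ E] [TopologicalSpace H] {I : ModelWithCorners ℝ E H}
    [TopologicalSpace M] [ChartedSpace H M] [IsManifold I ∞ M]
    [NormedAddCommGroup E'] [NormedSpace ℝ E'] [TopologicalSpace H'] {I' : ModelWithCorners ℝ E' H'}
    [TopologicalSpace M'] [ChartedSpace H' M'] [IsManifold I' ∞ M'] {f : M → M'} {x : M}
    (hf : ContMDiffAt I I' ∞ f x) : ∀ᶠ y in 𝓝 x, MDifferentiableAt I I' f y := by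
  have : IsManifold I 1 M := IsManifold.of_le (n := ∞) (mod_cast le_top)
  have : IsManifold I' 1 M' := IsManifold.of_le (n := ∞) (mod_cast le_top)
  exact ((contMDiffAt_iff_contMDiffAt_nhds (by simp)).1
    (hf.of_le (m := 1) (mod_cast le_top))).mono fun y hy => hy.mdifferentiableAt (by simp)

namespace AlmostComplexStructure

variable {E : Type*} [NormedAddCommGroup E] [NormedSpace ℝ E]
  {M : Type*} [TopologicalSpace M] [ChartedSpace E M] [IsManifold 𝓘(ℝ, E) ∞ M]

/-- An almost complex structure in the chart at `x₀`. -/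
def coord (J : AlmostComplexStructure E M) (x₀ : M) (y : E) : E →L[ℝ] E :=
  (tangentCoord 𝓘(ℝ, E) x₀ ((extChartAt 𝓘(ℝ, E) x₀).symm y)).comp
    ((J.toSection ((extChartAt 𝓘(ℝ, E) x₀).symm y)).comp
      ((trivializationAt E (TangentSpace 𝓘(ℝ, E)) x₀).symmL ℝ ((extChartAt 𝓘(ℝ, E) x₀).symm y)))

theorem coord_tangentCoord (J : AlmostComplexStructure E M) {x₀ x : M}
    (hx : x ∈ (chartAt E x₀).source) (v : TangentSpace 𝓘(ℝ, E) x) :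
    J.coord x₀ (extChartAt 𝓘(ℝ, E) x₀ x) (tangentCoord 𝓘(ℝ, E) x₀ x v) =
      tangentCoord 𝓘(ℝ, E) x₀ x (J.toSection x v) := by
  have hx' : x ∈ (extChartAt 𝓘(ℝ, E) x₀).source := by rwa [extChartAt_source]
  -- the base point is generalized, since the tangent spaces at `x` and at the inverse image of its
  -- coordinates are different types
  have h : ∀ x', x' = x → (tangentCoord 𝓘(ℝ, E) x₀ x').comp ((J.toSection x').comp
      ((trivializationAt E (TangentSpace 𝓘(ℝ, E)) x₀).symmL ℝ x'))
        (tangentCoord 𝓘(ℝ, E) x₀ x v) = tangentCoord 𝓘(ℝ, E) x₀ x (J.toSection x v) := by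
    rintro _ rfl
    simp only [ContinuousLinearMap.comp_apply]
    rw [symmL_tangentCoord hx]
  exact h _ ((extChartAt 𝓘(ℝ, E) x₀).left_inv hx')

theorem contDiffAt_coord (J : AlmostComplexStructure E M) {x₀ x : M}
    (hx : x ∈ (chartAt E x₀).source) :
    ContDiffAt ℝ ∞ (J.coord x₀) (extChartAt 𝓘(ℝ, E) x₀ x) := by
  have h := (((trivializationAt E (TangentSpace 𝓘(ℝ, E) : M → Type _) x₀).continuousLinearMap
    (RingHom.id ℝ)
    (trivializationAt E (TangentSpace 𝓘(ℝ, E) : M → Type _) x₀)).contMDiffOn_section_baseSet_iff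
      (IB := 𝓘(ℝ, E)) (n := ∞)).1 J.toSection.contMDiff.contMDiffOn
  have h1 : ContMDiffAt 𝓘(ℝ, E) 𝓘(ℝ, E →L[ℝ] E) ∞
      (fun x => (tangentCoord 𝓘(ℝ, E) x₀ x).comp ((J.toSection x).comp
        ((trivializationAt E (TangentSpace 𝓘(ℝ, E)) x₀).symmL ℝ x))) x :=
    h.contMDiffAt (((chartAt E x₀).open_source.inter (chartAt E x₀).open_source).mem_nhds ⟨hx, hx⟩)
  exact contDiffAt_comp_extChartAt_symm hx h1

theorem eventually_coord_sq (J : AlmostComplexStructure E M) {x₀ x : M}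
    (hx : x ∈ (chartAt E x₀).source) :
    ∀ᶠ y in 𝓝 (extChartAt 𝓘(ℝ, E) x₀ x), ∀ w, J.coord x₀ y (J.coord x₀ y w) = -w := by
  filter_upwards [eventually_extChartAt_symm (I := 𝓘(ℝ, E)) hx
    ((chartAt E x₀).open_source.mem_nhds hx)] with y hy w
  have h1 := J.coord_tangentCoord hy.2
  rw [(extChartAt 𝓘(ℝ, E) x₀).right_inv hy.1] at h1
  rw [← tangentCoord_symmL (I := 𝓘(ℝ, E)) hy.2 w, h1, h1, J.sq, map_neg]

end AlmostComplexStructure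

namespace SmoothImmersion

variable {S : Type*} [TopologicalSpace S] [ChartedSpace Plane S]
  {E : Type*} [NormedAddCommGroup E] [NormedSpace ℝ E]
  {M : Type*} [TopologicalSpace M] [ChartedSpace E M] [IsManifold 𝓘(ℝ, E) ∞ M]

/-- The immersion in the charts at `z₀` and `u z₀`. -/
def coord (u : SmoothImmersion S E M) (z₀ : S) (x : Plane) : E :=
  extChartAt 𝓘(ℝ, E) (u.toMap z₀) (u.toMap ((extChartAt 𝓘(ℝ, Plane) z₀).symm x))

/-- The coordinates of the vectors of `T_{u(z)} M` in the chart at `u z₀`. -/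
def pullCoord (u : SmoothImmersion S E M) (z₀ z : S) : u.Pull z →L[ℝ] E :=
  (trivializationAt E u.Pull z₀).continuousLinearMapAt ℝ z

/-- A section of `u^*TM` in the charts at `z₀` and `u z₀`. -/
def coordSection (u : SmoothImmersion S E M) (v : u.PullSection) (z₀ : S) (x : Plane) : E :=
  u.pullCoord z₀ ((extChartAt 𝓘(ℝ, Plane) z₀).symm x) (v ((extChartAt 𝓘(ℝ, Plane) z₀).symm x))

variable {u : SmoothImmersion S E M} {z₀ z : S}

theorem coordSection_add (v w : u.PullSection) :
    u.coordSection (v + w) z = u.coordSection v z + u.coordSection w z := by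
  funext x
  exact map_add (u.pullCoord z _) _ _

theorem coordSection_smul (c : ℝ) (v : u.PullSection) :
    u.coordSection (c • v) z = c • u.coordSection v z := by
  funext x
  exact map_smul (u.pullCoord z _) _ _

variable [IsManifold 𝓘(ℝ, Plane) ∞ S]

theorem left_inv_of_mem_trivDomain (hz : z ∈ u.trivDomain z₀) :
    (extChartAt 𝓘(ℝ, Plane) z₀).symm (extChartAt 𝓘(ℝ, Plane) z₀ z) = z :=
  (extChartAt 𝓘(ℝ, Plane) z₀).left_inv (by rw [extChartAt_source]; exact hz.1)

theorem coord_extChartAt (hz : z ∈ u.trivDomain z₀) :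
    u.coord z₀ (extChartAt 𝓘(ℝ, Plane) z₀ z) = extChartAt 𝓘(ℝ, E) (u.toMap z₀) (u.toMap z) := by
  rw [coord, left_inv_of_mem_trivDomain hz]

theorem eventually_coord_mem (hz : z ∈ u.trivDomain z₀) {p : S → Prop} (h : ∀ᶠ z' in 𝓝 z, p z') :
    ∀ᶠ x in 𝓝 (extChartAt 𝓘(ℝ, Plane) z₀ z), ∃ z' ∈ u.trivDomain z₀,
      x = extChartAt 𝓘(ℝ, Plane) z₀ z' ∧ (extChartAt 𝓘(ℝ, Plane) z₀).symm x = z' ∧ p z' := by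
  filter_upwards [eventually_extChartAt_symm (I := 𝓘(ℝ, Plane)) hz.1
    (Filter.Eventually.and ((u.isOpen_trivDomain z₀).mem_nhds hz) h)] with x hx
  exact ⟨_, hx.2.1, ((extChartAt 𝓘(ℝ, Plane) z₀).right_inv hx.1).symm, rfl, hx.2.2⟩

theorem contDiffAt_coord (hz : z ∈ u.trivDomain z₀) :
    ContDiffAt ℝ ∞ (u.coord z₀) (extChartAt 𝓘(ℝ, Plane) z₀ z) := by
  refine contDiffAt_comp_extChartAt_symm
    (f := fun z => extChartAt 𝓘(ℝ, E) (u.toMap z₀) (u.toMap z)) hz.1 ?_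
  exact (contMDiffAt_extChartAt' (n := ∞) hz.2).comp z (u.toMap.contMDiff z)

theorem trivializationAt_pull_snd (hz : z ∈ u.trivDomain z₀) (w : u.Pull z) :
    (trivializationAt E u.Pull z₀ ⟨z, w⟩).2 = u.pullCoord z₀ z w := by
  rw [pullCoord, Trivialization.continuousLinearMapAt_apply,
    Trivialization.coe_linearMapAt_of_mem _ hz.2]

theorem pullCoord_eq_tangentCoord (hz : z ∈ u.trivDomain z₀) (w : u.Pull z) :
    u.pullCoord z₀ z w = tangentCoord 𝓘(ℝ, E) (u.toMap z₀) (u.toMap z) w := by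
  rw [← trivializationAt_pull_snd hz]
  exact trivializationAt_tangent_snd hz.2 w

theorem pullCoord_self (w : u.Pull z) : u.pullCoord z z w = w :=
  (pullCoord_eq_tangentCoord (u.mem_trivDomain z) w).trans (tangentCoord_self _ w)

theorem pullCoord_injective (hz : z ∈ u.trivDomain z₀) : Function.Injective (u.pullCoord z₀ z) := by
  intro v w h
  rw [pullCoord_eq_tangentCoord hz, pullCoord_eq_tangentCoord hz] at h
  exact tangentCoord_injective hz.2 h

theorem coord_pullCoord (J : AlmostComplexStructure E M) (hz : z ∈ u.trivDomain z₀)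
    (w : u.Pull z) :
    J.coord (u.toMap z₀) (u.coord z₀ (extChartAt 𝓘(ℝ, Plane) z₀ z)) (u.pullCoord z₀ z w) =
      u.pullCoord z₀ z (u.pullJ J z w) := by
  rw [coord_extChartAt hz, pullCoord_eq_tangentCoord hz, pullCoord_eq_tangentCoord hz]
  exact J.coord_tangentCoord hz.2 w

theorem coordSection_extChartAt (v : u.PullSection) (hz : z ∈ u.trivDomain z₀) :
    u.coordSection v z₀ (extChartAt 𝓘(ℝ, Plane) z₀ z) = u.pullCoord z₀ z (v z) := by
  rw [coordSection, left_inv_of_mem_trivDomain hz]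

theorem contMDiffAt_pullCoord (v : u.PullSection) (hz : z ∈ u.trivDomain z₀) :
    ContMDiffAt 𝓘(ℝ, Plane) 𝓘(ℝ, E) ∞ (fun z => u.pullCoord z₀ z (v z)) z := by
  have h := ((trivializationAt E u.Pull z₀).contMDiffOn_section_baseSet_iff
      (IB := 𝓘(ℝ, Plane)) (n := ∞)).1 v.contMDiff.contMDiffOn
  refine (h.contMDiffAt ((trivializationAt E u.Pull z₀).open_baseSet.mem_nhds
    hz.2)).congr_of_eventuallyEq ?_
  filter_upwards [(u.isOpen_trivDomain z₀).mem_nhds hz] with z' hz'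
  exact (trivializationAt_pull_snd hz' _).symm

theorem contDiffAt_coordSection (v : u.PullSection) (hz : z ∈ u.trivDomain z₀) :
    ContDiffAt ℝ ∞ (u.coordSection v z₀) (extChartAt 𝓘(ℝ, Plane) z₀ z) :=
  contDiffAt_comp_extChartAt_symm (f := fun z => u.pullCoord z₀ z (v z)) hz.1
    (contMDiffAt_pullCoord v hz)

theorem fderiv_coord_tangentCoord (hz : z ∈ u.trivDomain z₀) (ζ : TangentSpace 𝓘(ℝ, Plane) z) :
    fderiv ℝ (u.coord z₀) (extChartAt 𝓘(ℝ, Plane) z₀ z) (tangentCoord 𝓘(ℝ, Plane) z₀ z ζ) =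
      u.pullCoord z₀ z (u.d z ζ) :=
  ((fderiv_coord (u.toMap.mdifferentiableAt) hz.1 hz.2 ζ).2).trans
    (pullCoord_eq_tangentCoord hz _).symm

theorem eventually_holomorphic {j : AlmostComplexStructure Plane S}
    {J : AlmostComplexStructure E M} (hu : u.IsPseudoholomorphic j J) (hz : z ∈ u.trivDomain z₀) :
    ∀ᶠ x in 𝓝 (extChartAt 𝓘(ℝ, Plane) z₀ z), ∀ ζ,
      J.coord (u.toMap z₀) (u.coord z₀ x) (fderiv ℝ (u.coord z₀) x ζ) =
        fderiv ℝ (u.coord z₀) x (j.coord z₀ x ζ) := by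
  filter_upwards [eventually_coord_mem hz (p := fun _ => True) (by simp)] with x hx ζ
  obtain ⟨z', hz', rfl, -, -⟩ := hx
  rw [← tangentCoord_symmL (I := 𝓘(ℝ, Plane)) hz'.1 ζ, fderiv_coord_tangentCoord hz',
    coord_pullCoord J hz', j.coord_tangentCoord hz'.1, fderiv_coord_tangentCoord hz', hu]

end SmoothImmersion
end

/-! ### Gromov's operator -/

noncomputable section

namespace SmoothImmersion

open LocalCauchyRiemann

variable {S : Type*} [TopologicalSpace S] [ChartedSpace Plane S] [IsManifold 𝓘(ℝ, Plane) ∞ S]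
  {E : Type*} [NormedAddCommGroup E] [NormedSpace ℝ E]
  {M : Type*} [TopologicalSpace M] [ChartedSpace E M] [IsManifold 𝓘(ℝ, E) ∞ M]
  {u : SmoothImmersion S E M} {z₀ z : S}

theorem contDiffAt_coord_variation {U : ℝ → S → M} (hz : z ∈ u.trivDomain z₀)
    (hU : ContMDiffAt (𝓘(ℝ, ℝ).prod 𝓘(ℝ, Plane)) 𝓘(ℝ, E) ∞ (Function.uncurry U) ((0 : ℝ), z))
    (h0 : U 0 z = u.toMap z) :
    ContDiffAt ℝ ∞ (fun q : ℝ × Plane => extChartAt 𝓘(ℝ, E) (u.toMap z₀)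
      (U q.1 ((extChartAt 𝓘(ℝ, Plane) z₀).symm q.2))) (0, extChartAt 𝓘(ℝ, Plane) z₀ z) := by
  have h1 : ContMDiffAt (𝓘(ℝ, ℝ).prod 𝓘(ℝ, Plane)) 𝓘(ℝ, E) ∞
      (fun p : ℝ × S => extChartAt 𝓘(ℝ, E) (u.toMap z₀) (Function.uncurry U p)) ((0 : ℝ), z) := by
    refine ContMDiffAt.comp (g := extChartAt 𝓘(ℝ, E) (u.toMap z₀)) ((0 : ℝ), z)
      (contMDiffAt_extChartAt' ?_) hU
    change U 0 z ∈ _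
    rw [h0]
    exact hz.2
  have h2 := contDiffAt_comp_extChartAt_symm (I := 𝓘(ℝ, ℝ).prod 𝓘(ℝ, Plane))
    (x₀ := ((0 : ℝ), z₀)) (x := ((0 : ℝ), z)) (f := fun p : ℝ × S =>
      extChartAt 𝓘(ℝ, E) (u.toMap z₀) (Function.uncurry U p))
    (by simpa using hz.1) h1
  rw [extChartAt_prod] at h2
  exact h2

/-- The linearization of `∂̄_J` in the charts at `z₀` and `u z₀`. -/
theorem hasDerivAt_dbar_variation (j : AlmostComplexStructure Plane S)
    (J : AlmostComplexStructure E M) {v : u.PullSection} {U : ℝ → S → M}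
    (hz : z ∈ u.trivDomain z₀) (hU : u.IsVariationAt v U z) (ζ : TangentSpace 𝓘(ℝ, Plane) z) :
    HasDerivAt (fun t => tangentCoord 𝓘(ℝ, E) (u.toMap z₀) (U t z) (dbar j J (U t) z ζ))
      (linCR (u.coord z₀) (J.coord (u.toMap z₀)) (j.coord z₀) (u.coordSection v z₀)
        (extChartAt 𝓘(ℝ, Plane) z₀ z) (tangentCoord 𝓘(ℝ, Plane) z₀ z ζ)) 0 := by
  have hU0 : ∀ᶠ w in 𝓝 z, U 0 w = u.toMap w := hU.2.mono fun w hw => congrArg TotalSpace.proj hw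
  have hsm := contDiffAt_coord_variation hz hU.1 hU0.self_of_nhds
  have hev : ∀ᶠ p in 𝓝 ((0 : ℝ), z), MDifferentiableAt (𝓘(ℝ, ℝ).prod 𝓘(ℝ, Plane)) 𝓘(ℝ, E)
      (Function.uncurry U) p := hU.1.eventually_mdifferentiableAt
  have hdiff : ∀ᶠ q in 𝓝 ((0 : ℝ), extChartAt 𝓘(ℝ, Plane) z₀ z), DifferentiableAt ℝ
      (fun q : ℝ × Plane => extChartAt 𝓘(ℝ, E) (u.toMap z₀)
        (U q.1 ((extChartAt 𝓘(ℝ, Plane) z₀).symm q.2))) q :=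
    ((hsm.of_le (m := 1) (mod_cast le_top)).eventually (by simp)).mono
      fun p hp => hp.differentiableAt (by simp)
  have hfst : Tendsto (fun t : ℝ => (t, z)) (𝓝 0) (𝓝 (0, z)) :=
    (continuous_id.prodMk continuous_const).tendsto 0
  have hsnd : Tendsto (fun w : S => ((0 : ℝ), w)) (𝓝 z) (𝓝 (0, z)) :=
    (continuous_const.prodMk continuous_id).tendsto z
  have hfst' : Tendsto (fun t : ℝ => (t, extChartAt 𝓘(ℝ, Plane) z₀ z)) (𝓝 0) (𝓝 (0, _)) :=
    (continuous_id.prodMk continuous_const).tendsto 0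
  have hsnd' : Tendsto (fun x : Plane => ((0 : ℝ), x)) (𝓝 (extChartAt 𝓘(ℝ, Plane) z₀ z))
      (𝓝 (0, _)) := (continuous_const.prodMk continuous_id).tendsto _
  have hsrc : ∀ᶠ t in 𝓝 (0 : ℝ), U t z ∈ (chartAt E (u.toMap z₀)).source := by
    have h1 : ContinuousAt (fun t => U t z) 0 :=
      ContinuousAt.comp (g := Function.uncurry U) (f := fun t : ℝ => (t, z))
        hU.1.continuousAt (continuousAt_id.prodMk continuousAt_const)
    have h2 : U 0 z ∈ (chartAt E (u.toMap z₀)).source := by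
      rw [hU0.self_of_nhds]
      exact hz.2
    exact h1.eventually ((chartAt E (u.toMap z₀)).open_source.mem_nhds h2)
  have hu : ∀ᶠ x in 𝓝 (extChartAt 𝓘(ℝ, Plane) z₀ z), extChartAt 𝓘(ℝ, E) (u.toMap z₀)
      (U 0 ((extChartAt 𝓘(ℝ, Plane) z₀).symm x)) = u.coord z₀ x := by
    filter_upwards [eventually_coord_mem hz hU0] with x hx
    obtain ⟨z', -, -, hx, h⟩ := hx
    rw [coord, hx, h]
  have hv : ∀ᶠ x in 𝓝 (extChartAt 𝓘(ℝ, Plane) z₀ z), fderiv ℝ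
      (fun q : ℝ × Plane => extChartAt 𝓘(ℝ, E) (u.toMap z₀)
        (U q.1 ((extChartAt 𝓘(ℝ, Plane) z₀).symm q.2))) (0, x) (1, 0) = u.coordSection v z₀ x := by
    filter_upwards [eventually_coord_mem hz (hU.2.and (hsnd.eventually hev)),
      hsnd'.eventually hdiff] with x hx hxd
    obtain ⟨z', hz', rfl, hx, h, hd⟩ := hx
    have hc : MDifferentiableAt 𝓘(ℝ, ℝ) 𝓘(ℝ, E) (fun t => U t z') 0 :=
      MDifferentiableAt.comp (g := Function.uncurry U) (f := fun t : ℝ => (t, z')) 0 hd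
        (mdifferentiableAt_id.prodMk mdifferentiableAt_const)
    have h1 := hasDerivAt_coord_of_velocity_eq hc hz'.2 h
    have h2 : HasDerivAt (fun t : ℝ => (t, extChartAt 𝓘(ℝ, Plane) z₀ z')) ((1 : ℝ), (0 : Plane)) 0 :=
      (hasDerivAt_id (0 : ℝ)).prodMk (hasDerivAt_const (0 : ℝ) _)
    have h3 := hxd.hasFDerivAt.comp_hasDerivAt (0 : ℝ) h2
    simp only [Function.comp_def, hx] at h3
    rw [coordSection_extChartAt _ hz', pullCoord_eq_tangentCoord hz']
    exact h3.unique h1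
  have hJ : DifferentiableAt ℝ (J.coord (u.toMap z₀))
      (u.coord z₀ (extChartAt 𝓘(ℝ, Plane) z₀ z)) := by
    rw [coord_extChartAt hz]
    exact (J.contDiffAt_coord hz.2).differentiableAt (by simp)
  refine (hasDerivAt_dbar (j := j.coord z₀ (extChartAt 𝓘(ℝ, Plane) z₀ z)) hsm hu hv hJ
    (tangentCoord 𝓘(ℝ, Plane) z₀ z ζ)).congr_of_eventuallyEq ?_
  filter_upwards [hfst.eventually hev, hfst'.eventually hdiff, hsrc] with t ht1 ht2 ht3
  have hUt : MDifferentiableAt 𝓘(ℝ, Plane) 𝓘(ℝ, E) (U t) z :=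
    MDifferentiableAt.comp (g := Function.uncurry U) (f := fun w : S => (t, w)) z ht1
      (mdifferentiableAt_const.prodMk mdifferentiableAt_id)
  have h1 : ∀ a : TangentSpace 𝓘(ℝ, Plane) z, fderiv ℝ
      (fun q : ℝ × Plane => extChartAt 𝓘(ℝ, E) (u.toMap z₀)
        (U q.1 ((extChartAt 𝓘(ℝ, Plane) z₀).symm q.2))) (t, extChartAt 𝓘(ℝ, Plane) z₀ z)
        (0, tangentCoord 𝓘(ℝ, Plane) z₀ z a) =
      tangentCoord 𝓘(ℝ, E) (u.toMap z₀) (U t z) (mfderiv 𝓘(ℝ, Plane) 𝓘(ℝ, E) (U t) z a) := by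
    intro a
    have h2 : HasFDerivAt (fun x : Plane => (t, x))
        ((0 : Plane →L[ℝ] ℝ).prod (ContinuousLinearMap.id ℝ Plane)) (extChartAt 𝓘(ℝ, Plane) z₀ z) :=
      (hasFDerivAt_const t _).prodMk (hasFDerivAt_id _)
    have h3 := (ht2.hasFDerivAt.comp _ h2).fderiv
    rw [← (fderiv_coord hUt hz.1 ht3 a).2]
    exact (congrArg (fun A : Plane →L[ℝ] E => A (tangentCoord 𝓘(ℝ, Plane) z₀ z a)) h3).symm
  rw [j.coord_tangentCoord hz.1, h1, h1, left_inv_of_mem_trivDomain hz, J.coord_tangentCoord ht3,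
    dbar, map_smul, map_add]

/-- Every section of `u^*TM` is, near every point, the velocity of a variation of `u`. -/
theorem exists_isVariationAt (u : SmoothImmersion S E M) (v : u.PullSection) (z : S) :
    ∃ U : ℝ → S → M, u.IsVariationAt v U z := by
  let p := u.toMap z
  let U : ℝ → S → M := fun t w => (extChartAt 𝓘(ℝ, E) p).symm
    (extChartAt 𝓘(ℝ, E) p (u.toMap w) + t • u.pullCoord z w (v w))
  have hbase : ∀ w ∈ u.trivDomain z, extChartAt 𝓘(ℝ, E) p (u.toMap w) ∈ (extChartAt 𝓘(ℝ, E) p).target :=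
    fun w hw => (extChartAt 𝓘(ℝ, E) p).map_source (by rw [extChartAt_source]; exact hw.2)
  have hsm : ∀ w ∈ u.trivDomain z, ContMDiffAt (𝓘(ℝ, ℝ).prod 𝓘(ℝ, Plane)) 𝓘(ℝ, E) ∞
      (Function.uncurry U) ((0 : ℝ), w) := by
    intro w hw
    have h1 : ContMDiffAt 𝓘(ℝ, Plane) 𝓘(ℝ, E) ∞ (fun w => extChartAt 𝓘(ℝ, E) p (u.toMap w)) w :=
      ContMDiffAt.comp w (contMDiffAt_extChartAt' hw.2) (u.toMap.contMDiff w)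
    have h2 := contMDiffAt_pullCoord v hw
    have h3 : ContMDiffAt (𝓘(ℝ, ℝ).prod 𝓘(ℝ, Plane)) 𝓘(ℝ, E) ∞
        (fun q : ℝ × S => extChartAt 𝓘(ℝ, E) p (u.toMap q.2) + q.1 • u.pullCoord z q.2 (v q.2))
        ((0 : ℝ), w) :=
      (h1.comp ((0 : ℝ), w) contMDiffAt_snd).add
        (contMDiffAt_fst.smul (h2.comp ((0 : ℝ), w) contMDiffAt_snd))
    refine ContMDiffAt.comp (g := (extChartAt 𝓘(ℝ, E) p).symm) ((0 : ℝ), w) ?_ h3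
    refine (contMDiffOn_extChartAt_symm p).contMDiffAt ?_
    simp only [zero_smul, add_zero]
    exact extChartAt_target_mem_nhds' (hbase w hw)
  refine ⟨U, hsm z (u.mem_trivDomain z), ?_⟩
  filter_upwards [(u.isOpen_trivDomain z).mem_nhds (u.mem_trivDomain z)] with w hw
  have hc : MDifferentiableAt 𝓘(ℝ, ℝ) 𝓘(ℝ, E) (fun t => U t w) 0 :=
    MDifferentiableAt.comp (g := Function.uncurry U) (f := fun t : ℝ => (t, w)) 0
      ((hsm w hw).mdifferentiableAt (by simp))
      (mdifferentiableAt_id.prodMk mdifferentiableAt_const)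
  refine velocity_eq hc ?_ hw.2 ?_
  · simp only [U, zero_smul, add_zero]
    exact (extChartAt 𝓘(ℝ, E) p).left_inv (by rw [extChartAt_source]; exact hw.2)
  · have h1 : HasDerivAt (fun t : ℝ => extChartAt 𝓘(ℝ, E) p (u.toMap w) + t • u.pullCoord z w (v w))
        (u.pullCoord z w (v w)) 0 := by
      simpa using ((hasDerivAt_id (0 : ℝ)).smul_const (u.pullCoord z w (v w))).const_add
        (extChartAt 𝓘(ℝ, E) p (u.toMap w))
    rw [← pullCoord_eq_tangentCoord hw]
    refine h1.congr_of_eventuallyEq ?_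
    have h2 : (extChartAt 𝓘(ℝ, E) p).target ∈
        𝓝 (extChartAt 𝓘(ℝ, E) p (u.toMap w) + (0 : ℝ) • u.pullCoord z w (v w)) := by
      rw [zero_smul, add_zero]
      exact extChartAt_target_mem_nhds' (hbase w hw)
    filter_upwards [h1.continuousAt h2] with t ht
    exact (extChartAt 𝓘(ℝ, E) p).right_inv ht

/-- The linearization of `∂̄_J` at `z`, in the charts centred at `z` and `u z`. -/
def gromovAt (j : AlmostComplexStructure Plane S) (J : AlmostComplexStructure E M)
    (u : SmoothImmersion S E M) (v : u.PullSection) (z : S) :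
    TangentSpace 𝓘(ℝ, Plane) z →L[ℝ] u.Pull z :=
  (linCR (u.coord z) (J.coord (u.toMap z)) (j.coord z) (u.coordSection v z)
    (extChartAt 𝓘(ℝ, Plane) z z) : Plane →L[ℝ] E)

/-- The vectors of `T_{u(z)} M` are their own coordinates in the chart centred at `u z`. -/
theorem gromovAt_apply (j : AlmostComplexStructure Plane S) (J : AlmostComplexStructure E M)
    (v : u.PullSection) (ζ : TangentSpace 𝓘(ℝ, Plane) z) :
    u.pullCoord z z (gromovAt j J u v z ζ) =
      linCR (u.coord z) (J.coord (u.toMap z)) (j.coord z) (u.coordSection v z)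
        (extChartAt 𝓘(ℝ, Plane) z z) (tangentCoord 𝓘(ℝ, Plane) z z ζ) := by
  rw [pullCoord_self, tangentCoord_self]
  rfl

/-- A pseudoholomorphic curve satisfies `∂̄_J u = 0`. The map `f` is only required to agree with `u`
near `z`, as for the initial map of a variation. -/
theorem dbar_eq_zero {j : AlmostComplexStructure Plane S} {J : AlmostComplexStructure E M}
    (hu : u.IsPseudoholomorphic j J) {f : S → M} (hf : f =ᶠ[𝓝 z] u.toMap)
    (ζ : TangentSpace 𝓘(ℝ, Plane) z) : dbar j J f z ζ = 0 := by
  have hm : (mfderiv 𝓘(ℝ, Plane) 𝓘(ℝ, E) f z : Plane →L[ℝ] E) =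
      mfderiv 𝓘(ℝ, Plane) 𝓘(ℝ, E) u.toMap z := hf.mfderiv_eq
  have h : J.toSection (u.toMap z) (mfderiv 𝓘(ℝ, Plane) 𝓘(ℝ, E) u.toMap z (j.toSection z ζ)) =
      mfderiv 𝓘(ℝ, Plane) 𝓘(ℝ, E) u.toMap z (j.toSection z (j.toSection z ζ)) :=
    hu z (j.toSection z ζ)
  have hzero : (1 / 2 : ℝ) • (mfderiv 𝓘(ℝ, Plane) 𝓘(ℝ, E) u.toMap z ζ +
      J.toSection (u.toMap z) (mfderiv 𝓘(ℝ, Plane) 𝓘(ℝ, E) u.toMap z (j.toSection z ζ))) = 0 := by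
    rw [h, j.sq, map_neg, add_neg_cancel, smul_zero]
  -- the base point `f z` is generalized, so that it can be replaced by `u z` in the types
  have key : ∀ p, p = u.toMap z → ∀ A : TangentSpace 𝓘(ℝ, Plane) z →L[ℝ] TangentSpace 𝓘(ℝ, E) p,
      (A : Plane →L[ℝ] E) = mfderiv 𝓘(ℝ, Plane) 𝓘(ℝ, E) u.toMap z →
      (1 / 2 : ℝ) • (A ζ + J.toSection p (A (j.toSection z ζ))) = 0 := by
    rintro _ rfl A rfl
    exact hzero
  exact key _ hf.self_of_nhds _ hm

/-- The linearization does not depend on the charts, because `∂̄_J u = 0`. -/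
theorem pullCoord_gromovAt {j : AlmostComplexStructure Plane S} {J : AlmostComplexStructure E M}
    (hu : u.IsPseudoholomorphic j J) (hz : z ∈ u.trivDomain z₀) (v : u.PullSection)
    (ζ : TangentSpace 𝓘(ℝ, Plane) z) :
    u.pullCoord z₀ z (gromovAt j J u v z ζ) =
      linCR (u.coord z₀) (J.coord (u.toMap z₀)) (j.coord z₀) (u.coordSection v z₀)
        (extChartAt 𝓘(ℝ, Plane) z₀ z) (tangentCoord 𝓘(ℝ, Plane) z₀ z ζ) := by
  obtain ⟨U, hU⟩ := u.exists_isVariationAt v z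
  have h0 := hasDerivAt_dbar_variation j J (u.mem_trivDomain z) hU ζ
  have h1 := hasDerivAt_dbar_variation j J hz hU ζ
  rw [← gromovAt_apply] at h0
  have hU0 : U 0 =ᶠ[𝓝 z] u.toMap := hU.2.mono fun w hw => congrArg TotalSpace.proj hw
  have hc : ContinuousAt (fun t => U t z) 0 :=
    ContinuousAt.comp (g := Function.uncurry U) (f := fun t : ℝ => (t, z))
      hU.1.continuousAt (continuousAt_id.prodMk continuousAt_const)
  rw [pullCoord_eq_tangentCoord (u.mem_trivDomain z)] at h0
  rw [pullCoord_eq_tangentCoord hz]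
  exact (hasDerivAt_tangentCoord_change hc hU0.self_of_nhds (u.mem_trivDomain z).2 hz.2
    (dbar_eq_zero hu hU0 ζ) h0).unique h1

theorem contMDiff_gromovAt {j : AlmostComplexStructure Plane S} {J : AlmostComplexStructure E M}
    (hu : u.IsPseudoholomorphic j J) (v : u.PullSection) :
    ContMDiff 𝓘(ℝ, Plane) (𝓘(ℝ, Plane).prod 𝓘(ℝ, Plane →L[ℝ] E)) ∞
      (fun z : S => TotalSpace.mk' (Plane →L[ℝ] E)
        (E := fun z : S => TangentSpace 𝓘(ℝ, Plane) z →L[ℝ] u.Pull z) z (gromovAt j J u v z)) := by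
  intro z₀
  rw [contMDiffAt_hom_bundle]
  refine ⟨contMDiffAt_id, ?_⟩
  have hz₀ := u.mem_trivDomain z₀
  have hlin : ContDiffAt ℝ ∞ (linCR (u.coord z₀) (J.coord (u.toMap z₀)) (j.coord z₀)
      (u.coordSection v z₀)) (extChartAt 𝓘(ℝ, Plane) z₀ z₀) := by
    refine contDiffAt_linCR (contDiffAt_coord hz₀) ?_ (j.contDiffAt_coord hz₀.1)
      (contDiffAt_coordSection v hz₀)
    rw [coord_extChartAt hz₀]
    exact J.contDiffAt_coord hz₀.2
  refine (hlin.contMDiffAt.comp z₀ (contMDiffAt_extChartAt' hz₀.1)).congr_of_eventuallyEq ?_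
  filter_upwards [(u.isOpen_trivDomain z₀).mem_nhds hz₀] with z hz
  refine ContinuousLinearMap.ext fun ζ => ?_
  have h := pullCoord_gromovAt hu hz v
    ((trivializationAt Plane (TangentSpace 𝓘(ℝ, Plane)) z₀).symmL ℝ z ζ)
  rw [tangentCoord_symmL hz.1] at h
  exact h

theorem gromovAt_antilinear {j : AlmostComplexStructure Plane S}
    {J : AlmostComplexStructure E M} (hu : u.IsPseudoholomorphic j J) (v : u.PullSection)
    (ζ : TangentSpace 𝓘(ℝ, Plane) z) :
    gromovAt j J u v z (j.toSection z ζ) = -u.pullJ J z (gromovAt j J u v z ζ) := by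
  have hz := u.mem_trivDomain z
  apply pullCoord_injective hz
  rw [gromovAt_apply, map_neg, ← coord_pullCoord J hz, gromovAt_apply,
    ← j.coord_tangentCoord hz.1]
  refine linCR_antilinear ?_ ?_ (j.eventually_coord_sq hz.1).self_of_nhds
    (eventually_holomorphic hu hz).self_of_nhds _
  · rw [coord_extChartAt hz]
    exact (J.contDiffAt_coord hz.2).differentiableAt (by simp)
  · rw [coord_extChartAt hz]
    exact J.eventually_coord_sq hz.2

/-- Gromov's operator, the linearization of `∂̄_J` at `u`. -/
def gromov {j : AlmostComplexStructure Plane S} {J : AlmostComplexStructure E M}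
    (hu : u.IsPseudoholomorphic j J) : u.PullSection →ₗ[ℝ] u.PullForm01 j J where
  toFun v := ⟨⟨gromovAt j J u v, contMDiff_gromovAt hu v⟩, fun _ ζ => gromovAt_antilinear hu v ζ⟩
  map_add' v w := by
    refine Subtype.ext (ContMDiffSection.ext fun z => ?_)
    have hd := fun v : u.PullSection =>
      (contDiffAt_coordSection v (u.mem_trivDomain z)).differentiableAt (by simp)
    change linCR _ _ _ (u.coordSection (v + w) z) _ = _
    rw [coordSection_add, linCR_add _ _ _ (hd v) (hd w)]
    rfl
  map_smul' c v := by
    refine Subtype.ext (ContMDiffSection.ext fun z => ?_)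
    have hd := (contDiffAt_coordSection v (u.mem_trivDomain z)).differentiableAt (by simp)
    change linCR _ _ _ (u.coordSection (c • v) z) _ = _
    rw [coordSection_smul, linCR_smul _ _ _ c hd]
    rfl

theorem isGromovOperator_gromov {j : AlmostComplexStructure Plane S}
    {J : AlmostComplexStructure E M} (hu : u.IsPseudoholomorphic j J) :
    u.IsGromovOperator j J (gromov hu) := by
  intro v z U hU ζ
  have hz := u.mem_trivDomain z
  have h := hasDerivAt_dbar_variation j J hz hU ζ
  rw [← gromovAt_apply, ← trivializationAt_pull_snd hz] at h
  refine HasDerivAt.congr_of_eventuallyEq h ?_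
  have hc : ContinuousAt (fun t => U t z) 0 :=
    ContinuousAt.comp (g := Function.uncurry U) (f := fun t : ℝ => (t, z))
      hU.1.continuousAt (continuousAt_id.prodMk continuousAt_const)
  have h2 : U 0 z ∈ (chartAt E (u.toMap z)).source := by
    rw [show U 0 z = u.toMap z from congrArg TotalSpace.proj hU.2.self_of_nhds]
    exact hz.2
  filter_upwards [hc.eventually ((chartAt E (u.toMap z)).open_source.mem_nhds h2)] with t ht
  exact trivializationAt_tangent_snd ht _

theorem IsGromovOperator.eq_gromov {j : AlmostComplexStructure Plane S}
    {J : AlmostComplexStructure E M} (hu : u.IsPseudoholomorphic j J)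
    {D : u.PullSection →ₗ[ℝ] u.PullForm01 j J} (hD : u.IsGromovOperator j J D) :
    D = gromov hu := by
  refine LinearMap.ext fun v => Subtype.ext (ContMDiffSection.ext fun z => ?_)
  refine ContinuousLinearMap.ext fun ζ => ?_
  obtain ⟨U, hU⟩ := u.exists_isVariationAt v z
  have h := (hD v z U hU ζ).unique (isGromovOperator_gromov hu v z U hU ζ)
  have hz := u.mem_trivDomain z
  exact pullCoord_injective hz
    ((trivializationAt_pull_snd hz _).symm.trans (h.trans (trivializationAt_pull_snd hz _)))

end SmoothImmersion
end

noncomputable section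

namespace SmoothImmersion

open LocalCauchyRiemann

variable {S : Type*} [TopologicalSpace S] [ChartedSpace Plane S] [IsManifold 𝓘(ℝ, Plane) ∞ S]
  {E : Type*} [NormedAddCommGroup E] [NormedSpace ℝ E] [FiniteDimensional ℝ E]
  {M : Type*} [TopologicalSpace M] [ChartedSpace E M] [IsManifold 𝓘(ℝ, E) ∞ M]
  {u : SmoothImmersion S E M} {z₀ z : S}

/-! ### Coordinates on the normal bundle -/

theorem movingFrame_coord (hz : z ∈ u.trivDomain z₀) :
    movingFrame (u.coord z₀) (u.incl z₀) (extChartAt 𝓘(ℝ, Plane) z₀ z) = u.localFrame z₀ z := by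
  refine ContinuousLinearMap.ext fun p => ?_
  have h := fderiv_coord_tangentCoord hz
    ((trivializationAt Plane (TangentSpace 𝓘(ℝ, Plane)) z₀).symmL ℝ z p.1)
  rw [tangentCoord_symmL hz.1] at h
  rw [movingFrame_apply, h]
  rfl

theorem isInvertible_movingFrame (hz : z ∈ u.normalDomain z₀) :
    (movingFrame (u.coord z₀) (u.incl z₀) (extChartAt 𝓘(ℝ, Plane) z₀ z)).IsInvertible := by
  rw [movingFrame_coord hz.1]
  exact hz.2

/-- The fibre coordinates on the normal space at `z` in the trivialization around `z₀`. -/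
def fibCoord (u : SmoothImmersion S E M) (z₀ z : S) : u.Normal z →L[ℝ] Fib E :=
  (trivializationAt (Fib E) u.Normal z₀).continuousLinearMapAt ℝ z

theorem trivializationAt_normal_snd (hz : z ∈ u.normalDomain z₀) (n : u.Normal z) :
    (trivializationAt (Fib E) u.Normal z₀ ⟨z, n⟩).2 = u.fibCoord z₀ z n := by
  rw [fibCoord, Trivialization.continuousLinearMapAt_apply,
    Trivialization.coe_linearMapAt_of_mem _ (show z ∈ (trivializationAt (Fib E) u.Normal z₀).baseSet
      from hz)]

/-- The fibre coordinate of the class of a vector is its normal coordinate in charts. -/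
theorem fibCoord_proj (hz : z ∈ u.normalDomain z₀) (w : u.Pull z) :
    u.fibCoord z₀ z (u.proj z w) = normalCoord (u.coord z₀) (u.incl z₀)
      (extChartAt 𝓘(ℝ, Plane) z₀ z) (u.pullCoord z₀ z w) := by
  rw [← trivializationAt_normal_snd hz, normalCoord, movingFrame_coord hz.1]
  exact congrArg Prod.snd (u.pretriv_apply hz w)

theorem fibCoord_injective (hz : z ∈ u.normalDomain z₀) :
    Function.Injective (u.fibCoord z₀ z) := by
  intro n m h
  rw [← trivializationAt_normal_snd hz, ← trivializationAt_normal_snd hz] at h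
  exact ((trivializationAt (Fib E) u.Normal z₀).continuousLinearEquivAt ℝ z hz).injective h

theorem fibCoord_ofFib (hz : z ∈ u.normalDomain z₀) (y : Fib E) :
    u.fibCoord z₀ z (u.proj z (u.ofFib z₀ z y)) = y := by
  rw [← trivializationAt_normal_snd hz]
  exact (congrArg Prod.snd (u.pretriv_apply hz _)).trans (u.toFib_ofFib hz y)

theorem extChartAt_normal (a p : u.NormalTotal) (hp : p.1 ∈ u.normalDomain a.1) :
    extChartAt (normalModel E) a p =
      (extChartAt 𝓘(ℝ, Plane) a.1 p.1, u.fibCoord a.1 p.1 p.2) := by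
  rw [← trivializationAt_normal_snd hp, FiberBundle.extChartAt]
  exact Prod.ext (congrArg (extChartAt 𝓘(ℝ, Plane) a.1)
    ((trivializationAt (Fib E) u.Normal a.1).coe_fst' hp)) rfl

theorem mem_chartAt_normal (a p : u.NormalTotal) (hp : p.1 ∈ u.normalDomain a.1) :
    p ∈ (chartAt (ModelProd Plane (Fib E)) a).source := by
  rw [FiberBundle.chartedSpace_chartAt]
  have h : p ∈ (trivializationAt (Fib E) u.Normal a.1).source := hp
  simpa [h] using hp.1.1

theorem dilate_fibCoord (t : ℝ) (p : u.NormalTotal) :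
    u.fibCoord z₀ (u.dilate t p).1 (u.dilate t p).2 = t • u.fibCoord z₀ p.1 p.2 :=
  map_smul _ _ _

theorem contMDiffAt_fibCoord {p : u.NormalTotal} (hp : p.1 ∈ u.normalDomain z₀) :
    ContMDiffAt (normalModel E) 𝓘(ℝ, Fib E) ∞
      (fun p : u.NormalTotal => u.fibCoord z₀ p.1 p.2) p := by
  have h := (((trivializationAt (Fib E) u.Normal z₀).contMDiffAt_iff (IB := 𝓘(ℝ, Plane))
    (n := ∞) (f := fun p : u.NormalTotal => p) (x₀ := p) hp).1 contMDiffAt_id).2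
  refine h.congr_of_eventuallyEq ?_
  have h1 : ∀ᶠ q : u.NormalTotal in 𝓝 p, q.1 ∈ u.normalDomain z₀ :=
    (FiberBundle.continuous_proj (Fib E) u.Normal).continuousAt.eventually
      ((u.isOpen_normalDomain z₀).mem_nhds hp)
  filter_upwards [h1] with q hq
  exact (trivializationAt_normal_snd hq q.2).symm

/-- A map to the total space of the normal bundle is smooth if its base point and its fibre
coordinate are. -/
theorem contMDiffAt_mk_normal {E' H' M' : Type*} [NormedAddCommGroup E'] [NormedSpace ℝ E']
    [TopologicalSpace H'] {I' : ModelWithCorners ℝ E' H'} [TopologicalSpace M'] [ChartedSpace H' M']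
    {f : M' → u.NormalTotal} {x : M'} (hx : (f x).1 ∈ u.normalDomain z₀)
    (hf : ContMDiffAt I' 𝓘(ℝ, Plane) ∞ (fun y => (f y).1) x)
    (hf2 : ContMDiffAt I' 𝓘(ℝ, Fib E) ∞ (fun y => u.fibCoord z₀ (f y).1 (f y).2) x) :
    ContMDiffAt I' (normalModel E) ∞ f x := by
  refine ((trivializationAt (Fib E) u.Normal z₀).contMDiffAt_iff (IB := 𝓘(ℝ, Plane))
    (n := ∞) hx).2 ⟨hf, hf2.congr_of_eventuallyEq ?_⟩
  filter_upwards [hf.continuousAt.eventually ((u.isOpen_normalDomain z₀).mem_nhds hx)] with y hy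
  exact trivializationAt_normal_snd hy (f y).2

theorem contMDiffAt_dilate (t : ℝ) (a : u.NormalTotal) :
    ContMDiffAt (normalModel E) (normalModel E) ∞ (u.dilate t) a := by
  refine contMDiffAt_mk_normal (z₀ := a.1) (u.mem_normalDomain a.1) ?_ ?_
  · exact contMDiffAt_proj u.Normal
  · simp only [dilate_fibCoord]
    have ht : ContMDiffAt (normalModel E) 𝓘(ℝ, ℝ) ∞ (fun _ : u.NormalTotal => t) a :=
      contMDiffAt_const
    exact ht.smul (contMDiffAt_fibCoord (u.mem_normalDomain a.1))

theorem contMDiffAt_fibre_line (n m : u.Normal z) (t₀ : ℝ) :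
    ContMDiffAt 𝓘(ℝ, ℝ) (normalModel E) ∞ (fun t : ℝ => (⟨z, n + t • m⟩ : u.NormalTotal)) t₀ := by
  refine contMDiffAt_mk_normal (z₀ := z) (u.mem_normalDomain z) contMDiffAt_const ?_
  simp only [map_add, map_smul]
  exact contMDiffAt_const.add (contMDiffAt_id.smul contMDiffAt_const)

/-! ### The NB-II structure -/

/-- The inverse of a continuous linear map in coordinates of the target, valid also for the junk
value `0` of the inverse of a map that is not invertible. -/
theorem inverse_apply_of_equiv {V W E : Type*} [TopologicalSpace V] [AddCommGroup V] [Module ℝ V]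
    [TopologicalSpace W] [AddCommGroup W] [Module ℝ W] [TopologicalSpace E] [AddCommGroup E]
    [Module ℝ E] {B : V →L[ℝ] W} {A : V →L[ℝ] E} (e : W ≃L[ℝ] E) (h : ∀ ξ, A ξ = e (B ξ)) (w : W) :
    B.inverse w = A.inverse (e w) := by
  have hA : A = (e : W →L[ℝ] E).comp B := ContinuousLinearMap.ext h
  rw [hA, ContinuousLinearMap.inverse_equiv_comp]
  simp

/-- The conjugated structure `(dψ)⁻¹ J dψ` in coordinates. -/
theorem conjJ_apply (J : AlmostComplexStructure E M) {ψ : u.NormalTotal → M} {a : u.NormalTotal}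
    {y₀ : M} (hψ : MDifferentiableAt (normalModel E) 𝓘(ℝ, E) ψ a)
    (hy : ψ a ∈ (chartAt E y₀).source) {A : Plane × Fib E →L[ℝ] E}
    (hA : A = fderiv ℝ (fun q => extChartAt 𝓘(ℝ, E) y₀ (ψ ((extChartAt (normalModel E) a).symm q)))
      (extChartAt (normalModel E) a a)) (ξ : TangentSpace (normalModel E) a) :
    u.conjJ J ψ a ξ = A.inverse (J.coord y₀ (extChartAt 𝓘(ℝ, E) y₀ (ψ a)) (A ξ)) := by
  let B : TangentSpace (normalModel E) a →L[ℝ] TangentSpace 𝓘(ℝ, E) (ψ a) :=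
    mfderiv (normalModel E) 𝓘(ℝ, E) ψ a
  let e := tangentCoordEquiv 𝓘(ℝ, E) hy
  have hAe : ∀ ξ : TangentSpace (normalModel E) a, A ξ = tangentCoord 𝓘(ℝ, E) y₀ (ψ a) (B ξ) := by
    intro ξ
    rw [← (fderiv_coord hψ (mem_chart_source _ a) hy ξ).2, tangentCoord_self, hA]
  have hinv : B.inverse (J.toSection (ψ a) (B ξ)) = A.inverse (e (J.toSection (ψ a) (B ξ))) :=
    inverse_apply_of_equiv (V := TangentSpace (normalModel E) a) e
      (fun ξ => (hAe ξ).trans (tangentCoordEquiv_apply hy (B ξ)).symm) _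
  rw [hAe, J.coord_tangentCoord hy, ← tangentCoordEquiv_apply hy]
  exact hinv

/-- The NB-II structure: at `a` it is given by the formula `localNBII` in the charts centred at the
base point of `a` and at its image. -/
def nbII (j : AlmostComplexStructure Plane S) (J : AlmostComplexStructure E M)
    (u : SmoothImmersion S E M) (a : u.NormalTotal) :
    TangentSpace (normalModel E) a →L[ℝ] TangentSpace (normalModel E) a :=
  (localNBII (u.coord a.1) (J.coord (u.toMap a.1)) (j.coord a.1 (extChartAt 𝓘(ℝ, Plane) a.1 a.1))
    (u.incl a.1) (extChartAt 𝓘(ℝ, Plane) a.1 a.1) (u.fibCoord a.1 a.1 a.2) :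
      Plane × Fib E →L[ℝ] Plane × Fib E)

/-- A tubular parametrization in the charts at the zero vector over `z` and at `u z`. -/
def coordTubular (u : SmoothImmersion S E M) (φ : u.NormalTotal → M) (z : S) (q : Plane × Fib E) :
    E :=
  extChartAt 𝓘(ℝ, E) (u.toMap z)
    (φ ((extChartAt (normalModel E) (⟨z, 0⟩ : u.NormalTotal)).symm q))

theorem coordTubular_apply (φ : u.NormalTotal → M) {w : S} (hw : w ∈ u.normalDomain z)
    (n : u.Normal w) :
    u.coordTubular φ z (extChartAt 𝓘(ℝ, Plane) z w, u.fibCoord z w n) =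
      extChartAt 𝓘(ℝ, E) (u.toMap z) (φ ⟨w, n⟩) := by
  have h := extChartAt_normal (⟨z, 0⟩ : u.NormalTotal) ⟨w, n⟩ hw
  have h1 : (⟨w, n⟩ : u.NormalTotal) ∈ (extChartAt (normalModel E) (⟨z, 0⟩ : u.NormalTotal)).source := by
    rw [extChartAt_source]
    exact mem_chartAt_normal _ _ hw
  rw [coordTubular, ← h, PartialEquiv.left_inv _ h1]

theorem IsTubularAt.apply_zero {φ : u.NormalTotal → M} (hφ : u.IsTubularAt φ z) :
    ∀ᶠ w in 𝓝 z, φ ⟨w, 0⟩ = u.toMap w := by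
  filter_upwards [hφ.2] with w hw
  obtain ⟨v, -, hv⟩ := hw 0
  have := congrArg TotalSpace.proj hv
  simpa [velocity] using this

theorem IsTubularAt.contDiffAt_coordTubular {φ : u.NormalTotal → M} (hφ : u.IsTubularAt φ z) :
    ContDiffAt ℝ ∞ (u.coordTubular φ z) (extChartAt 𝓘(ℝ, Plane) z z, 0) := by
  have hsrc : φ ⟨z, 0⟩ ∈ (chartAt E (u.toMap z)).source := by
    rw [hφ.apply_zero.self_of_nhds]
    exact mem_chart_source _ _
  have h1 : ContMDiffAt (normalModel E) 𝓘(ℝ, E) ∞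
      (fun p : u.NormalTotal => extChartAt 𝓘(ℝ, E) (u.toMap z) (φ p)) ⟨z, 0⟩ :=
    ContMDiffAt.comp (I' := 𝓘(ℝ, E)) (g := extChartAt 𝓘(ℝ, E) (u.toMap z)) (f := φ)
      (⟨z, 0⟩ : u.NormalTotal) (contMDiffAt_extChartAt' hsrc) hφ.1
  have h := contDiffAt_comp_extChartAt_symm (I := normalModel E) (x₀ := (⟨z, 0⟩ : u.NormalTotal))
    (x := (⟨z, 0⟩ : u.NormalTotal))
    (f := fun p : u.NormalTotal => extChartAt 𝓘(ℝ, E) (u.toMap z) (φ p))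
    (mem_chartAt_normal _ _ (u.mem_normalDomain z)) h1
  have h2 : extChartAt (normalModel E) (⟨z, 0⟩ : u.NormalTotal) ⟨z, 0⟩ =
      (extChartAt 𝓘(ℝ, Plane) z z, 0) :=
    (extChartAt_normal (⟨z, 0⟩ : u.NormalTotal) ⟨z, 0⟩ (u.mem_normalDomain z)).trans
      (congrArg (Prod.mk (extChartAt 𝓘(ℝ, Plane) z z)) (map_zero (u.fibCoord z z)))
  rw [h2] at h
  exact h

/-- A property that holds near `z` holds at the points with coordinates near those of `z`. -/
theorem eventually_coord_mem_normalDomain {p : S → Prop} (h : ∀ᶠ z' in 𝓝 z, p z') :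
    ∀ᶠ x in 𝓝 (extChartAt 𝓘(ℝ, Plane) z z), ∃ w ∈ u.normalDomain z,
      x = extChartAt 𝓘(ℝ, Plane) z w ∧ p w := by
  filter_upwards [eventually_coord_mem (u.mem_trivDomain z)
    (Filter.Eventually.and ((u.isOpen_normalDomain z).mem_nhds (u.mem_normalDomain z)) h)] with x hx
  obtain ⟨w, -, hx, -, hw⟩ := hx
  exact ⟨w, hw.1, hx, hw.2⟩

theorem IsTubularAt.coordTubular_zero {φ : u.NormalTotal → M} (hφ : u.IsTubularAt φ z) :
    ∀ᶠ x in 𝓝 (extChartAt 𝓘(ℝ, Plane) z z), u.coordTubular φ z (x, 0) = u.coord z x := by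
  filter_upwards [eventually_coord_mem_normalDomain (u := u) hφ.apply_zero] with x hx
  obtain ⟨w, hw, rfl, h⟩ := hx
  have h1 := coordTubular_apply φ hw 0
  rw [map_zero] at h1
  rw [h1, h, coord_extChartAt hw.1]

/-- The vertical derivative of a tubular parametrization along the zero section represents the
identity of the normal bundle. -/
theorem IsTubularAt.normalCoord_fderiv {φ : u.NormalTotal → M} (hφ : u.IsTubularAt φ z) :
    ∀ᶠ x in 𝓝 (extChartAt 𝓘(ℝ, Plane) z z), ∀ η : Fib E, normalCoord (u.coord z) (u.incl z) x
      (fderiv ℝ (u.coordTubular φ z) (x, 0) (0, η)) = η := by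
  have hzero : Tendsto (fun w : S => (⟨w, 0⟩ : u.NormalTotal)) (𝓝 z) (𝓝 ⟨z, 0⟩) :=
    (contMDiff_zeroSection (n := ∞) ℝ (F := Fib E) u.Normal (IB := 𝓘(ℝ, Plane))).continuous.tendsto z
  have hdiff : ∀ᶠ q in 𝓝 (extChartAt 𝓘(ℝ, Plane) z z, (0 : Fib E)),
      DifferentiableAt ℝ (u.coordTubular φ z) q :=
    ((hφ.contDiffAt_coordTubular.of_le (m := 1) (mod_cast le_top)).eventually (by simp)).mono
      fun p hp => hp.differentiableAt (by simp)
  have hslice : Tendsto (fun x : Plane => (x, (0 : Fib E))) (𝓝 (extChartAt 𝓘(ℝ, Plane) z z))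
      (𝓝 (extChartAt 𝓘(ℝ, Plane) z z, 0)) := (continuous_id.prodMk continuous_const).tendsto _
  filter_upwards [eventually_coord_mem_normalDomain (u := u)
    (hφ.2.and (hzero.eventually hφ.1.eventually_mdifferentiableAt)), hslice.eventually hdiff]
    with x hx hxd η
  obtain ⟨w, hw, rfl, hv, hmd⟩ := hx
  have hη := fibCoord_ofFib hw η
  set n := u.proj w (u.ofFib z w η) with hn
  obtain ⟨v, hvn, hvel⟩ := hv n
  have hline : MDifferentiableAt 𝓘(ℝ, ℝ) (normalModel E)
      (fun t : ℝ => (⟨w, t • n⟩ : u.NormalTotal)) 0 := by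
    have := (contMDiffAt_fibre_line (u := u) (z := w) 0 n 0).mdifferentiableAt (by simp)
    simpa only [zero_add] using this
  have hc : MDifferentiableAt 𝓘(ℝ, ℝ) 𝓘(ℝ, E) (fun t : ℝ => φ ⟨w, t • n⟩) 0 := by
    refine MDifferentiableAt.comp (g := φ) 0 ?_ hline
    simpa only [zero_smul] using hmd
  have h1 := hasDerivAt_coord_of_velocity_eq hc hw.1.2 hvel
  have h2 : HasDerivAt (fun t : ℝ => (extChartAt 𝓘(ℝ, Plane) z w, t • η))
      ((0 : Plane), η) 0 := by
    simpa using (hasDerivAt_const (0 : ℝ) (extChartAt 𝓘(ℝ, Plane) z w)).prodMk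
      ((hasDerivAt_id (0 : ℝ)).smul_const η)
  have h3 : HasFDerivAt (u.coordTubular φ z) (fderiv ℝ (u.coordTubular φ z)
      (extChartAt 𝓘(ℝ, Plane) z w, 0)) (extChartAt 𝓘(ℝ, Plane) z w, (0 : ℝ) • η) := by
    rw [zero_smul]
    exact hxd.hasFDerivAt
  have h4 := h3.comp_hasDerivAt (0 : ℝ) h2
  have h5 : (u.coordTubular φ z ∘ fun t : ℝ => (extChartAt 𝓘(ℝ, Plane) z w, t • η)) =
      fun t : ℝ => extChartAt 𝓘(ℝ, E) (u.toMap z) (φ ⟨w, t • n⟩) := by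
    funext t
    rw [← coordTubular_apply φ hw, map_smul, hη]
    rfl
  rw [h5] at h4
  rw [h4.unique h1, ← hη, ← hvn, fibCoord_proj hw, pullCoord_eq_tangentCoord hw.1]

/-- In charts, conjugation by `φ ∘ R^t` is conjugation by the derivative of the dilated coordinate
expression of `φ`, whose limit is `localNBII`. -/
theorem isNBII_nbII {j : AlmostComplexStructure Plane S} {J : AlmostComplexStructure E M}
    (hu : u.IsPseudoholomorphic j J) : u.IsNBII J (nbII j J u) := by
  intro a φ hφ ξ
  have hz := u.mem_trivDomain a.1
  have hJ : DifferentiableAt ℝ (J.coord (u.toMap a.1))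
      (u.coord a.1 (extChartAt 𝓘(ℝ, Plane) a.1 a.1)) := by
    rw [coord_extChartAt hz]
    exact (J.contDiffAt_coord hz.2).differentiableAt (by simp)
  have hlim := tendsto_conj_dilate (contDiffAt_coord hz) hJ
    ((j.contDiffAt_coord hz.1).differentiableAt (by simp))
    (j.eventually_coord_sq hz.1).self_of_nhds (eventually_holomorphic hu hz)
    (isInvertible_movingFrame (u.mem_normalDomain a.1)) hφ.contDiffAt_coordTubular
    hφ.coordTubular_zero hφ.normalCoord_fderiv (u.fibCoord a.1 a.1 a.2) ξ
  refine hlim.congr' ?_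
  refine Filter.Eventually.filter_mono nhdsWithin_le_nhds ?_
  have hline : ContinuousAt (fun t : ℝ => u.dilate t a) 0 := by
    have h1 : (fun t : ℝ => u.dilate t a) = fun t => ⟨a.1, 0 + t • a.2⟩ := by
      funext t
      rw [zero_add]
      rfl
    rw [h1]
    exact (contMDiffAt_fibre_line 0 a.2 0).continuousAt
  have hline0 : u.dilate 0 a = ⟨a.1, 0⟩ := congrArg (TotalSpace.mk a.1) (zero_smul ℝ a.2)
  have hmd : ∀ᶠ t : ℝ in 𝓝 0, MDifferentiableAt (normalModel E) 𝓘(ℝ, E) φ (u.dilate t a) := by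
    have h1 := hφ.1.eventually_mdifferentiableAt
    rw [← hline0] at h1
    exact hline.eventually h1
  have hsrc : ∀ᶠ t : ℝ in 𝓝 0, φ (u.dilate t a) ∈ (chartAt E (u.toMap a.1)).source := by
    have h1 : ContinuousAt φ (u.dilate 0 a) := by
      rw [hline0]
      exact hφ.1.continuousAt
    have h2 : φ (u.dilate 0 a) ∈ (chartAt E (u.toMap a.1)).source := by
      rw [hline0, hφ.apply_zero.self_of_nhds]
      exact mem_chart_source _ _
    exact (ContinuousAt.comp (f := fun t : ℝ => u.dilate t a) h1 hline).eventually
      ((chartAt E (u.toMap a.1)).open_source.mem_nhds h2)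
  filter_upwards [hmd, hsrc] with t ht1 ht2
  have hψ : MDifferentiableAt (normalModel E) 𝓘(ℝ, E) (φ ∘ u.dilate t) a :=
    ht1.comp a ((contMDiffAt_dilate t a).mdifferentiableAt (by simp))
  have hcoord : extChartAt (normalModel E) a a =
      (extChartAt 𝓘(ℝ, Plane) a.1 a.1, u.fibCoord a.1 a.1 a.2) :=
    extChartAt_normal a a (u.mem_normalDomain a.1)
  rw [conjJ_apply J hψ ht2 (A := fderiv ℝ (fun p : Plane × Fib E =>
    u.coordTubular φ a.1 (p.1, t • p.2))
      (extChartAt 𝓘(ℝ, Plane) a.1 a.1, u.fibCoord a.1 a.1 a.2)) ?_ ξ]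
  · congr 2
    rw [← map_smul, coordTubular_apply φ (u.mem_normalDomain a.1)]
    rfl
  rw [hcoord]
  refine Filter.EventuallyEq.fderiv_eq ?_
  rw [← hcoord]
  have hnear : ∀ᶠ p : u.NormalTotal in 𝓝 a, p.1 ∈ u.normalDomain a.1 :=
    (FiberBundle.continuous_proj (Fib E) u.Normal).continuousAt.eventually
      ((u.isOpen_normalDomain a.1).mem_nhds (u.mem_normalDomain a.1))
  filter_upwards [eventually_extChartAt_symm (I := normalModel E)
    (mem_chart_source (ModelProd Plane (Fib E)) a) hnear] with q hq
  have h1 := extChartAt_normal a _ hq.2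
  rw [(extChartAt (normalModel E) a).right_inv hq.1] at h1
  have h2 := coordTubular_apply φ hq.2 (t • ((extChartAt (normalModel E) a).symm q).2)
  rw [map_smul] at h2
  exact (congrArg (fun r : Plane × Fib E => u.coordTubular φ a.1 (r.1, t • r.2)) h1).trans h2

end SmoothImmersion
end

/-! ### Tubular parametrizations and uniqueness of the NB-II structure -/

noncomputable section

namespace SmoothImmersion

open LocalCauchyRiemann

variable {S : Type*} [TopologicalSpace S] [ChartedSpace Plane S] [IsManifold 𝓘(ℝ, Plane) ∞ S]
  {E : Type*} [NormedAddCommGroup E] [NormedSpace ℝ E] [FiniteDimensional ℝ E]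
  {M : Type*} [TopologicalSpace M] [ChartedSpace E M] [IsManifold 𝓘(ℝ, E) ∞ M]
  {u : SmoothImmersion S E M} {z₀ z : S}

/-- In charts, a tubular parametrization is given by adding a vector of the fixed complement. -/
theorem exists_isTubularAt (u : SmoothImmersion S E M) (z : S) :
    ∃ φ : u.NormalTotal → M, u.IsTubularAt φ z := by
  let p := u.toMap z
  let φ : u.NormalTotal → M := fun a => (extChartAt 𝓘(ℝ, E) p).symm
    (extChartAt 𝓘(ℝ, E) p (u.toMap a.1) + u.incl z (u.fibCoord z a.1 a.2))
  have hbase : ∀ w ∈ u.trivDomain z,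
      extChartAt 𝓘(ℝ, E) p (u.toMap w) ∈ (extChartAt 𝓘(ℝ, E) p).target :=
    fun w hw => (extChartAt 𝓘(ℝ, E) p).map_source (by rw [extChartAt_source]; exact hw.2)
  have hsm : ∀ w ∈ u.normalDomain z, ContMDiffAt (normalModel E) 𝓘(ℝ, E) ∞ φ ⟨w, 0⟩ := by
    intro w hw
    have h1 : ContMDiffAt 𝓘(ℝ, Plane) 𝓘(ℝ, E) ∞ (fun w => extChartAt 𝓘(ℝ, E) p (u.toMap w)) w :=
      ContMDiffAt.comp w (contMDiffAt_extChartAt' hw.1.2) (u.toMap.contMDiff w)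
    have h2 : ContMDiffAt (normalModel E) 𝓘(ℝ, E) ∞ (fun a : u.NormalTotal =>
        extChartAt 𝓘(ℝ, E) p (u.toMap a.1) + u.incl z (u.fibCoord z a.1 a.2)) ⟨w, 0⟩ :=
      (ContMDiffAt.comp (I' := 𝓘(ℝ, Plane)) (g := fun w => extChartAt 𝓘(ℝ, E) p (u.toMap w))
        (f := fun a : u.NormalTotal => a.1) (⟨w, 0⟩ : u.NormalTotal) h1
        (contMDiffAt_proj u.Normal)).add
        ((u.incl z).contMDiff.contMDiffAt.comp (⟨w, 0⟩ : u.NormalTotal)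
          (contMDiffAt_fibCoord (p := ⟨w, 0⟩) hw))
    refine ContMDiffAt.comp (g := (extChartAt 𝓘(ℝ, E) p).symm) (⟨w, 0⟩ : u.NormalTotal) ?_ h2
    refine (contMDiffOn_extChartAt_symm p).contMDiffAt ?_
    have h3 : extChartAt 𝓘(ℝ, E) p (u.toMap w) + u.incl z (u.fibCoord z w 0) =
        extChartAt 𝓘(ℝ, E) p (u.toMap w) := by
      rw [map_zero, map_zero, add_zero]
    refine (congrArg (fun y => (extChartAt 𝓘(ℝ, E) p).target ∈ 𝓝 y) h3).mpr ?_
    exact extChartAt_target_mem_nhds' (hbase w hw.1)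
  refine ⟨φ, hsm z (u.mem_normalDomain z), ?_⟩
  filter_upwards [(u.isOpen_normalDomain z).mem_nhds (u.mem_normalDomain z)] with w hw n
  refine ⟨u.ofFib z w (u.fibCoord z w n), fibCoord_injective hw (fibCoord_ofFib hw _), ?_⟩
  have hline : MDifferentiableAt 𝓘(ℝ, ℝ) (normalModel E)
      (fun t : ℝ => (⟨w, t • n⟩ : u.NormalTotal)) 0 := by
    have := (contMDiffAt_fibre_line (u := u) (z := w) 0 n 0).mdifferentiableAt (by simp)
    simpa only [zero_add] using this
  have hc : MDifferentiableAt 𝓘(ℝ, ℝ) 𝓘(ℝ, E) (fun t : ℝ => φ ⟨w, t • n⟩) 0 := by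
    refine MDifferentiableAt.comp (g := φ) 0 ?_ hline
    simpa only [zero_smul] using (hsm w hw).mdifferentiableAt (by simp)
  have hφ : ∀ t : ℝ, φ ⟨w, t • n⟩ = (extChartAt 𝓘(ℝ, E) p).symm
      (extChartAt 𝓘(ℝ, E) p (u.toMap w) + t • u.incl z (u.fibCoord z w n)) := by
    intro t
    simp only [φ, map_smul]
  refine velocity_eq hc ?_ hw.1.2 ?_
  · rw [hφ, zero_smul, add_zero]
    exact (extChartAt 𝓘(ℝ, E) p).left_inv (by rw [extChartAt_source]; exact hw.1.2)
  · have h1 : HasDerivAt (fun t : ℝ => extChartAt 𝓘(ℝ, E) p (u.toMap w) +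
        t • u.incl z (u.fibCoord z w n)) (u.incl z (u.fibCoord z w n)) 0 := by
      simpa using ((hasDerivAt_id (0 : ℝ)).smul_const (u.incl z (u.fibCoord z w n))).const_add
        (extChartAt 𝓘(ℝ, E) p (u.toMap w))
    have h3 : u.pullCoord z w (u.ofFib z w (u.fibCoord z w n)) = u.incl z (u.fibCoord z w n) :=
      (trivializationAt E u.Pull z).continuousLinearMapAt_symmL (R := ℝ) hw.1.2 _
    rw [← pullCoord_eq_tangentCoord hw.1, h3]
    refine h1.congr_of_eventuallyEq ?_
    have h2 : (extChartAt 𝓘(ℝ, E) p).target ∈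
        𝓝 (extChartAt 𝓘(ℝ, E) p (u.toMap w) + (0 : ℝ) • u.incl z (u.fibCoord z w n)) := by
      rw [zero_smul, add_zero]
      exact extChartAt_target_mem_nhds' (hbase w hw.1)
    filter_upwards [h1.continuousAt h2] with t ht
    rw [hφ]
    exact (extChartAt 𝓘(ℝ, E) p).right_inv ht

/-- As tubular parametrizations exist around every point, the limit is determined. -/
theorem IsNBII.eq_nbII {j : AlmostComplexStructure Plane S} {J : AlmostComplexStructure E M}
    (hu : u.IsPseudoholomorphic j J) {Jc : ∀ a : u.NormalTotal,
      TangentSpace (normalModel E) a →L[ℝ] TangentSpace (normalModel E) a}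
    (h : u.IsNBII J Jc) : Jc = nbII j J u := by
  funext a
  obtain ⟨φ, hφ⟩ := u.exists_isTubularAt a.1
  refine ContinuousLinearMap.ext fun ξ => ?_
  exact tendsto_nhds_unique (X := Plane × Fib E) (h a φ hφ ξ) (isNBII_nbII hu a φ hφ ξ)

theorem nbII_sq {j : AlmostComplexStructure Plane S} {J : AlmostComplexStructure E M}
    (hu : u.IsPseudoholomorphic j J) (a : u.NormalTotal)
    (ξ : TangentSpace (normalModel E) a) : nbII j J u a (nbII j J u a ξ) = -ξ := by
  have hz := u.mem_trivDomain a.1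
  refine localNBII_sq ?_ ?_ (j.eventually_coord_sq hz.1).self_of_nhds
    (eventually_holomorphic hu hz).self_of_nhds
    (isInvertible_movingFrame (u.mem_normalDomain a.1)) _ ξ
  · rw [coord_extChartAt hz]
    exact (J.contDiffAt_coord hz.2).differentiableAt (by simp)
  · rw [coord_extChartAt hz]
    exact J.eventually_coord_sq hz.2

end SmoothImmersion
end

/-! ### The Lie bracket in coordinates -/

noncomputable section

/-- The coordinates of a vector field in the chart at `x₀`. -/
def coordField {E H M : Type*} [NormedAddCommGroup E] [NormedSpace ℝ E] [TopologicalSpace H]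
    (I : ModelWithCorners ℝ E H) [TopologicalSpace M] [ChartedSpace H M] [IsManifold I ∞ M]
    (V : ∀ x : M, TangentSpace I x) (x₀ : M) (y : E) : E :=
  tangentCoord I x₀ ((extChartAt I x₀).symm y) (V ((extChartAt I x₀).symm y))

/-- The Lie bracket in coordinates. -/
theorem mlieBracket_eq_fderiv {E H M : Type*} [NormedAddCommGroup E] [NormedSpace ℝ E]
    [TopologicalSpace H] {I : ModelWithCorners ℝ E H} [I.Boundaryless] [TopologicalSpace M]
    [ChartedSpace H M] [IsManifold I ∞ M] (V W : ∀ x : M, TangentSpace I x) (x : M) :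
    tangentCoord I x x (VectorField.mlieBracket I V W x) =
      fderiv ℝ (coordField I W x) (extChartAt I x x) (coordField I V x (extChartAt I x x)) -
        fderiv ℝ (coordField I V x) (extChartAt I x x) (coordField I W x (extChartAt I x x)) := by
  have : IsManifold I 1 M := IsManifold.of_le (n := ∞) (mod_cast le_top)
  -- the pullback of a vector field by the inverse chart is its coordinate representation
  have hV : ∀ V : ∀ x : M, TangentSpace I x,
      VectorField.mpullbackWithin 𝓘(ℝ, E) I (extChartAt I x).symm V (range I) =ᶠ[𝓝 (extChartAt I x x)]
        coordField I V x := by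
    intro V
    filter_upwards [extChartAt_target_mem_nhds (I := I) x] with y hy
    have hy' : (extChartAt I x).symm y ∈ (chartAt H x).source := by
      rw [← extChartAt_source I]
      exact (extChartAt I x).map_target hy
    rw [VectorField.mpullbackWithin_apply, coordField, tangentCoord_eq_mfderiv hy']
    refine (isInvertible_mfderivWithin_extChartAt_symm hy).inverse_apply_eq.2 ?_
    exact (congrArg (fun A => A (V ((extChartAt I x).symm y)))
      (mfderivWithin_extChartAt_symm_comp_mfderiv_extChartAt (I := I) hy)).symm
  rw [tangentCoord_self]
  have h1 : VectorField.mlieBracket I V W x = VectorField.lieBracketWithin ℝ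
      (VectorField.mpullbackWithin 𝓘(ℝ, E) I (extChartAt I x).symm V (range I))
      (VectorField.mpullbackWithin 𝓘(ℝ, E) I (extChartAt I x).symm W (range I))
      ((extChartAt I x).symm ⁻¹' univ ∩ range I) (extChartAt I x x) := by
    rw [← VectorField.mlieBracketWithin_univ, VectorField.mlieBracketWithin_apply,
      mfderiv_extChartAt_self]
    exact congrArg (fun A : E →L[ℝ] E => A _) (ContinuousLinearMap.inverse_id (R := ℝ) (M := E))
  have key : ∀ A B : E → E, A =ᶠ[𝓝 (extChartAt I x x)] coordField I V x →
      B =ᶠ[𝓝 (extChartAt I x x)] coordField I W x →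
      VectorField.lieBracketWithin ℝ A B ((extChartAt I x).symm ⁻¹' univ ∩ range I)
        (extChartAt I x x) =
      VectorField.lieBracket ℝ (coordField I V x) (coordField I W x) (extChartAt I x x) := by
    intro A B hA hB
    rw [preimage_univ, univ_inter, I.range_eq_univ, VectorField.lieBracketWithin_univ,
      hA.lieBracket_vectorField_eq hB]
  exact h1.trans (key _ _ (hV V) (hV W))

end

noncomputable section

namespace SmoothImmersion

open LocalCauchyRiemann

variable {S : Type*} [TopologicalSpace S] [ChartedSpace Plane S] [IsManifold 𝓘(ℝ, Plane) ∞ S]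
  {E : Type*} [NormedAddCommGroup E] [NormedSpace ℝ E]
  {M : Type*} [TopologicalSpace M] [ChartedSpace E M] [IsManifold 𝓘(ℝ, E) ∞ M]
  {u : SmoothImmersion S E M} {z₀ z : S}

/-! ### Tangential vector fields -/

theorem contDiffAt_coordField (X : VectorFields S) (z : S) :
    ContDiffAt ℝ ∞ (coordField 𝓘(ℝ, Plane) X z) (extChartAt 𝓘(ℝ, Plane) z z) := by
  refine contDiffAt_comp_extChartAt_symm (f := fun w => tangentCoord 𝓘(ℝ, Plane) z w (X w))
    (mem_chart_source _ z) ?_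
  have h := ((trivializationAt Plane (TangentSpace 𝓘(ℝ, Plane) : S → Type _)
    z).contMDiffOn_section_baseSet_iff (IB := 𝓘(ℝ, Plane)) (n := ∞)).1 X.contMDiff.contMDiffOn
  have hz : (chartAt Plane z).source ∈ 𝓝 z :=
    (chartAt Plane z).open_source.mem_nhds (mem_chart_source _ z)
  refine (h.contMDiffAt hz).congr_of_eventuallyEq ?_
  filter_upwards [hz] with w hw
  exact (trivializationAt_tangent_snd hw _).symm

/-- The coordinates of `du(X)`. -/
theorem coordSection_push (X : VectorFields S) : u.coordSection (u.push X) z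
    =ᶠ[𝓝 (extChartAt 𝓘(ℝ, Plane) z z)]
      fun x => fderiv ℝ (u.coord z) x (coordField 𝓘(ℝ, Plane) X z x) := by
  filter_upwards [eventually_coord_mem (u.mem_trivDomain z) (p := fun _ => True) (by simp)] with x hx
  obtain ⟨w, hw, rfl, -, -⟩ := hx
  rw [coordSection_extChartAt _ hw, coordField, left_inv_of_mem_trivDomain hw,
    fderiv_coord_tangentCoord hw]
  rfl

/-- The coordinates of the rotated vector field `j Z`. -/
theorem coordField_rotate (u : SmoothImmersion S E M) (j : AlmostComplexStructure Plane S)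
    (Z : VectorFields S) :
    coordField 𝓘(ℝ, Plane) (fun w => j.toSection w (Z w)) z =ᶠ[𝓝 (extChartAt 𝓘(ℝ, Plane) z z)]
      fun x => j.coord z x (coordField 𝓘(ℝ, Plane) Z z x) := by
  filter_upwards [eventually_coord_mem (u.mem_trivDomain z) (p := fun _ => True) (by simp)] with x hx
  obtain ⟨w, hw, rfl, -, -⟩ := hx
  rw [coordField, coordField, left_inv_of_mem_trivDomain hw, j.coord_tangentCoord hw.1]

/-- Gromov's operator restricts to the Cauchy-Riemann operator of the tangent bundle. -/
theorem gromovAt_push {j : AlmostComplexStructure Plane S} {J : AlmostComplexStructure E M}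
    (hu : u.IsPseudoholomorphic j J) (X Z : VectorFields S) :
    gromovAt j J u (u.push X) z (Z z) = u.d z (dbarTangent j X Z z) := by
  have hz := u.mem_trivDomain z
  have hX := (contDiffAt_coordField X z).differentiableAt (by simp)
  have hZ := (contDiffAt_coordField Z z).differentiableAt (by simp)
  have hj := (j.contDiffAt_coord hz.1).differentiableAt (by simp)
  have hJ : DifferentiableAt ℝ (J.coord (u.toMap z))
      (u.coord z (extChartAt 𝓘(ℝ, Plane) z z)) := by
    rw [coord_extChartAt hz]
    exact (J.contDiffAt_coord hz.2).differentiableAt (by simp)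
  have hsq := j.eventually_coord_sq hz.1
  have hval : ∀ V : VectorFields S, coordField 𝓘(ℝ, Plane) V z (extChartAt 𝓘(ℝ, Plane) z z) =
      tangentCoord 𝓘(ℝ, Plane) z z (V z) := by
    intro V
    rw [coordField, left_inv_of_mem_trivDomain hz]
  have hjZ : fderiv ℝ (coordField 𝓘(ℝ, Plane) (fun w => j.toSection w (Z w)) z)
      (extChartAt 𝓘(ℝ, Plane) z z) = _ :=
    (coordField_rotate u j Z).fderiv_eq.trans
      (hj.hasFDerivAt.clm_apply hZ.hasFDerivAt).fderiv
  apply pullCoord_injective hz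
  rw [gromovAt_apply, linCR_congr (EventuallyEq.refl _ _) (coordSection_push X),
    linCR_tangential (contDiffAt_coord hz) hJ hj hX hsq.self_of_nhds (eventually_holomorphic hu hz),
    ← fderiv_coord_tangentCoord hz]
  congr 1
  rw [dbarTangent, map_smul, map_add, ← j.coord_tangentCoord hz.1, mlieBracket_eq_fderiv,
    mlieBracket_eq_fderiv, hjZ, (coordField_rotate u j Z).self_of_nhds]
  -- the terms with the derivative of `Z` cancel because of `j² = -1`
  have h1 := fderiv_anticomm hj hsq (coordField 𝓘(ℝ, Plane) X z (extChartAt 𝓘(ℝ, Plane) z z))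
    (coordField 𝓘(ℝ, Plane) Z z (extChartAt 𝓘(ℝ, Plane) z z))
  have h2 := hsq.self_of_nhds (fderiv ℝ (coordField 𝓘(ℝ, Plane) Z z) (extChartAt 𝓘(ℝ, Plane) z z)
    (coordField 𝓘(ℝ, Plane) X z (extChartAt 𝓘(ℝ, Plane) z z)))
  simp only [add_apply, ContinuousLinearMap.comp_apply, ContinuousLinearMap.flip_apply, map_sub,
    map_add, ← hval, h1, h2]
  congr 1
  abel

/-! ### The descent to the normal bundle -/

variable [FiniteDimensional ℝ E]

/-- A section of the normal bundle in the trivialization around `z₀`. -/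
def coordNormal (u : SmoothImmersion S E M) (s : u.NormalSection) (z₀ : S) (x : Plane) : Fib E :=
  u.fibCoord z₀ ((extChartAt 𝓘(ℝ, Plane) z₀).symm x) (s ((extChartAt 𝓘(ℝ, Plane) z₀).symm x))

theorem coordNormal_extChartAt (s : u.NormalSection) (hz : z ∈ u.normalDomain z₀) :
    u.coordNormal s z₀ (extChartAt 𝓘(ℝ, Plane) z₀ z) = u.fibCoord z₀ z (s z) := by
  rw [coordNormal, left_inv_of_mem_trivDomain hz.1]

theorem contMDiffAt_fibCoord_section (s : u.NormalSection) (hz : z ∈ u.normalDomain z₀) :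
    ContMDiffAt 𝓘(ℝ, Plane) 𝓘(ℝ, Fib E) ∞ (fun w => u.fibCoord z₀ w (s w)) z :=
  ContMDiffAt.comp (I' := normalModel E) (g := fun p : u.NormalTotal => u.fibCoord z₀ p.1 p.2)
    (f := fun w => (⟨w, s w⟩ : u.NormalTotal)) z (contMDiffAt_fibCoord (p := ⟨z, s z⟩) hz)
    (s.contMDiff z)

theorem contDiffAt_coordNormal (s : u.NormalSection) (hz : z ∈ u.normalDomain z₀) :
    ContDiffAt ℝ ∞ (u.coordNormal s z₀) (extChartAt 𝓘(ℝ, Plane) z₀ z) :=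
  contDiffAt_comp_extChartAt_symm (f := fun w => u.fibCoord z₀ w (s w)) hz.1.1
    (contMDiffAt_fibCoord_section s hz)

/-- The normal part of Gromov's operator depends only on the normal part of the direction, and is
given by the NB-II structure. -/
theorem fibCoord_proj_gromovAt {j : AlmostComplexStructure Plane S}
    {J : AlmostComplexStructure E M} (hu : u.IsPseudoholomorphic j J) (v : u.PullSection)
    (ζ : TangentSpace 𝓘(ℝ, Plane) z) :
    u.fibCoord z z (u.proj z (gromovAt j J u v z ζ)) = (1 / 2 : ℝ) •
      (fderiv ℝ (u.coordNormal (u.toNormal v) z) (extChartAt 𝓘(ℝ, Plane) z z)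
          (tangentCoord 𝓘(ℝ, Plane) z z ζ) +
        (localNBII (u.coord z) (J.coord (u.toMap z)) (j.coord z (extChartAt 𝓘(ℝ, Plane) z z))
          (u.incl z) (extChartAt 𝓘(ℝ, Plane) z z)
          (u.coordNormal (u.toNormal v) z (extChartAt 𝓘(ℝ, Plane) z z))
          (tangentCoord 𝓘(ℝ, Plane) z z (j.toSection z ζ),
            fderiv ℝ (u.coordNormal (u.toNormal v) z) (extChartAt 𝓘(ℝ, Plane) z z)
              (tangentCoord 𝓘(ℝ, Plane) z z (j.toSection z ζ)))).2) := by
  have hz := u.mem_normalDomain z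
  have hinv := isInvertible_movingFrame hz
  have hJ : DifferentiableAt ℝ (J.coord (u.toMap z))
      (u.coord z (extChartAt 𝓘(ℝ, Plane) z z)) := by
    rw [coord_extChartAt hz.1]
    exact (J.contDiffAt_coord hz.1.2).differentiableAt (by simp)
  have hs := (contDiffAt_coordNormal (u.toNormal v) hz).differentiableAt (by simp)
  have hmod : ∀ᶠ x in 𝓝 (extChartAt 𝓘(ℝ, Plane) z z),
      normalCoord (u.coord z) (u.incl z) x (u.coordSection v z x) =
        normalCoord (u.coord z) (u.incl z) x (u.incl z (u.coordNormal (u.toNormal v) z x)) := by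
    filter_upwards [eventually_coord_mem_normalDomain (u := u) (z := z) (p := fun _ => True)
      (by simp)] with x hx
    obtain ⟨w, hw, rfl, -⟩ := hx
    rw [normalCoord_incl (isInvertible_movingFrame hw), coordSection_extChartAt _ hw.1,
      ← fibCoord_proj hw, coordNormal_extChartAt _ hw]
    rfl
  rw [fibCoord_proj hz, gromovAt_apply, normalCoord_linCR_congr
    (w := fun x => u.incl z (u.coordNormal (u.toNormal v) z x)) (contDiffAt_coord hz.1) hJ
    ((j.contDiffAt_coord hz.1.1).differentiableAt (by simp))
    (j.eventually_coord_sq hz.1.1).self_of_nhds (eventually_holomorphic hu hz.1) hinv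
    ((contDiffAt_coordSection v hz.1).differentiableAt (by simp))
    ((u.incl z).differentiableAt.comp _ hs) hmod, normalCoord_linCR_incl hinv hs,
    j.coord_tangentCoord hz.1.1]

theorem proj_gromovAt_congr {j : AlmostComplexStructure Plane S}
    {J : AlmostComplexStructure E M} (hu : u.IsPseudoholomorphic j J) {v w : u.PullSection}
    (h : u.toNormal v = u.toNormal w) (ζ : TangentSpace 𝓘(ℝ, Plane) z) :
    u.proj z (gromovAt j J u v z ζ) = u.proj z (gromovAt j J u w z ζ) := by
  apply fibCoord_injective (u.mem_normalDomain z)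
  rw [fibCoord_proj_gromovAt hu, fibCoord_proj_gromovAt hu, h]

end SmoothImmersion
end

/-! ### Gromov's operator on the normal bundle -/

noncomputable section

namespace SmoothImmersion

open LocalCauchyRiemann

variable {S : Type*} [TopologicalSpace S] [ChartedSpace Plane S] [IsManifold 𝓘(ℝ, Plane) ∞ S]
  {E : Type*} [NormedAddCommGroup E] [NormedSpace ℝ E] [FiniteDimensional ℝ E]
  {M : Type*} [TopologicalSpace M] [ChartedSpace E M] [IsManifold 𝓘(ℝ, E) ∞ M]
  {u : SmoothImmersion S E M} {z₀ z : S}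

/-- The representative of a section of the normal bundle in the fixed complement of `du` around `z₀`
is smooth. -/
theorem contMDiffAt_ofFib_fibCoord (s : u.NormalSection) (hz : z ∈ u.normalDomain z₀) :
    ContMDiffAt 𝓘(ℝ, Plane) (𝓘(ℝ, Plane).prod 𝓘(ℝ, E)) ∞
      (fun w => TotalSpace.mk' E (E := u.Pull) w (u.ofFib z₀ w (u.fibCoord z₀ w (s w)))) z := by
  refine ((trivializationAt E u.Pull z₀).contMDiffAt_iff (IB := 𝓘(ℝ, Plane)) (n := ∞)
    (show _ ∈ (trivializationAt E u.Pull z₀).source from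
      ((trivializationAt E u.Pull z₀).mem_source).2 hz.1.2)).2 ⟨contMDiffAt_id, ?_⟩
  refine ((u.incl z₀).contMDiff.contMDiffAt.comp z
    (contMDiffAt_fibCoord_section s hz)).congr_of_eventuallyEq ?_
  filter_upwards [(u.isOpen_normalDomain z₀).mem_nhds hz] with w hw
  refine (trivializationAt_pull_snd hw.1 _).trans ?_
  exact (trivializationAt E u.Pull z₀).continuousLinearMapAt_symmL (R := ℝ) hw.1.2 _

/-- Every smooth section of the normal bundle is represented by a smooth section of `u^*TM`: glue
local representatives by a partition of unity. -/
theorem surjective_toNormal [T2Space S] [CompactSpace S] (u : SmoothImmersion S E M) :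
    Function.Surjective u.toNormal := by
  intro s
  suffices h : ∃ v : u.PullSection, ∀ w, v w ∈ {x : u.Pull w | u.proj w x = s w} by
    obtain ⟨v, hv⟩ := h
    exact ⟨v, ContMDiffSection.ext hv⟩
  refine exists_contMDiffSection_forall_mem_convex_of_local (I := 𝓘(ℝ, Plane)) (n := ⊤)
    (F_fiber := E) u.Pull (fun w => {x : u.Pull w | u.proj w x = s w}) ?_ ?_
  · intro w x hx y hy a b _ _ hab
    change u.proj w (a • x + b • y) = s w
    rw [map_add, map_smul, map_smul, show u.proj w x = s w from hx, show u.proj w y = s w from hy,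
      ← add_smul, hab, one_smul]
  · intro z
    refine ⟨u.normalDomain z, (u.isOpen_normalDomain z).mem_nhds (u.mem_normalDomain z),
      fun w => u.ofFib z w (u.fibCoord z w (s w)),
      fun w hw => (contMDiffAt_ofFib_fibCoord s hw).contMDiffWithinAt, fun w hw => ?_⟩
    exact fibCoord_injective hw (fibCoord_ofFib hw _)

theorem toNormal_add (v w : u.PullSection) :
    u.toNormal (v + w) = u.toNormal v + u.toNormal w :=
  ContMDiffSection.ext fun z => map_add (u.proj z) _ _

theorem toNormal_smul (c : ℝ) (v : u.PullSection) : u.toNormal (c • v) = c • u.toNormal v :=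
  ContMDiffSection.ext fun z => map_smul (u.proj z) _ _

/-- A section of `u^*TM` that represents a section of the normal bundle. -/
def normalLift [T2Space S] [CompactSpace S] (u : SmoothImmersion S E M) (s : u.NormalSection) :
    u.PullSection :=
  (u.surjective_toNormal s).choose

theorem toNormal_normalLift [T2Space S] [CompactSpace S] (s : u.NormalSection) :
    u.toNormal (u.normalLift s) = s :=
  (u.surjective_toNormal s).choose_spec

/-- The normal part of a smooth one-form with values in `u^*TM` is smooth. -/
theorem contMDiff_proj_form (α : u.PullForm) :
    ContMDiff 𝓘(ℝ, Plane) (𝓘(ℝ, Plane).prod 𝓘(ℝ, Plane →L[ℝ] Fib E)) ∞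
      (fun z : S => TotalSpace.mk' (Plane →L[ℝ] Fib E)
        (E := fun z : S => TangentSpace 𝓘(ℝ, Plane) z →L[ℝ] u.Normal z) z
        ((u.proj z).comp (α z))) := by
  intro z₀
  rw [contMDiffAt_hom_bundle]
  refine ⟨contMDiffAt_id, ?_⟩
  have hz := u.mem_normalDomain z₀
  have hα := ((contMDiffAt_hom_bundle _).1 (α.contMDiff z₀)).2
  have hN : ContMDiffAt 𝓘(ℝ, Plane) 𝓘(ℝ, E →L[ℝ] Fib E) ∞ (fun z =>
      normalCoord (u.coord z₀) (u.incl z₀) (extChartAt 𝓘(ℝ, Plane) z₀ z)) z₀ := by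
    have h1 : ContDiffAt ℝ ∞ (normalCoord (u.coord z₀) (u.incl z₀))
        (extChartAt 𝓘(ℝ, Plane) z₀ z₀) :=
      contDiffAt_const.clm_comp
        (contDiffAt_movingFrame_inverse (contDiffAt_coord hz.1) (isInvertible_movingFrame hz))
    exact h1.contMDiffAt.comp z₀ (contMDiffAt_extChartAt' hz.1.1)
  refine (hN.clm_comp hα).congr_of_eventuallyEq ?_
  filter_upwards [(u.isOpen_normalDomain z₀).mem_nhds hz] with z hz
  refine ContinuousLinearMap.ext fun ζ => ?_
  exact fibCoord_proj hz (α z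
    ((trivializationAt Plane (TangentSpace 𝓘(ℝ, Plane)) z₀).symmL ℝ z ζ))

section

variable {j : AlmostComplexStructure Plane S} {J : AlmostComplexStructure E M}

/-- The normal part of a form in `Ω^{0,1}(u^*TM)`. -/
def projForm (hu : u.IsPseudoholomorphic j J) : u.PullForm01 j J →ₗ[ℝ] NormalForm01 hu where
  toFun α := ⟨⟨fun z => (u.proj z).comp ((α : u.PullForm) z), contMDiff_proj_form _⟩, by
    intro z ζ
    have h := α.2 z ζ
    change u.proj z ((α : u.PullForm) z (j.toSection z ζ)) = _
    rw [h, map_neg]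
    rfl⟩
  map_add' α β := by
    refine Subtype.ext (ContMDiffSection.ext fun z => ContinuousLinearMap.ext fun ζ => ?_)
    exact map_add (u.proj z) _ _
  map_smul' c α := by
    refine Subtype.ext (ContMDiffSection.ext fun z => ContinuousLinearMap.ext fun ζ => ?_)
    exact map_smul (u.proj z) _ _

theorem projForm_gromov_congr (hu : u.IsPseudoholomorphic j J) {v w : u.PullSection}
    (h : u.toNormal v = u.toNormal w) :
    projForm hu (gromov hu v) = projForm hu (gromov hu w) :=
  Subtype.ext (ContMDiffSection.ext fun _ => ContinuousLinearMap.ext fun ζ =>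
    proj_gromovAt_congr hu h ζ)

/-- Gromov's operator on the normal bundle, `[v] ↦ [D_u v]`; it is evaluated on a chosen lift, on
which its value does not depend. -/
def normalGromov [T2Space S] [CompactSpace S] (hu : u.IsPseudoholomorphic j J) :
    u.NormalSection →ₗ[ℝ] NormalForm01 hu where
  toFun s := projForm hu (gromov hu (u.normalLift s))
  map_add' s s' := by
    refine (projForm_gromov_congr hu (w := u.normalLift s + u.normalLift s') ?_).trans
      (((projForm hu).comp (gromov hu)).map_add _ _)
    rw [toNormal_add, toNormal_normalLift, toNormal_normalLift, toNormal_normalLift]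
  map_smul' c s := by
    refine (projForm_gromov_congr hu (w := c • u.normalLift s) ?_).trans
      (((projForm hu).comp (gromov hu)).map_smul _ _)
    rw [toNormal_smul, toNormal_normalLift, toNormal_normalLift]

theorem isDescent_normalGromov [T2Space S] [CompactSpace S] (hu : u.IsPseudoholomorphic j J) :
    IsDescent hu (gromov hu) (normalGromov hu) := fun v z ζ =>
  congrArg (fun α : NormalForm01 hu => (α : u.NormalForm) z ζ)
    (projForm_gromov_congr hu (toNormal_normalLift (u.toNormal v)))

theorem IsDescent.unique [T2Space S] [CompactSpace S] {hu : u.IsPseudoholomorphic j J}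
    {D : u.PullSection →ₗ[ℝ] u.PullForm01 j J} {D₁ D₂ : u.NormalSection →ₗ[ℝ] NormalForm01 hu}
    (h₁ : IsDescent hu D D₁) (h₂ : IsDescent hu D D₂) : D₁ = D₂ := by
  refine LinearMap.ext fun s => ?_
  obtain ⟨v, rfl⟩ := u.surjective_toNormal s
  exact Subtype.ext (ContMDiffSection.ext fun z => ContinuousLinearMap.ext fun ζ =>
    (h₁ v z ζ).trans (h₂ v z ζ).symm)

/-! ### The Cauchy-Riemann operator of the NB-II structure -/

/-- The differential of a section of the normal bundle, in the chart centred at its value. -/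
theorem mfderiv_section_apply (s : u.NormalSection) (ζ : TangentSpace 𝓘(ℝ, Plane) z) :
    (mfderiv 𝓘(ℝ, Plane) (normalModel E) (fun w => (⟨w, s w⟩ : u.NormalTotal)) z ζ : Plane × Fib E) =
      (tangentCoord 𝓘(ℝ, Plane) z z ζ, fderiv ℝ (u.coordNormal s z) (extChartAt 𝓘(ℝ, Plane) z z)
        (tangentCoord 𝓘(ℝ, Plane) z z ζ)) := by
  have hz := u.mem_normalDomain z
  have hσ : MDifferentiableAt 𝓘(ℝ, Plane) (normalModel E) (fun w => (⟨w, s w⟩ : u.NormalTotal)) z :=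
    (s.contMDiff z).mdifferentiableAt (by simp)
  have h1 := (fderiv_coord (x₀ := z) (y₀ := (⟨z, s z⟩ : u.NormalTotal)) hσ (mem_chart_source _ z)
    (mem_chart_source _ _) ζ).2
  rw [tangentCoord_self (I := normalModel E)] at h1
  have hs := (contDiffAt_coordNormal s hz).differentiableAt (by simp)
  have h2 : (fun x => extChartAt (normalModel E) (⟨z, s z⟩ : u.NormalTotal)
      ⟨(extChartAt 𝓘(ℝ, Plane) z).symm x, s ((extChartAt 𝓘(ℝ, Plane) z).symm x)⟩)
        =ᶠ[𝓝 (extChartAt 𝓘(ℝ, Plane) z z)] fun x => (x, u.coordNormal s z x) := by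
    filter_upwards [eventually_coord_mem_normalDomain (u := u) (z := z) (p := fun _ => True)
      (by simp)] with x hx
    obtain ⟨w, hw, rfl, -⟩ := hx
    rw [left_inv_of_mem_trivDomain hw.1, coordNormal_extChartAt s hw]
    exact extChartAt_normal (⟨z, s z⟩ : u.NormalTotal) ⟨w, s w⟩ hw
  have h3 := h2.fderiv_eq.trans
    ((hasFDerivAt_id (extChartAt 𝓘(ℝ, Plane) z z)).prodMk hs.hasFDerivAt).fderiv
  exact h1.symm.trans (congrArg (fun A : Plane →L[ℝ] Plane × Fib E =>
    A (tangentCoord 𝓘(ℝ, Plane) z z ζ)) h3)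

/-- In the chart centred at `s z`, half of `ds ζ + J̌ (ds (j ζ))` has the first component
`½ (ζ + j (j ζ)) = 0`, and its second component is the normal part of Gromov's operator. -/
theorem isCauchyRiemann_of_isDescent [T2Space S] [CompactSpace S] {hu : u.IsPseudoholomorphic j J}
    {D' : u.NormalSection →ₗ[ℝ] NormalForm01 hu} (h : IsDescent hu (gromov hu) D') :
    IsCauchyRiemann hu (nbII j J u) D' := by
  intro s z ζ σ ds
  obtain ⟨v, rfl⟩ := u.surjective_toNormal s
  have hz := u.mem_normalDomain z
  have hD := (congrArg (u.fibCoord z z) (h v z ζ)).trans (fibCoord_proj_gromovAt hu v ζ)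
  generalize (D' (u.toNormal v) : u.NormalForm) z ζ = n at hD ⊢
  refine (velocity_eq (x₀ := σ z) ((contMDiffAt_fibre_line _ n 0).mdifferentiableAt (by simp)) ?_
    (mem_chart_source _ _) ?_).symm
  · rw [zero_smul, add_zero]
  rw [tangentCoord_self (I := normalModel E)]
  have h1 : (fun t : ℝ => extChartAt (normalModel E) (σ z)
      (⟨z, u.toNormal v z + t • n⟩ : u.NormalTotal)) = fun t => (extChartAt 𝓘(ℝ, Plane) z z,
        u.fibCoord z z (u.toNormal v z) + t • u.fibCoord z z n) := by
    funext t
    rw [← map_smul, ← map_add]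
    exact extChartAt_normal (σ z) ⟨z, u.toNormal v z + t • n⟩ hz
  rw [h1]
  have h2 : HasDerivAt (fun t : ℝ => (extChartAt 𝓘(ℝ, Plane) z z,
      u.fibCoord z z (u.toNormal v z) + t • u.fibCoord z z n)) ((0 : Plane), u.fibCoord z z n) 0 := by
    simpa using (hasDerivAt_const (0 : ℝ) (extChartAt 𝓘(ℝ, Plane) z z)).prodMk
      (((hasDerivAt_id (0 : ℝ)).smul_const (u.fibCoord z z n)).const_add
        (u.fibCoord z z (u.toNormal v z)))
  refine h2.congr_deriv ?_
  have h3 := mfderiv_section_apply (u.toNormal v) ζ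
  have h4 := mfderiv_section_apply (u.toNormal v) (j.toSection z ζ)
  have hj := (j.eventually_coord_sq hz.1.1).self_of_nhds (tangentCoord 𝓘(ℝ, Plane) z z ζ)
  -- the tangent space of the total space at `s z` is identified with the model space by the chart
  -- centred there, so that `ds` may be replaced by its coordinate expression
  have key : ∀ p q : Plane × Fib E,
      p = (tangentCoord 𝓘(ℝ, Plane) z z ζ, fderiv ℝ (u.coordNormal (u.toNormal v) z)
        (extChartAt 𝓘(ℝ, Plane) z z) (tangentCoord 𝓘(ℝ, Plane) z z ζ)) →
      q = (tangentCoord 𝓘(ℝ, Plane) z z (j.toSection z ζ),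
        fderiv ℝ (u.coordNormal (u.toNormal v) z) (extChartAt 𝓘(ℝ, Plane) z z)
          (tangentCoord 𝓘(ℝ, Plane) z z (j.toSection z ζ))) →
      ((0 : Plane), u.fibCoord z z n) =
      (1 / 2 : ℝ) • (p + localNBII (u.coord z) (J.coord (u.toMap z))
        (j.coord z (extChartAt 𝓘(ℝ, Plane) z z)) (u.incl z) (extChartAt 𝓘(ℝ, Plane) z z)
        (u.fibCoord z z (u.toNormal v z)) q) := by
    rintro _ _ rfl rfl
    rw [hD, coordNormal_extChartAt _ hz]
    refine Prod.ext ?_ rfl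
    change (0 : Plane) = (1 / 2 : ℝ) • (tangentCoord 𝓘(ℝ, Plane) z z ζ +
      j.coord z (extChartAt 𝓘(ℝ, Plane) z z) (tangentCoord 𝓘(ℝ, Plane) z z (j.toSection z ζ)))
    rw [← j.coord_tangentCoord hz.1.1, hj, add_neg_cancel, smul_zero]
  exact key _ _ h3 h4

end

end SmoothImmersion
end

theorem mainTheorem11
    {S : Type*} [TopologicalSpace S] [T2Space S] [CompactSpace S]
    [ChartedSpace Plane S] [IsManifold 𝓘(ℝ, Plane) ∞ S]
    {E : Type*} [NormedAddCommGroup E] [NormedSpace ℝ E] [FiniteDimensional ℝ E]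
    {M : Type*} [TopologicalSpace M] [ChartedSpace E M] [IsManifold 𝓘(ℝ, E) ∞ M]
    (j : AlmostComplexStructure Plane S) (J : AlmostComplexStructure E M)
    (u : SmoothImmersion S E M) (hu : u.IsPseudoholomorphic j J) :
    -- Gromov's operator and the NB-II structure are well defined
    (∃! D : u.PullSection →ₗ[ℝ] u.PullForm01 j J, u.IsGromovOperator j J D) ∧
    (∃! Jc : ∀ a : u.NormalTotal, TangentSpace (SmoothImmersion.normalModel E) a →L[ℝ]
      TangentSpace (SmoothImmersion.normalModel E) a, u.IsNBII J Jc) ∧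
    ∀ (D : u.PullSection →ₗ[ℝ] u.PullForm01 j J)
      (Jc : ∀ a : u.NormalTotal, TangentSpace (SmoothImmersion.normalModel E) a →L[ℝ]
        TangentSpace (SmoothImmersion.normalModel E) a),
      u.IsGromovOperator j J D → u.IsNBII J Jc →
        (∀ (a : u.NormalTotal) (ξ : TangentSpace (SmoothImmersion.normalModel E) a),
          Jc a (Jc a ξ) = -ξ) ∧
        -- `D_u` restricts to `∂̄` on the tangent bundle of the curve
        (∀ (X Z : VectorFields S) (z : S),
          (D (u.push X) : u.PullForm) z (Z z) = u.d z (dbarTangent j X Z z)) ∧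
        -- `D_u` descends to a unique operator on the normal bundle
        (∃! D' : u.NormalSection →ₗ[ℝ] SmoothImmersion.NormalForm01 hu,
          SmoothImmersion.IsDescent hu D D') ∧
        -- the descended operator is the Cauchy-Riemann operator of the NB-II structure
        ∀ D' : u.NormalSection →ₗ[ℝ] SmoothImmersion.NormalForm01 hu,
          SmoothImmersion.IsDescent hu D D' → SmoothImmersion.IsCauchyRiemann hu Jc D' := by
  refine ⟨⟨_, SmoothImmersion.isGromovOperator_gromov hu, fun D hD => hD.eq_gromov hu⟩,
    ⟨_, SmoothImmersion.isNBII_nbII hu, fun Jc hJc => hJc.eq_nbII hu⟩, fun D Jc hD hJc => ?_⟩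
  rw [hD.eq_gromov hu, hJc.eq_nbII hu]
  exact ⟨SmoothImmersion.nbII_sq hu, fun X Z z => SmoothImmersion.gromovAt_push hu X Z,
    ⟨_, SmoothImmersion.isDescent_normalGromov hu,
      fun D' hD' => hD'.unique (SmoothImmersion.isDescent_normalGromov hu)⟩,
    fun D' hD' => SmoothImmersion.isCauchyRiemann_of_isDescent hD'⟩
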